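/- Work over a field $k$; maps are $k$-linear, $\otimes=\otimes_k$, and $\Delta(x)=x_{(1)}\otimes x_{(2)}$, $\epsilon$ denote the comultiplication and counit. $X^{\mathrm{cop}}$ is the opposite coalgebra, $H^{\mathrm{op}}$ the opposite algebra, $\tau$ the flip. **$q$-magma and $q$-cycle coalgebras.** A *$q$-magma coalgebra* $\mathcal X=(X;\cdot,:)$ is a coalgebra $X$ with maps $p(x\otimes y)=x\cdot y$ and $d(x\otimes y)=x:y$ from $X\otimes X$ to $X$ such that $\epsilon\circ p=\epsilon\circ d=\epsilon\otimes\epsilon$ and $x\otimes y\mapsto (y_{(1)}:x_{(2)})\otimes (x_{(1)}\cdot y_{(2)})$ is a coalgebra morphism $X\otimes X^{\mathrm{cop}}\to X^{\mathrm{cop}}\otimes X$. It is *left regular* if $\overline G(x\otimes y)=x\cdot y_{(1)}\otimes y_{(2)}$ is invertible, *right regular* if $\overline G'(x\otimes y)=(x:y_{(2)})\otimes y_{(1)}$ is invertible, and *regular* if both hold. If $\mathcal X$ is left regular, put $x^y=(X\otimes\epsilon)\,\overline G^{-1}(x\otimes y)$, ${}^xy=y_{(2)}:x^{y_{(1)}}$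 and $s_{\mathcal X}(x\otimes y)={}^{x_{(2)}}y_{(2)}\otimes x_{(1)}{}^{y_{(1)}}$. A *$q$-cycle coalgebra* is a left regular $q$-magma coalgebra such that for all $x,y,z$ $$(x\cdot y_{(1)})\cdot(z:y_{(2)})=(x\cdot z_{(2)})\cdot(y\cdot z_{(1)}),\quad (x\cdot y_{(1)}):(z\cdot y_{(2)})=(x:z_{(2)})\cdot(y:z_{(1)}),\quad (x:y_{(1)}):(z:y_{(2)})=(x:z_{(2)}):(y\cdot z_{(1)}).$$ A *$q$-cycle coalgebra morphism* is a coalgebra morphism that preserves $\cdot$ and $:$. **Very strong regularity.** $\mathcal X$ is *strongly regular* if it is regular and there are maps $p_i,d_i,gp_i,gd_i\colon X\otimes X\to X$ ($i\in\mathbb Z$), written $x\cdot_i y$, $x:_iy$, $x^{\underline y_i}$, $x_{\underline y_i}$ respectively, with $p_0=p$, $d_0=d$, $gp_0=(X\otimes\epsilon)\overline G^{-1}$, $gd_0=(X\otimes\epsilon)\overline G'^{-1}$ and, for all $i\in\mathbb Z$ and $x,y\in X$, $$x^{\underline{y_{(2)}}_i}\cdot_{i-1}y_{(1)}=(x\cdot_{i-1}y_{(2)})^{\underline{y_{(1)}}_i}=\epsilon(y)x,\qquad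 x_{\underline{y_{(1)}}_{i-1}}:_i y_{(2)}=(x:_iy_{(1)})_{\underline{y_{(2)}}_{i-1}}=\epsilon(y)x,$$ $$x^{\underline{y_{(1)}}_i}\cdot_{i}y_{(2)}=(x\cdot_{i}y_{(1)})^{\underline{y_{(2)}}_i}=\epsilon(y)x,\qquad x_{\underline{y_{(2)}}_{i}}:_i y_{(1)}=(x:_iy_{(2)})_{\underline{y_{(1)}}_{i}}=\epsilon(y)x.$$ For a coalgebra $C$, an endomorphism $t$ of the coalgebra $C\otimes C$ with components $t_1=(C\otimes\epsilon)t$ and $t_2=(\epsilon\otimes C)t$ is *left non-degenerate* if $G_t(x\otimes y)=t_2(x\otimes y_{(1)})\otimes y_{(2)}$ is invertible; then $\mathcal C_t=(C;\cdot_t,:_t)$ is given by $x\cdot_t y=(C\otimes\epsilon)G_t^{-1}(x\otimes y)$ and $x:_ty=t_1\bigl((y\cdot_t x_{(1)})\otimes x_{(2)}\bigr)$. Finally $\mathcal X$ is *very strongly regular* if it is strongly regular (which makes $s_{\mathcal X}$ invertible) and the inverse $t$ of $\tau\circ s_{\mathcal X}\circ\tau$, viewed as an endomorphism of $X^{\mathrm{cop}}\otimes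 X^{\mathrm{cop}}$, is left non-degenerate with the structure defined by $t$ on the coalgebra $X^{\mathrm{cop}}$ strongly regular. **Hopf $q$-braces.** A *Hopf $q$-brace* $\mathcal H=(H;\cdot,:)$ is a regular $q$-cycle coalgebra whose coalgebra $H$ is the underlying coalgebra of a Hopf algebra, such that both $\cdot$ and $:$ make $H$ a right $H^{\mathrm{op}}$-module and, for all $h,a,l\in H$, $$(ha)\cdot l=\bigl(h\cdot(l_{(1)}:a_{(2)})\bigr)\bigl(a_{(1)}\cdot l_{(2)}\bigr),\qquad (ha):l=\bigl(h:(l_{(1)}\cdot a_{(2)})\bigr)\bigl(a_{(1)}:l_{(2)}\bigr).$$ It *has bijective antipode* if the antipode of $H$ is bijective. A *Hopf $q$-brace morphism* is a Hopf algebra morphism that preserves $\cdot$ and $:$. **Theorem.** Let $\mathcal X$ be a very strongly regular $q$-cycle coalgebra. There exist a Hopf $q$-brace $\mathcal H_{\mathcal X}$ with bijective antipode and a $q$-cycle coalgebra morphism $\iota_{\mathcal X}\colon\mathcal X\to\mathcal H_{\mathcal X}$ which are universal: for every Hopf $q$-brace $\mathcal L$ with bijective antipode and every $q$-cycle coalgebra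 morphism $f\colon\mathcal X\to\mathcal L$ there is a unique Hopf $q$-brace morphism $\bar f\colon\mathcal H_{\mathcal X}\to\mathcal L$ with $f=\bar f\circ\iota_{\mathcal X}$. -/

import Mathlib

open scoped TensorProduct
open Coalgebra

universe u v w

namespace QBrace

/-! ### The opposite coalgebra -/

/-- A copy of `X`, which carries the opposite coalgebra structure `X^cop` when `X` is a
coalgebra. -/
def Cop (X : Type v) : Type v := X

instance Cop.instAddCommGroup (X : Type v) [AddCommGroup X] : AddCommGroup (Cop X) :=
  inferInstanceAs (AddCommGroup X)

instance Cop.instModule (k : Type u) [Field k] (X : Type v) [AddCommGroup X] [Module k X] :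
    Module k (Cop X) :=
  inferInstanceAs (Module k X)

/-- The identity map, as a linear equivalence from `X` to `X^cop`. -/
def toCop (k : Type u) [Field k] (X : Type v) [AddCommGroup X] [Module k X] : X ≃ₗ[k] Cop X :=
  LinearEquiv.refl k X

/-- The flipped comultiplication `x ↦ x₍₂₎ ⊗ x₍₁₎` of a coalgebra `X`. -/
noncomputable def comulFlip (k : Type u) [Field k] (X : Type v) [AddCommGroup X] [Module k X]
    [Coalgebra k X] : X →ₗ[k] X ⊗[k] X :=
  (TensorProduct.comm k X X).toLinearMap ∘ₗ comul

/-- The flipped comultiplication and the counit of `X` form a coalgebra structure on the vector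
space `X`. -/
noncomputable abbrev flipCoalgebra (k : Type u) [Field k] (X : Type v) [AddCommGroup X]
    [Module k X] [Coalgebra k X] : Coalgebra k X where
  comul := comulFlip k X
  counit := counit
  coassoc := by
    let F : X ⊗[k] (X ⊗[k] X) →ₗ[k] X ⊗[k] (X ⊗[k] X) :=
      (TensorProduct.assoc k X X X).toLinearMap ∘ₗ
        (TensorProduct.comm k X (X ⊗[k] X)).toLinearMap ∘ₗ
        (TensorProduct.comm k X X).toLinearMap.lTensor X
    have h1 : TensorProduct.assoc k X X X ∘ₗ (comulFlip k X).rTensor X ∘ₗ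
        (TensorProduct.comm k X X).toLinearMap = F ∘ₗ comul.lTensor X := by
      refine TensorProduct.ext' fun a b => ?_
      simp [F, comulFlip]
    have h3 : (comulFlip k X).lTensor X ∘ₗ (TensorProduct.comm k X X).toLinearMap
        = F ∘ₗ (TensorProduct.assoc k X X X).toLinearMap ∘ₗ comul.rTensor X := by
      refine TensorProduct.ext' fun a b => ?_
      have h4 : ∀ t : X ⊗[k] X, b ⊗ₜ[k] (TensorProduct.comm k X X t)
          = F (TensorProduct.assoc k X X X (t ⊗ₜ[k] b)) := by
        intro t
        induction t using TensorProduct.induction_on with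
        | zero => simp
        | tmul c d => simp [F]
        | add c d hc hd => simp only [map_add, TensorProduct.tmul_add, TensorProduct.add_tmul, hc, hd]
      simpa [comulFlip] using h4 (comul a)
    ext x
    have e1 := LinearMap.congr_fun h1 (comul x)
    have e3 := LinearMap.congr_fun h3 (comul x)
    simp only [LinearMap.comp_apply, LinearEquiv.coe_coe, comulFlip] at e1 e3 ⊢
    rw [e1, e3, coassoc_apply]
  rTensor_counit_comp_comul := by
    have h : counit.rTensor X ∘ₗ (TensorProduct.comm k X X).toLinearMap
        = (TensorProduct.comm k X k).toLinearMap ∘ₗ counit.lTensor X := by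
      refine TensorProduct.ext' fun a b => ?_
      simp
    ext x
    have e := LinearMap.congr_fun h (comul x)
    simp only [LinearMap.comp_apply, LinearEquiv.coe_coe, comulFlip] at e ⊢
    rw [e]
    simp
  lTensor_counit_comp_comul := by
    have h : counit.lTensor X ∘ₗ (TensorProduct.comm k X X).toLinearMap
        = (TensorProduct.comm k k X).toLinearMap ∘ₗ counit.rTensor X := by
      refine TensorProduct.ext' fun a b => ?_
      simp
    ext x
    have e := LinearMap.congr_fun h (comul x)
    simp only [LinearMap.comp_apply, LinearEquiv.coe_coe, comulFlip] at e ⊢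
    rw [e]
    simp

/-- The opposite coalgebra `X^cop`. -/
noncomputable instance Cop.instCoalgebra (k : Type u) [Field k] (X : Type v) [AddCommGroup X]
    [Module k X] [Coalgebra k X] : Coalgebra k (Cop X) :=
  flipCoalgebra k X

/-- A linear map between coalgebras is a coalgebra morphism. -/
def IsCoalgMap {k : Type u} [Field k] {A : Type v} {B : Type w} [AddCommGroup A] [Module k A]
    [Coalgebra k A] [AddCommGroup B] [Module k B] [Coalgebra k B] (f : A →ₗ[k] B) : Prop :=
  counit ∘ₗ f = (counit : A →ₗ[k] k) ∧ TensorProduct.map f f ∘ₗ comul = comul ∘ₗ f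

section Operations

variable {k : Type u} [Field k] {X : Type v} [AddCommGroup X] [Module k X] [Coalgebra k X]

/-! ### Auxiliary maps on `X ⊗ X` -/

/-- `X ⊗ ε`, that is `x ⊗ y ↦ ε(y) x`. -/
noncomputable def projL : X ⊗[k] X →ₗ[k] X :=
  (TensorProduct.rid k X).toLinearMap ∘ₗ counit.lTensor X

/-- `ε ⊗ X`, that is `x ⊗ y ↦ ε(x) y`. -/
noncomputable def projR : X ⊗[k] X →ₗ[k] X :=
  (TensorProduct.lid k X).toLinearMap ∘ₗ counit.rTensor X

/-- For an operation `x ⊗ y ↦ x ⋆ y`, the map `x ⊗ y ↦ x ⋆ y₍₁₎ ⊗ y₍₂₎`. -/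
noncomputable def G (p : X ⊗[k] X →ₗ[k] X) : X ⊗[k] X →ₗ[k] X ⊗[k] X :=
  p.rTensor X ∘ₗ (TensorProduct.assoc k X X X).symm.toLinearMap ∘ₗ comul.lTensor X

/-- For an operation `x ⊗ y ↦ x ⋆ y`, the map `x ⊗ y ↦ x ⋆ y₍₂₎ ⊗ y₍₁₎`, that is the map `G` of
that operation formed over the opposite coalgebra `X^cop`. -/
noncomputable def Gcop (p : X ⊗[k] X →ₗ[k] X) : X ⊗[k] X →ₗ[k] X ⊗[k] X :=
  p.rTensor X ∘ₗ (TensorProduct.assoc k X X X).symm.toLinearMap ∘ₗ (comulFlip k X).lTensor X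

/-- `(X ⊗ ε) ∘ g⁻¹` for a bijective endomorphism `g` of `X ⊗ X`. -/
noncomputable def projInv (g : X ⊗[k] X →ₗ[k] X ⊗[k] X) (hg : Function.Bijective g) :
    X ⊗[k] X →ₗ[k] X :=
  projL ∘ₗ (LinearEquiv.ofBijective g hg).symm.toLinearMap

/-! ### Regularity.  Throughout, `p` is `x ⊗ y ↦ x · y` and `d` is `x ⊗ y ↦ x : y`. -/

/-- The map `h : X ⊗ X^cop → X^cop ⊗ X`, `h (x ⊗ y) = (y₍₁₎ : x₍₂₎) ⊗ (x₍₁₎ · y₍₂₎)`.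
(The comultiplication of `X ⊗ X^cop` sends `x ⊗ y` to `(x₍₁₎ ⊗ y₍₂₎) ⊗ (x₍₂₎ ⊗ y₍₁₎)`.) -/
noncomputable def hMap (p d : X ⊗[k] X →ₗ[k] X) : X ⊗[k] Cop X →ₗ[k] Cop X ⊗[k] X :=
  (TensorProduct.comm k X (Cop X)).toLinearMap ∘ₗ
    TensorProduct.map
      (p ∘ₗ (toCop k X).symm.toLinearMap.lTensor X)
      ((toCop k X).toLinearMap ∘ₗ d ∘ₗ (TensorProduct.comm k X X).toLinearMap ∘ₗ
        (toCop k X).symm.toLinearMap.lTensor X) ∘ₗ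
    comul

/-- Left regularity: `x ⊗ y ↦ x · y₍₁₎ ⊗ y₍₂₎` is invertible. -/
abbrev IsLeftRegular (p : X ⊗[k] X →ₗ[k] X) : Prop := Function.Bijective (G p)

/-- Right regularity, that is left regularity of the opposite structure `(X^cop; :, ·)`:
`x ⊗ y ↦ x : y₍₂₎ ⊗ y₍₁₎` is invertible. -/
abbrev IsRightRegular (d : X ⊗[k] X →ₗ[k] X) : Prop := Function.Bijective (Gcop d)

/-- Strong regularity of `(X; ·, :)`: there are families `pᵢ` (`x ·ᵢ y`), `dᵢ` (`x :ᵢ y`),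
`gpᵢ` (upper index operations) and `gdᵢ` (lower index operations), `i ∈ ℤ`, which start for
`i = 0` with `p`, `d`, `(X ⊗ ε) ∘ G_𝒳` and `(X ⊗ ε) ∘ G_{𝒳^op}` and satisfy, in this order,
* `gpᵢ(x, y₍₂₎) ·ᵢ₋₁ y₍₁₎ = gpᵢ(x ·ᵢ₋₁ y₍₂₎, y₍₁₎) = ε(y) x`,
* `gdᵢ₋₁(x, y₍₁₎) :ᵢ y₍₂₎ = gdᵢ₋₁(x :ᵢ y₍₁₎, y₍₂₎) = ε(y) x`,
* `gpᵢ(x, y₍₁₎) ·ᵢ y₍₂₎ = gpᵢ(x ·ᵢ y₍₁₎, y₍₂₎) = ε(y) x`,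
* `gdᵢ(x, y₍₂₎) :ᵢ y₍₁₎ = gdᵢ(x :ᵢ y₍₂₎, y₍₁₎) = ε(y) x`. -/
def IsStronglyRegular (p d : X ⊗[k] X →ₗ[k] X) : Prop :=
  ∃ (hl : IsLeftRegular p) (hr : IsRightRegular d) (P D gp gd : ℤ → (X ⊗[k] X →ₗ[k] X)),
    P 0 = p ∧ D 0 = d ∧ gp 0 = projInv (G p) hl ∧ gd 0 = projInv (Gcop d) hr ∧
    ∀ i : ℤ,
      (P (i - 1) ∘ₗ Gcop (gp i) = projL ∧ gp i ∘ₗ Gcop (P (i - 1)) = projL) ∧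
      (D i ∘ₗ G (gd (i - 1)) = projL ∧ gd (i - 1) ∘ₗ G (D i) = projL) ∧
      (P i ∘ₗ G (gp i) = projL ∧ gp i ∘ₗ G (P i) = projL) ∧
      (D i ∘ₗ Gcop (gd i) = projL ∧ gd i ∘ₗ Gcop (D i) = projL)

/-! ### Passing between operations and endomorphisms of `X ⊗ X` -/

/-- The operation `x ⊗ y ↦ x^y` of a left regular structure. -/
noncomputable def sup (p : X ⊗[k] X →ₗ[k] X) (hl : IsLeftRegular p) : X ⊗[k] X →ₗ[k] X :=
  projInv (G p) hl

/-- The operation `x ⊗ y ↦ ˣy = y₍₂₎ : x^{y₍₁₎}` of a left regular structure. -/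
noncomputable def lsup (p d : X ⊗[k] X →ₗ[k] X) (hl : IsLeftRegular p) : X ⊗[k] X →ₗ[k] X :=
  d ∘ₗ (TensorProduct.comm k X X).toLinearMap ∘ₗ G (sup p hl)

/-- The endomorphism `s_𝒳` of `X ⊗ X`, `s (x ⊗ y) = ˣ⁽²⁾y₍₂₎ ⊗ x₍₁₎^{y₍₁₎}`. -/
noncomputable def sMap (p d : X ⊗[k] X →ₗ[k] X) (hl : IsLeftRegular p) :
    X ⊗[k] X →ₗ[k] X ⊗[k] X :=
  (TensorProduct.comm k X X).toLinearMap ∘ₗ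
    TensorProduct.map (sup p hl) (lsup p d hl) ∘ₗ comul

/-- Left non-degeneracy of an endomorphism `t` of `X ⊗ X`: the map
`x ⊗ y ↦ t₂(x ⊗ y₍₁₎) ⊗ y₍₂₎` is invertible, where `t₂ = (ε ⊗ X) ∘ t`. -/
abbrev IsLeftNondegenerate (t : X ⊗[k] X →ₗ[k] X ⊗[k] X) : Prop :=
  Function.Bijective (G (projR ∘ₗ t))

/-- The operation `x · y` of `𝒳_t`, namely `(X ⊗ ε) ∘ G_t⁻¹`. -/
noncomputable def dotOf (t : X ⊗[k] X →ₗ[k] X ⊗[k] X) (ht : IsLeftNondegenerate t) :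
    X ⊗[k] X →ₗ[k] X :=
  projInv (G (projR ∘ₗ t)) ht

/-- The operation `x : y = t₁((y · x₍₁₎) ⊗ x₍₂₎)` of `𝒳_t`, where `t₁ = (X ⊗ ε) ∘ t`. -/
noncomputable def colonOf (t : X ⊗[k] X →ₗ[k] X ⊗[k] X) (ht : IsLeftNondegenerate t) :
    X ⊗[k] X →ₗ[k] X :=
  (projL ∘ₗ t) ∘ₗ G (dotOf t ht) ∘ₗ (TensorProduct.comm k X X).toLinearMap

/-- For a bijective endomorphism `s` of `X ⊗ X`, the inverse of `s_τ = τ ∘ s ∘ τ`, regarded as an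
endomorphism of `X^cop ⊗ X^cop`. -/
noncomputable def tildeTauInv (s : X ⊗[k] X →ₗ[k] X ⊗[k] X) (hs : Function.Bijective s) :
    Cop X ⊗[k] Cop X →ₗ[k] Cop X ⊗[k] Cop X :=
  TensorProduct.map (toCop k X).toLinearMap (toCop k X).toLinearMap ∘ₗ
    (TensorProduct.comm k X X).toLinearMap ∘ₗ
    (LinearEquiv.ofBijective s hs).symm.toLinearMap ∘ₗ
    (TensorProduct.comm k X X).toLinearMap ∘ₗ
    TensorProduct.map (toCop k X).symm.toLinearMap (toCop k X).symm.toLinearMap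

/-- Very strong regularity: `(X; ·, :)` is strongly regular, and for `s = s_𝒳` the map
`t = s̃_τ⁻¹` on `X^cop ⊗ X^cop` is left non-degenerate with `𝒳_t` strongly regular (over the
coalgebra `X^cop`).  The map `s` is automatically bijective when `𝒳` is strongly regular. -/
def IsVeryStronglyRegular (p d : X ⊗[k] X →ₗ[k] X) : Prop :=
  IsStronglyRegular p d ∧
    ∃ (hl : IsLeftRegular p) (hs : Function.Bijective (sMap p d hl))
      (ht : IsLeftNondegenerate (tildeTauInv (sMap p d hl) hs)),
      IsStronglyRegular (dotOf (tildeTauInv (sMap p d hl) hs) ht)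
        (colonOf (tildeTauInv (sMap p d hl) hs) ht)

end Operations

/-! ### `q`-magma coalgebras, `q`-cycle coalgebras and Hopf `q`-braces -/

/-- A `q`-magma coalgebra structure `(X; ·, :)` on the coalgebra `X`. -/
structure QMagmaCoalgebra (k : Type u) [Field k] (X : Type v) [AddCommGroup X] [Module k X]
    [Coalgebra k X] where
  /-- `x ⊗ y ↦ x · y` -/
  p : X ⊗[k] X →ₗ[k] X
  /-- `x ⊗ y ↦ x : y` -/
  d : X ⊗[k] X →ₗ[k] X
  counit_p : counit ∘ₗ p = (counit : X ⊗[k] X →ₗ[k] k)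
  counit_d : counit ∘ₗ d = (counit : X ⊗[k] X →ₗ[k] k)
  isCoalgMap_hMap : IsCoalgMap (hMap p d)

/-- `x · y` -/
def QMagmaCoalgebra.dot {k : Type u} [Field k] {X : Type v} [AddCommGroup X] [Module k X]
    [Coalgebra k X] (𝒳 : QMagmaCoalgebra k X) (x y : X) : X := 𝒳.p (x ⊗ₜ[k] y)

/-- `x : y` -/
def QMagmaCoalgebra.colon {k : Type u} [Field k] {X : Type v} [AddCommGroup X] [Module k X]
    [Coalgebra k X] (𝒳 : QMagmaCoalgebra k X) (x y : X) : X := 𝒳.d (x ⊗ₜ[k] y)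

/-- Compatibility of a map with the two operations.  A morphism of `q`-magma coalgebras, and
in particular of `q`-cycle coalgebras, is a coalgebra morphism with this property. -/
def PreservesOps {k : Type u} [Field k] {X : Type v} [AddCommGroup X] [Module k X]
    [Coalgebra k X] {Y : Type w} [AddCommGroup Y] [Module k Y] [Coalgebra k Y]
    (𝒳 : QMagmaCoalgebra k X) (𝒴 : QMagmaCoalgebra k Y) (f : X → Y) : Prop :=
  ∀ x x' : X, f (𝒳.dot x x') = 𝒴.dot (f x) (f x') ∧ f (𝒳.colon x x') = 𝒴.colon (f x) (f x')

/-- A `q`-cycle coalgebra: a left regular `q`-magma coalgebra such that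
* `(x · y₍₁₎) · (z : y₍₂₎) = (x · z₍₂₎) · (y · z₍₁₎)`,
* `(x · y₍₁₎) : (z · y₍₂₎) = (x : z₍₂₎) · (y : z₍₁₎)`,
* `(x : y₍₁₎) : (z : y₍₂₎) = (x : z₍₂₎) : (y · z₍₁₎)`.

Here `ℛ k y` is a chosen expression `comul y = ∑ i, left i ⊗ right i`; the sums do not depend
on the choice, as they are linear in `left i ⊗ right i`. -/
structure QCycleCoalgebra (k : Type u) [Field k] (X : Type v) [AddCommGroup X] [Module k X]
    [Coalgebra k X] extends QMagmaCoalgebra k X where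
  leftRegular : IsLeftRegular p
  cycle_dot_dot : ∀ x y z : X,
    ∑ i ∈ (ℛ k y).index, toQMagmaCoalgebra.dot (toQMagmaCoalgebra.dot x ((ℛ k y).left i))
        (toQMagmaCoalgebra.colon z ((ℛ k y).right i)) =
      ∑ j ∈ (ℛ k z).index, toQMagmaCoalgebra.dot (toQMagmaCoalgebra.dot x ((ℛ k z).right j))
        (toQMagmaCoalgebra.dot y ((ℛ k z).left j))
  cycle_dot_colon : ∀ x y z : X,
    ∑ i ∈ (ℛ k y).index, toQMagmaCoalgebra.colon (toQMagmaCoalgebra.dot x ((ℛ k y).left i))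
        (toQMagmaCoalgebra.dot z ((ℛ k y).right i)) =
      ∑ j ∈ (ℛ k z).index, toQMagmaCoalgebra.dot (toQMagmaCoalgebra.colon x ((ℛ k z).right j))
        (toQMagmaCoalgebra.colon y ((ℛ k z).left j))
  cycle_colon_colon : ∀ x y z : X,
    ∑ i ∈ (ℛ k y).index, toQMagmaCoalgebra.colon (toQMagmaCoalgebra.colon x ((ℛ k y).left i))
        (toQMagmaCoalgebra.colon z ((ℛ k y).right i)) =
      ∑ j ∈ (ℛ k z).index, toQMagmaCoalgebra.colon (toQMagmaCoalgebra.colon x ((ℛ k z).right j))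
        (toQMagmaCoalgebra.dot y ((ℛ k z).left j))

/-- A Hopf `q`-brace: a regular `q`-cycle coalgebra on a Hopf algebra `H` such that both operations
make `H` a right `H^op`-module and
* `(h k) · l = (h · (l₍₁₎ : k₍₂₎)) (k₍₁₎ · l₍₂₎)`,
* `(h k) : l = (h : (l₍₁₎ · k₍₂₎)) (k₍₁₎ : l₍₂₎)`. -/
structure HopfQBrace (k : Type u) [Field k] (H : Type v) [Ring H] [HopfAlgebra k H]
    extends QCycleCoalgebra k H where
  rightRegular : IsRightRegular d
  dot_one : ∀ h : H, toQMagmaCoalgebra.dot h 1 = h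
  dot_mul : ∀ h a b : H,
    toQMagmaCoalgebra.dot h (a * b) = toQMagmaCoalgebra.dot (toQMagmaCoalgebra.dot h b) a
  colon_one : ∀ h : H, toQMagmaCoalgebra.colon h 1 = h
  colon_mul : ∀ h a b : H,
    toQMagmaCoalgebra.colon h (a * b) = toQMagmaCoalgebra.colon (toQMagmaCoalgebra.colon h b) a
  mul_dot : ∀ h a l : H,
    toQMagmaCoalgebra.dot (h * a) l =
      ∑ i ∈ (ℛ k a).index, ∑ j ∈ (ℛ k l).index,
        toQMagmaCoalgebra.dot h (toQMagmaCoalgebra.colon ((ℛ k l).left j) ((ℛ k a).right i)) *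
          toQMagmaCoalgebra.dot ((ℛ k a).left i) ((ℛ k l).right j)
  mul_colon : ∀ h a l : H,
    toQMagmaCoalgebra.colon (h * a) l =
      ∑ i ∈ (ℛ k a).index, ∑ j ∈ (ℛ k l).index,
        toQMagmaCoalgebra.colon h (toQMagmaCoalgebra.dot ((ℛ k l).left j) ((ℛ k a).right i)) *
          toQMagmaCoalgebra.colon ((ℛ k a).left i) ((ℛ k l).right j)

end QBrace

/-!
The Hopf algebra of the theorem is the free Hopf algebra `H = FreeHopf k X` with bijective antipode
`S` on the coalgebra `X`, generated by symbols `Sⁱ(x)` with `i : ℤ`.  It is enough to extend the two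
operations from `X` to `H`.  In a Hopf `q`-brace the antipode satisfies
`S(y₍₁₎) · (l : y₍₂₎) = S(y · l)`, so that the operations on `X` force those on all `Sⁱ(x)`, provided
that certain convolution inverses exist.  Very strong regularity is exactly what supplies them: it
yields operations `D i j` and `K i j` on `X`, which stand for `Sⁱ(y) · Sʲ(l)` and `Sⁱ(y) : Sʲ(l)`,
with all the relations that hold in a Hopf `q`-brace (`IsLevelSystem`, `exists_isLevelSystem`).

Instead of the notation of Sweedler, multiplicative matrices are used: square matrices `u` with
`Δ u_ab = ∑ c, u_ac ⊗ u_cb` and `ε u_ab = δ_ab`.  Their entries span `X` (`exists_isMult`), so that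
linear maps are compared on entries (`ext_isMult`), where identities with comultiplications become
identities between finite sums.  The matrices `Sⁱ(u)` and `Sⁱ⁺¹(u)` over `H` are inverse to one
another, up to transposition for odd `i`.  Hence a linear map between representations of `H` which
commutes with the action of `X` commutes with the action of `H` (`FreeHopf.intertwines`).  This
lemma carries the rest of the proof.

The operations on `H` are encoded in representations.  The relations of a level system say that
`l ↦ (y ⊗ c ↦ y₍₁₎ · l₍₂₎ ⊗ (l₍₁₎ : y₍₂₎) c)` satisfies the antipode relations, so that it defines a
representation of `H` on `X ⊗ H` (`twistRep`).  Exchanging the roles of the two arguments, one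
obtains from it the representation `a ↦ (l ⊗ c ↦ (l₍₁₎ : a₍₂₎) ⊗ (a₍₁₎ · l₍₂₎) c)` of `H` on `H ⊗ H`
(`freeRep`), and applying the counit to either factor gives the two operations on `H`.  That the
action of `a` is compatible with products, counits and comultiplications in `l` is a statement about
intertwining maps, hence it need only be checked for `a` in `X` (`isBraceRep_freeRep`).  It implies
the module laws, the product rules and the `q`-magma axiom.  The identities of a `q`-cycle coalgebra
are also intertwining relations, and they pass from `X` to `H` one argument at a time
(`star_eq_of_cycleIdentities`, `IsLevelSystem.isCycle`).  Regularity follows from the module laws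
and the bijectivity of the antipode (`bijective_G_of_module`).

For universality, let `f : X → L` be a morphism to a Hopf `q`-brace with bijective antipode.  The
operations of `L` define a similar representation of `L` on `L ⊗ L` (`crossRep`).  The morphism
`H → L` of Hopf algebras which extends `f` intertwines it with `freeRep`, since it does so for
elements of `X`, and therefore preserves the operations (`liftHopf_dot_colon`).  It is unique,
because morphisms from `H` are determined by their values on `X` (`FreeHopf.algHom_ext_zero`).
-/

namespace QBrace

/-! ### Multiplicative matrices -/

section MultiplicativeMatrices

variable {k : Type u} [Field k] {X : Type v} [AddCommGroup X] [Module k X] [Coalgebra k X]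

/-- The comultiplication of level `i ∈ ℤ` of a coalgebra `X`: the comultiplication of `X` when `i`
is even and that of `X^cop` when `i` is odd. -/
noncomputable def levelComul (k : Type u) [Field k] (X : Type v) [AddCommGroup X] [Module k X]
    [Coalgebra k X] (i : ℤ) : X →ₗ[k] X ⊗[k] X :=
  if Even i then comul else comulFlip k X

/-- A square matrix `u` with entries in `X` is multiplicative of level `i` when
`Δ u_ab = ∑ c, u_ac ⊗ u_cb` and `ε u_ab = δ_ab`, where `Δ` is the comultiplication of level `i`. -/
structure IsMult (k : Type u) [Field k] {X : Type v} [AddCommGroup X] [Module k X]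
    [Coalgebra k X] (i : ℤ) {n : Type} [Fintype n] [DecidableEq n] (u : n → n → X) : Prop where
  comul_apply : ∀ a b, levelComul k X i (u a b) = ∑ c, u a c ⊗ₜ[k] u c b
  counit_apply : ∀ a b, counit (R := k) (u a b) = if a = b then 1 else 0

variable {n m : Type} [Fintype n] [DecidableEq n] [Fintype m] [DecidableEq m]

theorem levelComul_of_even {i : ℤ} (hi : Even i) : levelComul k X i = comul := if_pos hi

theorem levelComul_of_odd {i : ℤ} (hi : ¬ Even i) : levelComul k X i = comulFlip k X := if_neg hi

@[simp] theorem levelComul_zero : levelComul k X 0 = comul := levelComul_of_even Even.zero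

theorem levelComul_congr {i j : ℤ} (h : Even i ↔ Even j) :
    levelComul k X i = levelComul k X j := by
  unfold levelComul; simp only [h]

theorem comm_comp_levelComul (i : ℤ) (x : X) :
    TensorProduct.comm k X X (levelComul k X i x) = levelComul k X (i + 1) x := by
  by_cases hi : Even i
  · rw [levelComul_of_even hi, levelComul_of_odd (by rw [Int.even_add_one]; exact not_not.2 hi)]
    rfl
  · rw [levelComul_of_odd hi, levelComul_of_even (by rw [Int.even_add_one]; exact hi)]
    simp [comulFlip]

theorem IsMult.congr {i j : ℤ} {u : n → n → X} (hu : IsMult k i u) (h : Even i ↔ Even j) :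
    IsMult k j u :=
  ⟨fun a b => by rw [← levelComul_congr h, hu.comul_apply], hu.counit_apply⟩

theorem IsMult.transpose {i : ℤ} {u : n → n → X} (hu : IsMult k i u) :
    IsMult k (i + 1) (fun a b => u b a) :=
  ⟨fun a b => by
    rw [← comm_comp_levelComul, hu.comul_apply, map_sum]
    simp, fun a b => by rw [hu.counit_apply]; simp [eq_comm]⟩

theorem IsMult.transpose' {i : ℤ} {u : n → n → X} (hu : IsMult k (i + 1) u) :
    IsMult k i (fun a b => u b a) :=
  hu.transpose.congr (by simp)

/-- The coefficients of `Δ` with respect to a basis of a finite-dimensional left coideal form a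
multiplicative matrix. -/
theorem exists_isMult_zero (x : X) :
    ∃ (r : ℕ) (u : Fin r → Fin r → X), IsMult k 0 u ∧
      x ∈ Submodule.span k (Set.range fun p : Fin r × Fin r => u p.1 p.2) := by
  classical
  let B := Module.Basis.ofVectorSpace k X
  -- write `Δ x = ∑ i ∈ F, B i ⊗ y i`
  let y := TensorProduct.equivFinsuppOfBasisLeft (N := X) B (comul x)
  have hy : comul x = y.sum fun i z => B i ⊗ₜ[k] z := by
    rw [← TensorProduct.equivFinsuppOfBasisLeft_symm_apply, LinearEquiv.symm_apply_apply]
  let W : Submodule k X := Submodule.span k (y.support.image y : Set X)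
  have : FiniteDimensional k W := FiniteDimensional.span_finset k _
  have hyW : ∀ i, y i ∈ W := by
    intro i
    by_cases hi : i ∈ y.support
    · exact Submodule.subset_span (Finset.mem_coe.2 (Finset.mem_image_of_mem y hi))
    · rw [Finsupp.notMem_support_iff.1 hi]; exact zero_mem _
  have hxW : x ∈ W := by
    have h := congrArg ((TensorProduct.lid k X).toLinearMap ∘ₗ counit.rTensor X) hy
    simp only [LinearMap.comp_apply, LinearEquiv.coe_coe, rTensor_counit_comul,
      TensorProduct.lid_tmul, one_smul, Finsupp.sum, map_sum, LinearMap.rTensor_tmul] at h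
    rw [h]
    exact sum_mem fun i _ => Submodule.smul_mem _ _ (hyW i)
  let R := LinearMap.range (W.subtype.lTensor X)
  -- coassociativity, read off in the first tensor factor, shows that `W` is a left coideal
  have hco : ∀ l, comul (y l) = ∑ i ∈ y.support,
      ((TensorProduct.equivFinsuppOfBasisLeft (N := X) B (comul (B i))) l) ⊗ₜ[k] y i := by
    intro l
    have h := coassoc_apply (R := k) x
    rw [hy] at h
    simp only [Finsupp.sum, map_sum, LinearMap.rTensor_tmul, LinearMap.lTensor_tmul] at h
    have h2 := congrArg (fun t => TensorProduct.equivFinsuppOfBasisLeft (N := X ⊗[k] X) B t l) h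
    simp only [map_sum, Finsupp.finsetSum_apply,
      TensorProduct.equivFinsuppOfBasisLeft_apply_tmul_apply] at h2
    have h3 : ∀ (t : X ⊗[k] X) (z : X), TensorProduct.equivFinsuppOfBasisLeft (N := X ⊗[k] X) B
        (TensorProduct.assoc k X X X (t ⊗ₜ[k] z)) l
        = (TensorProduct.equivFinsuppOfBasisLeft (N := X) B t l) ⊗ₜ[k] z := by
      intro t z
      induction t using TensorProduct.induction_on with
      | zero => simp
      | tmul c d =>
        simp [TensorProduct.smul_tmul']
      | add c d hc hd =>
        simp only [TensorProduct.add_tmul, map_add, Finsupp.add_apply, hc, hd]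
    simp only [h3] at h2
    rw [h2]
    simp only [Module.Basis.repr_self]
    rw [Finset.sum_eq_single l]
    · simp
    · intro b _ hb
      simp [hb]
    · intro hl
      simp [Finsupp.notMem_support_iff.1 hl]
  have hWR : ∀ z ∈ W, comul z ∈ R := by
    intro z hz
    induction hz using Submodule.span_induction with
    | mem z hz =>
      simp only [Finset.coe_image, Set.mem_image] at hz
      obtain ⟨l, -, rfl⟩ := hz
      rw [hco]
      exact sum_mem fun i _ => ⟨_ ⊗ₜ ⟨y i, hyW i⟩, LinearMap.lTensor_tmul _ _ _ _⟩
    | zero => simp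
    | add a b _ _ ha hb => rw [map_add]; exact add_mem ha hb
    | smul c a _ ha => rw [map_smul]; exact R.smul_mem _ ha
  obtain ⟨r, ⟨e⟩⟩ : ∃ r, Nonempty (Module.Basis (Fin r) k W) := ⟨_, ⟨Module.finBasis k W⟩⟩
  have hex : ∀ j : Fin r, ∃ t : Fin r → X, comul (e j : X) = ∑ i, t i ⊗ₜ[k] (e i : X) := by
    intro j
    obtain ⟨t, ht⟩ := hWR (e j) (e j).2
    refine ⟨fun i => TensorProduct.equivFinsuppOfBasisRight (M := X) e t i, ?_⟩
    rw [← ht]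
    conv_lhs => rw [← (TensorProduct.equivFinsuppOfBasisRight (M := X) e).symm_apply_apply t,
      TensorProduct.equivFinsuppOfBasisRight_symm_apply, Finsupp.sum_fintype _ _ (by simp)]
    simp
  choose t ht using hex
  -- dual functionals of the independent family `e`
  have hli : LinearIndependent k (fun i => (e i : X)) :=
    e.linearIndependent.map' W.subtype (Submodule.ker_subtype W)
  have hinj : ∀ {M : Type v} [AddCommGroup M] [Module k M] (a b : Fin r → M),
      ∑ i, a i ⊗ₜ[k] (e i : X) = ∑ i, b i ⊗ₜ[k] (e i : X) → a = b := by
    intro M _ _ a b hab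
    have h2 : ∑ i, a i ⊗ₜ[k] e i = ∑ i, b i ⊗ₜ[k] e i := by
      apply Module.Flat.lTensor_preserves_injective_linearMap (M := M) W.subtype
        W.injective_subtype
      simpa using hab
    have h3 := congrArg (TensorProduct.equivFinsuppOfBasisRight (M := M) e) h2
    funext i
    have h4 := DFunLike.congr_fun h3 i
    simpa [TensorProduct.equivFinsuppOfBasisRight_apply_tmul_apply, Finsupp.finsetSum_apply,
      Finsupp.single_apply] using h4
  refine ⟨r, t, ⟨fun a b => ?_, fun a b => ?_⟩, ?_⟩
  · have h1 := coassoc_apply (R := k) (e a : X)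
    rw [ht a] at h1
    simp only [map_sum, LinearMap.rTensor_tmul, LinearMap.lTensor_tmul, ht,
      TensorProduct.tmul_sum] at h1
    rw [Finset.sum_comm] at h1
    have h2 : ∑ i, (comul (t a i)) ⊗ₜ[k] (e i : X)
        = ∑ i, (∑ c, t a c ⊗ₜ[k] t c i) ⊗ₜ[k] (e i : X) := by
      apply (TensorProduct.assoc k X X X).injective
      rw [map_sum, map_sum, h1]
      simp [TensorProduct.sum_tmul]
    rw [levelComul_zero]
    exact congrFun (hinj _ _ h2) b
  · have h1 := rTensor_counit_comul (R := k) (e a : X)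
    rw [ht a] at h1
    simp only [map_sum, LinearMap.rTensor_tmul] at h1
    have h5 := congrArg (TensorProduct.lid k X) h1
    simp only [map_sum, TensorProduct.lid_tmul, one_smul] at h5
    have h6 : ∑ i, counit (R := k) (t a i) • (e i : X) = ∑ i, (if a = i then (1 : k) else 0) • (e i : X) := by
      rw [h5]; simp
    have h7 := Fintype.linearIndependent_iff.1 hli
      (fun i => counit (R := k) (t a i) - if a = i then 1 else 0)
      (by rw [← sub_eq_zero.2 h6, ← Finset.sum_sub_distrib]; simp only [sub_smul]) b
    exact sub_eq_zero.1 h7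
  · have hmem : ∀ j, (e j : X) ∈ Submodule.span k
        (Set.range fun p : Fin r × Fin r => t p.1 p.2) := by
      intro j
      have h1 := lTensor_counit_comul (R := k) (e j : X)
      rw [ht j] at h1
      have h5 := congrArg (TensorProduct.rid k X) h1
      simp only [map_sum, LinearMap.lTensor_tmul, TensorProduct.rid_tmul, one_smul] at h5
      rw [← h5]
      exact sum_mem fun i _ => Submodule.smul_mem _ _ (Submodule.subset_span ⟨(j, i), rfl⟩)
    have h8 := e.sum_repr ⟨x, hxW⟩
    have h9 := congrArg W.subtype h8
    simp only [map_sum, map_smul, Submodule.subtype_apply] at h9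
    rw [← h9]
    exact sum_mem fun i _ => Submodule.smul_mem _ _ (hmem i)

/-- Every element lies in the span of the entries of a multiplicative matrix: this is the fundamental
theorem of coalgebras, in the form used throughout instead of the notation of Sweedler. -/
theorem exists_isMult (i : ℤ) (x : X) :
    ∃ (r : ℕ) (u : Fin r → Fin r → X), IsMult k i u ∧
      x ∈ Submodule.span k (Set.range fun p : Fin r × Fin r => u p.1 p.2) := by
  obtain ⟨r, u, hu, hx⟩ := exists_isMult_zero (k := k) x
  by_cases hi : Even i
  · exact ⟨r, u, hu.congr (by simp [hi]), hx⟩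
  · refine ⟨r, fun a b => u b a, hu.transpose.congr (by simp [hi]), ?_⟩
    refine Submodule.span_mono ?_ hx
    rintro _ ⟨p, rfl⟩
    exact ⟨(p.2, p.1), rfl⟩

/-- Linear maps which agree on the entries of all multiplicative matrices are equal. -/
theorem ext_isMult (i : ℤ) {M : Type w} [AddCommGroup M] [Module k M] {f g : X →ₗ[k] M}
    (h : ∀ (r : ℕ) (u : Fin r → Fin r → X), IsMult k i u → ∀ a b, f (u a b) = g (u a b)) :
    f = g := by
  ext x
  obtain ⟨r, u, hu, hx⟩ := exists_isMult (k := k) i x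
  have hle : Submodule.span k (Set.range fun p : Fin r × Fin r => u p.1 p.2)
      ≤ LinearMap.eqLocus f g := by
    rw [Submodule.span_le]
    rintro _ ⟨p, rfl⟩
    exact h r u hu p.1 p.2
  exact hle hx

theorem ext_isMult₂ (i j : ℤ) {Y : Type*} [AddCommGroup Y] [Module k Y] [Coalgebra k Y]
    {M : Type w} [AddCommGroup M] [Module k M] {f g : X →ₗ[k] Y →ₗ[k] M}
    (h : ∀ (r s : ℕ) (u : Fin r → Fin r → X) (w : Fin s → Fin s → Y), IsMult k i u →
      IsMult k j w → ∀ a b c d, f (u a b) (w c d) = g (u a b) (w c d)) : f = g :=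
  ext_isMult i fun r u hu a b => ext_isMult j fun s w hw c d => h r s u w hu hw a b c d

end MultiplicativeMatrices

section LinearSystems

variable {k : Type u} [Field k] {Z : Type v} [AddCommGroup Z] [Module k Z]
variable {n : Type} [Fintype n] [DecidableEq n]

/-- Solving a linear system whose coefficients are operators, by a left inverse of the matrix of
coefficients. -/
theorem sum_eq_of_leftInverse {M N : n → n → Z → Z} {r s : n → Z}
    (hM : ∀ p q, ∀ (t : n → Z), M p q (∑ l, t l) = ∑ l, M p q (t l))
    (hMN : ∀ p q z, ∑ l, M p l (N l q z) = if p = q then z else 0)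
    (hs : ∀ p, ∑ q, N p q (r q) = s p) (p : n) : ∑ q, M p q (s q) = r p := by
  simp only [← hs, hM]
  rw [Finset.sum_comm]
  simp [hMN]

end LinearSystems

end QBrace

namespace QBrace

/-! ### Matrices of operators -/

section MatricesOfOperators

variable {k : Type u} [Field k] {X : Type v} [AddCommGroup X] [Module k X]
variable {n : Type} [Fintype n] [DecidableEq n]

theorem sum_map_left {Y Z W : Type*} [AddCommGroup Y] [Module k Y] [AddCommGroup Z] [Module k Z]
    [AddCommGroup W] [Module k W] {V : Type*} [AddCommGroup V] [Module k V] {ι : Type*}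
    (s : Finset ι) (f : ι → Y →ₗ[k] Z) (g : W →ₗ[k] V)
    (t : Y ⊗[k] W) : ∑ i ∈ s, TensorProduct.map (f i) g t = TensorProduct.map (∑ i ∈ s, f i) g t := by
  rw [← TensorProduct.mapBilinear_apply, map_sum, LinearMap.sum_apply, LinearMap.sum_apply]
  rfl

theorem sum_map_right {Y Z W : Type*} [AddCommGroup Y] [Module k Y] [AddCommGroup Z] [Module k Z]
    [AddCommGroup W] [Module k W] {V : Type*} [AddCommGroup V] [Module k V] {ι : Type*}
    (s : Finset ι) (f : Y →ₗ[k] Z) (g : ι → W →ₗ[k] V)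
    (t : Y ⊗[k] W) : ∑ i ∈ s, TensorProduct.map f (g i) t = TensorProduct.map f (∑ i ∈ s, g i) t := by
  rw [← TensorProduct.mapBilinear_apply, map_sum, LinearMap.sum_apply]
  rfl

/-- The matrix `c'` is a left inverse of the matrix `c`, entries being multiplied by composition. -/
def IsLeftInv (c' c : n → n → X →ₗ[k] X) : Prop :=
  ∀ a b, ∑ e, c' a e ∘ₗ c e b = if a = b then LinearMap.id else 0

variable {c c' d d' : n → n → X →ₗ[k] X} {Δ Δ' Γ : X →ₗ[k] X ⊗[k] X}

theorem map_map_apply (f g f' g' : X →ₗ[k] X) (t : X ⊗[k] X) :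
    TensorProduct.map f g (TensorProduct.map f' g' t) = TensorProduct.map (f ∘ₗ f') (g ∘ₗ g') t := by
  rw [TensorProduct.map_comp]; rfl

theorem sum_ite_map_left (f : n → X →ₗ[k] X) (a : n) (t : X ⊗[k] X) :
    ∑ b, TensorProduct.map (if a = b then LinearMap.id else 0) (f b) t
      = TensorProduct.map LinearMap.id (f a) t := by
  rw [Finset.sum_eq_single a]
  · rw [if_pos rfl]
  · intro b _ hb
    rw [if_neg (Ne.symm hb), TensorProduct.map_zero_left, LinearMap.zero_apply]
  · simp

theorem sum_ite_map_right (f : n → X →ₗ[k] X) (a : n) (t : X ⊗[k] X) :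
    ∑ b, TensorProduct.map (f b) (if b = a then LinearMap.id else 0) t
      = TensorProduct.map (f a) LinearMap.id t := by
  rw [Finset.sum_eq_single a]
  · rw [if_pos rfl]
  · intro b _ hb
    rw [if_neg hb, TensorProduct.map_zero_right, LinearMap.zero_apply]
  · simp

/-- The inverse of a multiplicative matrix of operators is multiplicative, in the opposite
order. -/
theorem comul_leftInv (h1 : IsLeftInv c' c) (h2 : IsLeftInv c c')
    (hc : ∀ a b x, Δ (c a b x) = ∑ e, TensorProduct.map (c e b) (c a e) (Δ x)) (a b : n) (x : X) :
    Δ (c' a b x) = ∑ e, TensorProduct.map (c' a e) (c' e b) (Δ x) := by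
  have key := sum_eq_of_leftInverse (Z := X ⊗[k] X)
    (M := fun p q t => ∑ e, TensorProduct.map (c' p e) (c' e q) t)
    (N := fun p q t => ∑ e, TensorProduct.map (c e q) (c p e) t)
    (r := fun q => Δ (c' q b x)) (s := fun p => if p = b then Δ x else 0) ?_ ?_ ?_ a
  · rw [← key, Finset.sum_eq_single b]
    · simp
    · intro q _ hq; simp [hq]
    · simp
  · intro p q t
    simp only [map_sum]
    exact Finset.sum_comm
  · intro p q z
    simp only [map_sum, map_map_apply]
    calc ∑ l, ∑ e, ∑ f, TensorProduct.map (c' p e ∘ₗ c f q) (c' e l ∘ₗ c l f) z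
        = ∑ e, ∑ f, ∑ l, TensorProduct.map (c' p e ∘ₗ c f q) (c' e l ∘ₗ c l f) z := by
          rw [Finset.sum_comm]
          exact Finset.sum_congr rfl fun e _ => Finset.sum_comm
      _ = ∑ f, ∑ e, TensorProduct.map (c' p e ∘ₗ c f q) (if e = f then LinearMap.id else 0) z := by
          rw [Finset.sum_comm]
          simp only [sum_map_right, h1 _ _]
      _ = if p = q then z else 0 := by
          simp only [sum_ite_map_right, sum_map_left, h1 p q]
          split_ifs <;> simp
  · intro p
    have := congrArg Δ (LinearMap.congr_fun (h2 p b) x)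
    simp only [LinearMap.sum_apply, LinearMap.comp_apply, map_sum, hc] at this
    rw [this]
    split_ifs <;> simp

/-- How a commutation relation between two matrices `c`, `d` of operators passes to the matrices
`c⁻¹` and `d c⁻¹`. -/
theorem exchange_leftInv (h1 : IsLeftInv c' c) (h2 : IsLeftInv c c')
    (hd' : ∀ a b, d' a b = ∑ e, d a e ∘ₗ c' e b)
    (hc : ∀ a b x, Δ (c a b x) = ∑ e, TensorProduct.map (c e b) (c a e) (Δ x))
    (hΔ' : ∀ x, Δ' x = TensorProduct.comm k X X (Δ x))
    (hcd : ∀ a b x, ∑ e, TensorProduct.map (c e b) (d a e) (Δ x)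
      = ∑ e, TensorProduct.map (c a e) (d e b) (Δ' x)) (a b : n) (x : X) :
    ∑ e, TensorProduct.map (c' b e) (d' e a) (Δ x)
      = ∑ e, TensorProduct.map (c' e a) (d' b e) (Δ' x) := by
  have hc' := comul_leftInv h1 h2 hc
  have hc'' : ∀ a b x, Δ' (c' a b x) = ∑ e, TensorProduct.map (c' e b) (c' a e) (Δ' x) := by
    intro a b x
    rw [hΔ', hc', map_sum, hΔ']
    refine Finset.sum_congr rfl fun e _ => ?_
    generalize Δ x = t
    induction t using TensorProduct.induction_on with
    | zero => simp
    | tmul y z => simp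
    | add y z hy hz => simp only [map_add, hy, hz]
  have s1 : ∀ e, TensorProduct.map LinearMap.id (d' e a) (Δ x)
      = ∑ g, ∑ f, TensorProduct.map (c f g) (d e f) (Δ (c' g a x)) := by
    intro e
    simp only [hc', map_sum, map_map_apply]
    calc TensorProduct.map LinearMap.id (d' e a) (Δ x)
        = ∑ f, TensorProduct.map LinearMap.id (d e f ∘ₗ c' f a) (Δ x) := by
          rw [hd', sum_map_right]
      _ = ∑ f, ∑ h, ∑ g, TensorProduct.map (c f g ∘ₗ c' g h) (d e f ∘ₗ c' h a) (Δ x) := by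
          simp only [sum_map_left, h2 _ _, sum_ite_map_left]
      _ = _ := by
          have : ∀ f, ∑ h, ∑ g, TensorProduct.map (c f g ∘ₗ c' g h) (d e f ∘ₗ c' h a) (Δ x)
            = ∑ g, ∑ h, TensorProduct.map (c f g ∘ₗ c' g h) (d e f ∘ₗ c' h a) (Δ x) :=
            fun f => Finset.sum_comm
          simp only [this]
          exact Finset.sum_comm
  have s3 : ∑ g, TensorProduct.map LinearMap.id (d b g) (Δ' (c' g a x))
      = ∑ e, TensorProduct.map (c' e a) (d' b e) (Δ' x) := by
    simp only [hc'', map_sum, map_map_apply, LinearMap.id_comp]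
    rw [Finset.sum_comm]
    simp only [sum_map_right, hd']
  rw [← s3]
  calc ∑ e, TensorProduct.map (c' b e) (d' e a) (Δ x)
      = ∑ e, TensorProduct.map (c' b e) LinearMap.id
          (∑ g, ∑ f, TensorProduct.map (c f g) (d e f) (Δ (c' g a x))) := by
        simp only [← s1, map_map_apply, LinearMap.id_comp, LinearMap.comp_id]
    _ = ∑ e, ∑ g, ∑ f, TensorProduct.map (c' b e ∘ₗ c e f) (d f g) (Δ' (c' g a x)) := by
        simp only [hcd, map_sum, map_map_apply, LinearMap.id_comp]
    _ = ∑ g, ∑ f, ∑ e, TensorProduct.map (c' b e ∘ₗ c e f) (d f g) (Δ' (c' g a x)) := by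
        rw [Finset.sum_comm]
        exact Finset.sum_congr rfl fun g _ => Finset.sum_comm
    _ = _ := by
        simp only [sum_map_left, h1 _ _, sum_ite_map_left]

theorem comul_exchange (h1 : IsLeftInv c' c) (h2 : IsLeftInv c c')
    (hd' : ∀ a b, d' a b = ∑ e, d a e ∘ₗ c' e b)
    (hc : ∀ a b x, Δ (c a b x) = ∑ e, TensorProduct.map (c e b) (c a e) (Δ x))
    (hΔ' : ∀ x, Δ' x = TensorProduct.comm k X X (Δ x))
    (hcd : ∀ a b x, ∑ e, TensorProduct.map (c e b) (d a e) (Δ x)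
      = ∑ e, TensorProduct.map (c a e) (d e b) (Δ' x))
    (hd : ∀ a b x, Γ (d a b x) = ∑ e, TensorProduct.map (d a e) (d e b) (Δ' x)) (a b : n) (x : X) :
    Γ (d' a b x) = ∑ e, TensorProduct.map (d' a e) (d' e b) (Δ x) := by
  have hc' := comul_leftInv h1 h2 hc
  have hc'' : ∀ a b x, Δ' (c' a b x) = ∑ e, TensorProduct.map (c' e b) (c' a e) (Δ' x) := by
    intro a b x
    rw [hΔ', hc', map_sum, hΔ']
    refine Finset.sum_congr rfl fun e _ => ?_
    generalize Δ x = t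
    induction t using TensorProduct.induction_on with
    | zero => simp
    | tmul y z => simp
    | add y z hy hz => simp only [map_add, hy, hz]
  have ex := exchange_leftInv h1 h2 hd' hc hΔ' hcd
  calc Γ (d' a b x) = ∑ f, ∑ e, TensorProduct.map (d a e) (d e f) (Δ' (c' f b x)) := by
        simp only [hd', LinearMap.sum_apply, LinearMap.comp_apply, map_sum, hd]
    _ = ∑ e, ∑ f, ∑ h, TensorProduct.map (d a e ∘ₗ c' h b) (d e f ∘ₗ c' f h) (Δ' x) := by
        simp only [hc'', map_sum, map_map_apply]
        exact Finset.sum_comm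
    _ = ∑ e, TensorProduct.map (d a e) LinearMap.id
          (∑ h, TensorProduct.map (c' h b) (d' e h) (Δ' x)) := by
        refine Finset.sum_congr rfl fun e _ => ?_
        rw [Finset.sum_comm]
        simp only [map_sum, map_map_apply, sum_map_right, hd', LinearMap.id_comp]
    _ = ∑ h, ∑ e, TensorProduct.map (d a e ∘ₗ c' e h) (d' h b) (Δ x) := by
        simp only [← ex b, map_sum, map_map_apply, LinearMap.id_comp]
        exact Finset.sum_comm
    _ = _ := by simp only [sum_map_left, hd']

end MatricesOfOperators

end QBrace

namespace QBrace

/-! ### Relations between operations on iterated antipodes -/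

section LevelRelations

variable {k : Type u} [Field k] {X : Type v} [AddCommGroup X] [Module k X] [Coalgebra k X]

/-- Acting with `g` undoes acting with `f`, for the convolution product of level `j`:
`g (f x y₍₂₎) y₍₁₎ = ε(y) x`. -/
def IsConvInv (j : ℤ) (f g : X →ₗ[k] X →ₗ[k] X) : Prop :=
  ∀ ⦃n : Type⦄ [Fintype n] [DecidableEq n] (w : n → n → X), IsMult k j w → ∀ (a b : n) (x : X),
    ∑ c, g (f x (w c b)) (w a c) = if a = b then x else 0

/-- `dot' y₍₁₎ (colon l y₍₂₎) = dot y l`, for the comultiplication of level `i`.  When `dot'` is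
the operation `dot` on antipodes, this is the relation `S(y₍₁₎) · (l : y₍₂₎) = S(y · l)`. -/
def IsAntipodal (i : ℤ) (dot' dot colon : X →ₗ[k] X →ₗ[k] X) : Prop :=
  ∀ ⦃n : Type⦄ [Fintype n] [DecidableEq n] (u : n → n → X), IsMult k i u → ∀ (a b : n) (l : X),
    ∑ c, dot' (u a c) (colon l (u c b)) = dot (u a b) l

/-- `f` is a coalgebra morphism `X ⊗ X^cop → X`, where the first factor has level `i` and the
second one has level `j`. -/
def IsMultOp (i j : ℤ) (f : X →ₗ[k] X →ₗ[k] X) : Prop :=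
  ∀ ⦃n m : Type⦄ [Fintype n] [DecidableEq n] [Fintype m] [DecidableEq m] (u : n → n → X)
    (w : m → m → X), IsMult k i u → IsMult k j w →
    IsMult k i (fun p q : n × m => f (u p.1 q.1) (w q.2 p.2))

/-- `(l₍₁₎ : y₍₂₎) ⊗ (y₍₁₎ · l₍₂₎) = (l₍₂₎ : y₍₁₎) ⊗ (y₍₂₎ · l₍₁₎)`, for `y` of level `i` and `l`
of level `j`. -/
def IsCommuting (i j : ℤ) (dot colon : X →ₗ[k] X →ₗ[k] X) : Prop :=
  ∀ ⦃n m : Type⦄ [Fintype n] [DecidableEq n] [Fintype m] [DecidableEq m] (u : n → n → X)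
    (w : m → m → X), IsMult k i u → IsMult k j w → ∀ a b c d,
    ∑ e, ∑ f, colon (w c f) (u e b) ⊗ₜ[k] dot (u a e) (w f d)
      = ∑ e, ∑ f, colon (w f d) (u a e) ⊗ₜ[k] dot (u e b) (w c f)

/-- `dot` and `colon` make up a coalgebra morphism
`y ⊗ l ↦ (l₍₁₎ : y₍₂₎) ⊗ (y₍₁₎ · l₍₂₎)`. -/
structure IsMagma (i j : ℤ) (dot colon : X →ₗ[k] X →ₗ[k] X) : Prop where
  multDot : IsMultOp i j dot
  multColon : IsMultOp j i colon
  exchange : IsCommuting i j dot colon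

variable {i j : ℤ} {dot dot' dot₁ dot₁' colon colon' colon₁ colon₁' f g : X →ₗ[k] X →ₗ[k] X}
variable {n : Type} [Fintype n] [DecidableEq n]

theorem IsCommuting.symm (h : IsCommuting i j dot colon) : IsCommuting j i colon dot := by
  intro n m _ _ _ _ u w hu hw a b c d
  have := congrArg (TensorProduct.comm k X X) (h w u hw hu c d a b)
  simp only [map_sum, TensorProduct.comm_tmul] at this
  rw [Finset.sum_comm, this, Finset.sum_comm]

theorem IsMagma.symm (h : IsMagma i j dot colon) : IsMagma j i colon dot :=
  ⟨h.multColon, h.multDot, h.exchange.symm⟩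

theorem IsMultOp.congr {i' j' : ℤ} (hi : Even i ↔ Even i') (hj : Even j ↔ Even j')
    (h : IsMultOp i j f) : IsMultOp i' j' f :=
  fun _ _ _ _ _ _ u w hu hw => (h u w (hu.congr hi.symm) (hw.congr hj.symm)).congr hi

theorem IsMagma.congr {i' j' : ℤ} (hi : Even i ↔ Even i') (hj : Even j ↔ Even j')
    (h : IsMagma i j dot colon) : IsMagma i' j' dot colon :=
  ⟨h.multDot.congr hi hj, h.multColon.congr hj hi,
    fun _ _ _ _ _ _ u w hu hw => h.exchange u w (hu.congr hi.symm) (hw.congr hj.symm)⟩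

theorem IsConvInv.congr (hj : Even i ↔ Even j) (h : IsConvInv i f g) : IsConvInv j f g :=
  fun _ _ _ w hw => h w (hw.congr hj.symm)

theorem IsAntipodal.congr (hj : Even i ↔ Even j) (h : IsAntipodal i dot' dot colon) :
    IsAntipodal j dot' dot colon :=
  fun _ _ _ w hw => h w (hw.congr hj.symm)

theorem IsMultOp.counit_apply (h : IsMultOp i j f) (x y : X) :
    counit (R := k) (f x y) = counit (R := k) x * counit (R := k) y := by
  have : (LinearMap.compr₂ f (counit (R := k))) =
      (LinearMap.mul k k).compl₁₂ (counit (R := k) (A := X)) (counit (R := k) (A := X)) := by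
    refine ext_isMult₂ i j fun r s u w hu hw a b c d => ?_
    have := (h u w hu hw).counit_apply (a, d) (b, c)
    simp only [Prod.mk.injEq] at this
    simp only [LinearMap.compr₂_apply, LinearMap.compl₁₂_apply, LinearMap.mul_apply', this,
      hu.counit_apply, hw.counit_apply, eq_comm (a := c)]
    split_ifs <;> simp_all
  exact LinearMap.congr_fun₂ this x y

theorem IsMultOp.comul_flip (h : IsMultOp j i f) {u : n → n → X} (hu : IsMult k i u) (a b : n)
    (x : X) : levelComul k X j (f x (u a b))
      = ∑ e, TensorProduct.map (f.flip (u e b)) (f.flip (u a e)) (levelComul k X j x) := by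
  have : levelComul k X j ∘ₗ f.flip (u a b)
      = (∑ e, TensorProduct.map (f.flip (u e b)) (f.flip (u a e))) ∘ₗ levelComul k X j := by
    refine ext_isMult j fun r w hw c d => ?_
    have := (h w u hw hu).comul_apply (c, b) (d, a)
    simp only [LinearMap.comp_apply, LinearMap.flip_apply, hw.comul_apply, this,
      LinearMap.sum_apply, map_sum, TensorProduct.map_tmul, Fintype.sum_prod_type]
  simpa using LinearMap.congr_fun this x

theorem IsMultOp.comul_left (h : IsMultOp i j f) {u : n → n → X} (hu : IsMult k i u) (a b : n)
    (x : X) : levelComul k X i (f (u a b) x)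
      = ∑ e, TensorProduct.map (f (u a e)) (f (u e b)) (levelComul k X (j + 1) x) := by
  have : levelComul k X i ∘ₗ f (u a b)
      = (∑ e, TensorProduct.map (f (u a e)) (f (u e b))) ∘ₗ levelComul k X (j + 1) := by
    refine ext_isMult j fun r w hw c d => ?_
    have := (h u w hu hw).comul_apply (a, d) (b, c)
    simp only [LinearMap.comp_apply, this, LinearMap.sum_apply, map_sum,
      hw.transpose.comul_apply d c, TensorProduct.map_tmul, Fintype.sum_prod_type]
    exact Finset.sum_comm
  simpa using LinearMap.congr_fun this x

theorem IsCommuting.apply (h : IsCommuting i j dot colon) {u : n → n → X} (hu : IsMult k i u)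
    (a b : n) (x : X) :
    ∑ e, TensorProduct.map (colon.flip (u e b)) (dot (u a e)) (levelComul k X j x)
      = ∑ e, TensorProduct.map (colon.flip (u a e)) (dot (u e b)) (levelComul k X (j + 1) x) := by
  have : (∑ e, TensorProduct.map (colon.flip (u e b)) (dot (u a e))) ∘ₗ levelComul k X j
      = (∑ e, TensorProduct.map (colon.flip (u a e)) (dot (u e b))) ∘ₗ levelComul k X (j + 1) := by
    refine ext_isMult j fun r w hw c d => ?_
    have := h u w hu hw a b c d
    simp only [LinearMap.comp_apply, LinearMap.sum_apply, map_sum,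
      hw.transpose.comul_apply d c, hw.comul_apply, TensorProduct.map_tmul, LinearMap.flip_apply]
    rw [Finset.sum_comm, this, Finset.sum_comm]
  simpa using LinearMap.congr_fun this x

theorem IsConvInv.isLeftInv (h : IsConvInv i f g) {u : n → n → X} (hu : IsMult k i u) :
    IsLeftInv (fun a b => g.flip (u a b)) (fun a b => f.flip (u a b)) := by
  intro a b
  ext x
  simp only [LinearMap.sum_apply, LinearMap.comp_apply, LinearMap.flip_apply]
  rw [h u hu a b x]
  split_ifs <;> simp

/-- The relation solved for `dot'`, with the help of the inverse action `colon'`. -/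
theorem IsAntipodal.eq_sum (h : IsAntipodal i dot' dot colon) (hi : IsConvInv i colon' colon)
    {u : n → n → X} (hu : IsMult k i u) (a b : n) (l : X) :
    dot' (u a b) l = ∑ e, dot (u a e) (colon' l (u e b)) := by
  calc dot' (u a b) l = ∑ c, dot' (u a c) (if c = b then l else 0) := by simp [apply_ite]
    _ = ∑ c, ∑ e, dot' (u a c) (colon (colon' l (u e b)) (u c e)) := by
      simp only [← hi u hu, map_sum]
    _ = ∑ e, dot (u a e) (colon' l (u e b)) := by
      rw [Finset.sum_comm]
      simp only [h u hu]

/-- The morphism `y ⊗ l ↦ (l₍₁₎ : y₍₂₎) ⊗ (y₍₁₎ · l₍₂₎)` remains a coalgebra morphism when `y` is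
replaced by its antipode. -/
theorem IsMagma.antipode_left (h : IsMagma i j dot colon) (h1 : IsConvInv i colon colon')
    (h2 : IsConvInv i colon' colon) (ha : IsAntipodal i dot' dot colon) :
    IsMagma (i + 1) j dot' colon' := by
  have cu : ∀ {n : Type} [Fintype n] [DecidableEq n] (u : n → n → X), IsMult k i u →
      ∀ a b x, counit (R := k) (colon' x (u a b)) = if a = b then counit (R := k) x else 0 := by
    intro n _ _ u hu a b x
    have := congrArg (counit (R := k)) (h2 u hu a b x)
    rw [map_sum] at this
    simpa [h.multColon.counit_apply, hu.counit_apply, apply_ite (counit (R := k))] using this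
  have cd : ∀ {n : Type} [Fintype n] [DecidableEq n] (u : n → n → X), IsMult k i u →
      ∀ a b x, counit (R := k) (dot' (u a b) x) = if a = b then counit (R := k) x else 0 := by
    intro n _ _ u hu a b x
    rw [ha.eq_sum h2 hu, map_sum]
    simp [h.multDot.counit_apply, hu.counit_apply, cu u hu]
  have hop : ∀ {n : Type} [Fintype n] [DecidableEq n] (u : n → n → X), IsMult k i u →
      ∀ a b, dot' (u a b) = ∑ e, dot (u a e) ∘ₗ colon'.flip (u e b) := by
    intro n _ _ u hu a b
    ext l
    simp [ha.eq_sum h2 hu]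
  refine ⟨?_, ?_, ?_⟩
  · intro n m _ _ _ _ u w hu hw
    have ex := fun a b x => comul_exchange (h1.isLeftInv hu.transpose') (h2.isLeftInv hu.transpose')
      (hop _ hu.transpose') (Δ := levelComul k X j) (Γ := levelComul k X i)
      (fun a b x => h.multColon.comul_flip hu.transpose' a b x)
      (fun x => (comm_comp_levelComul j x).symm) (fun a b x => h.exchange.apply hu.transpose' a b x)
      (fun a b x => h.multDot.comul_left hu.transpose' a b x) a b x
    refine ⟨fun p q => ?_, fun p q => ?_⟩
    · rw [← comm_comp_levelComul, ex q.1 p.1, map_sum, Fintype.sum_prod_type]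
      refine Finset.sum_congr rfl fun e _ => ?_
      simp [hw.comul_apply]
    · rw [cd _ hu.transpose', hw.counit_apply]
      simp only [Prod.ext_iff, eq_comm (a := q.1), eq_comm (a := q.2), ite_and]
  · intro n m _ _ _ _ w u hw hu
    have ex := fun a b x => comul_leftInv (h1.isLeftInv hu.transpose') (h2.isLeftInv hu.transpose')
      (Δ := levelComul k X j) (fun a b x => h.multColon.comul_flip hu.transpose' a b x) a b x
    refine ⟨fun p q => ?_, fun p q => ?_⟩
    · have := ex p.2 q.2 (w p.1 q.1)
      simp only [LinearMap.flip_apply, hw.comul_apply, map_sum, TensorProduct.map_tmul] at this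
      rw [this, Fintype.sum_prod_type, Finset.sum_comm]
    · rw [cu _ hu.transpose', hw.counit_apply]
      simp only [Prod.ext_iff, ite_and]
      split_ifs <;> rfl
  · intro n m _ _ _ _ u w hu hw a b c d
    have ex := exchange_leftInv (h1.isLeftInv hu.transpose') (h2.isLeftInv hu.transpose')
      (hop _ hu.transpose') (Δ := levelComul k X j)
      (fun a b x => h.multColon.comul_flip hu.transpose' a b x)
      (fun x => (comm_comp_levelComul j x).symm) (fun a b x => h.exchange.apply hu.transpose' a b x)
      a b (w c d)
    simpa only [hw.transpose.comul_apply d c, hw.comul_apply, map_sum, TensorProduct.map_tmul,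
      LinearMap.flip_apply] using ex

/-- From the action on `y` by `l` to the action by the antipode of `l`. -/
theorem IsAntipodal.antipode_right (hA : IsAntipodal i dot₁ dot colon)
    (hB : IsAntipodal j colon₁ colon dot)
    (h1 : IsConvInv j dot' dot) (h2 : IsConvInv j dot₁ dot₁')
    (hm : IsMultOp i (j + 1) dot') (hc : IsMultOp j i colon) :
    IsAntipodal i dot₁' dot' colon₁ := by
  intro n _ _ u hu a b l
  suffices h : ∑ c, dot₁' (u a c) ∘ₗ colon₁.flip (u c b) = dot' (u a b) by
    simpa using LinearMap.congr_fun h l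
  refine ext_isMult j fun s w hw c d => ?_
  have hy := hm u _ hu hw.transpose
  have hz := hc w _ hw hy
  -- the system `∑ Q, r Q ·₁ z P Q = s P` for the multiplicative matrix `z = w : (u · S(w))`
  have key := sum_eq_of_leftInverse
    (M := fun P Q t => dot₁' t (colon (w P.1 Q.1) (dot' (u Q.2.1 P.2.1) (w Q.2.2 P.2.2))))
    (N := fun P Q t => dot₁ t (colon (w P.1 Q.1) (dot' (u Q.2.1 P.2.1) (w Q.2.2 P.2.2))))
    (r := fun Q : Fin s × n × Fin s => dot' (u a Q.2.1) (w Q.1 Q.2.2))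
    (s := fun P => if P.1 = P.2.2 then u a P.2.1 else 0)
    (fun P Q t => by simp [map_sum, LinearMap.sum_apply])
    (fun P Q t => h2 _ hz P Q t) ?_ (c, (b, d))
  · rw [← key]
    simp only [Fintype.sum_prod_type, LinearMap.sum_apply, LinearMap.comp_apply,
      LinearMap.flip_apply]
    rw [Finset.sum_comm]
    refine Finset.sum_congr rfl fun e _ => ?_
    have hB' : colon₁ (w c d) (u e b) = ∑ p, colon (w c p) (dot' (u e b) (w p d)) :=
      hB.eq_sum h1 hw c d _
    rw [hB', map_sum]
    refine Finset.sum_congr rfl fun p _ => ?_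
    rw [Finset.sum_eq_single p]
    · simp
    · intro q _ hq
      simp [Ne.symm hq]
    · simp
  · rintro ⟨p, e, q⟩
    simp only [Fintype.sum_prod_type]
    have := fun m => hA _ hy (a, m) (e, q) (w p m)
    simp only [Fintype.sum_prod_type] at this
    simp only [this]
    exact h1 w hw p q (u a e)

/-- From the action on `y` by the antipode of `l` to the action by `l`. -/
theorem IsAntipodal.of_antipode_right (hA : IsAntipodal i dot₁ dot colon)
    (hB : IsAntipodal j colon₁' colon' dot₁)
    (h1 : IsConvInv i colon colon') (h2 : IsConvInv i colon₁' colon₁)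
    (hd : IsMultOp i j dot) (hc : IsMultOp j i colon) :
    IsAntipodal j colon₁ colon dot := by
  intro m _ _ w hw c d x
  suffices h : ∑ b, colon₁ (w c b) ∘ₗ dot.flip (w b d) = colon (w c d) by
    simpa using LinearMap.congr_fun h x
  refine ext_isMult i fun s u hu a b => ?_
  have hy := hd u w hu hw
  have hv := hc w u hw hu
  have key := sum_eq_of_leftInverse
    (M := fun P Q t => colon₁ t (dot (u P.1 Q.1) (w Q.2 P.2)))
    (N := fun P Q t => colon₁' t (dot (u P.1 Q.1) (w Q.2 P.2)))
    (r := fun Q : Fin s × m => colon (w c Q.2) (u Q.1 b))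
    (s := fun P => if P.1 = b then w c P.2 else 0)
    (fun P Q t => by simp [map_sum, LinearMap.sum_apply])
    (fun P Q t => h2 _ hy P Q t) ?_ (a, d)
  · rw [← key]
    simp only [Fintype.sum_prod_type, LinearMap.sum_apply, LinearMap.comp_apply,
      LinearMap.flip_apply]
    rw [Finset.sum_eq_single b]
    · simp
    · intro q _ hq
      simp [hq]
    · simp
  · rintro ⟨p, q⟩
    have hB' := fun f => hB _ hv (c, b) (q, f) (u p f)
    have h3 : ∑ f, colon' (colon (w c q) (u f b)) (u p f) = if p = b then w c q else 0 :=
      h1 u hu p b (w c q)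
    simp only [← h3, ← hB', ← hA u hu, map_sum]
    simp only [Fintype.sum_prod_type]
    rw [Finset.sum_comm]
    conv_rhs => rw [Finset.sum_comm]; enter [2, d]; rw [Finset.sum_comm]

end LevelRelations

end QBrace

namespace QBrace

/-! ### Level systems -/

section LevelSystems

variable {k : Type u} [Field k] {X : Type v} [AddCommGroup X] [Module k X] [Coalgebra k X]

/-- Operations `D i j y l` and `K i j y l`, for `i j : ℤ`, which stand for `Sⁱ(y) · Sʲ(l)` and
`Sⁱ(y) : Sʲ(l)` in a Hopf `q`-brace with antipode `S`, together with the relations among them which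
hold in every Hopf `q`-brace. -/
structure IsLevelSystem (D K : ℤ → ℤ → X →ₗ[k] X →ₗ[k] X) : Prop where
  inv_dot : ∀ i j, IsConvInv j (D i j) (D i (j + 1))
  inv_dot' : ∀ i j, IsConvInv j (D i (j + 1)) (D i j)
  inv_colon : ∀ i j, IsConvInv j (K i j) (K i (j + 1))
  inv_colon' : ∀ i j, IsConvInv j (K i (j + 1)) (K i j)
  antipodal_dot : ∀ i j, IsAntipodal i (D (i + 1) j) (D i j) (K j i)
  antipodal_colon : ∀ i j, IsAntipodal i (K (i + 1) j) (K i j) (D j i)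
  magma : ∀ i j, IsMagma i j (D i j) (K j i)

theorem IsLevelSystem.symm {D K : ℤ → ℤ → X →ₗ[k] X →ₗ[k] X} (h : IsLevelSystem D K) :
    IsLevelSystem K D :=
  ⟨h.inv_colon, h.inv_colon', h.inv_dot, h.inv_dot', h.antipodal_colon, h.antipodal_dot,
    fun i j => (h.magma j i).symm⟩

/-- The relations away from the diagonal, by induction on the distance to the diagonal. -/
theorem relations_of_diagonal {D K : ℤ → ℤ → X →ₗ[k] X →ₗ[k] X}
    (D1 : ∀ i j, IsConvInv j (D i j) (D i (j + 1)))
    (D2 : ∀ i j, IsConvInv j (D i (j + 1)) (D i j))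
    (K1 : ∀ i j, IsConvInv j (K i j) (K i (j + 1)))
    (K2 : ∀ i j, IsConvInv j (K i (j + 1)) (K i j))
    (hA : ∀ i, IsAntipodal i (D (i + 1) i) (D i i) (K i i))
    (hB : ∀ i, IsAntipodal i (K (i + 1) i) (K i i) (D i i))
    (hC : ∀ i, IsMagma i i (D i i) (K i i)) (m : ℕ) :
    ∀ i j : ℤ, j = i + m → IsAntipodal i (D (i + 1) j) (D i j) (K j i) ∧
      IsAntipodal j (K (j + 1) i) (K j i) (D i j) ∧ IsMagma i j (D i j) (K j i) := by
  induction m with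
  | zero =>
    rintro i j rfl
    simpa using ⟨hA i, hB i, hC i⟩
  | succ m ih =>
    intro i j hj
    obtain ⟨j, rfl⟩ : ∃ j', j = j' + 1 := ⟨j - 1, by ring⟩
    obtain ⟨a, b, c⟩ := ih i j (by push_cast at hj; linarith)
    have c' : IsMagma i (j + 1) (D i (j + 1)) (K (j + 1) i) :=
      (c.symm.antipode_left (D1 i j) (D2 i j) b).symm
    have a' : IsAntipodal i (D (i + 1) (j + 1)) (D i (j + 1)) (K (j + 1) i) :=
      a.antipode_right b (D2 i j) (D1 (i + 1) j) c'.multDot c.multColon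
    obtain ⟨-, b2, -⟩ := ih (i + 1) (j + 1) (by push_cast at hj; linarith)
    exact ⟨a', a'.of_antipode_right b2 (K1 (j + 1) i) (K2 (j + 1 + 1) i) c'.multDot c'.multColon, c'⟩

/-- The operations of a level system depend on `i` and `j` only up to a common even shift, since
`S²` is an automorphism.  Therefore the relations at `(0, 0)` and `(1, 1)` imply all the others. -/
theorem IsLevelSystem.of_base {D K : ℤ → ℤ → X →ₗ[k] X →ₗ[k] X}
    (D1 : ∀ i j, IsConvInv j (D i j) (D i (j + 1)))
    (D2 : ∀ i j, IsConvInv j (D i (j + 1)) (D i j))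
    (K1 : ∀ i j, IsConvInv j (K i j) (K i (j + 1)))
    (K2 : ∀ i j, IsConvInv j (K i (j + 1)) (K i j))
    (hD : ∀ i j m, D (i + 2 * m) (j + 2 * m) = D i j)
    (hK : ∀ i j m, K (i + 2 * m) (j + 2 * m) = K i j)
    (a0 : IsAntipodal 0 (D 1 0) (D 0 0) (K 0 0)) (b0 : IsAntipodal 0 (K 1 0) (K 0 0) (D 0 0))
    (a1 : IsAntipodal 1 (D 2 1) (D 1 1) (K 1 1)) (b1 : IsAntipodal 1 (K 2 1) (K 1 1) (D 1 1))
    (c0 : IsMagma 0 0 (D 0 0) (K 0 0)) : IsLevelSystem D K := by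
  have c10 : IsMagma 1 0 (D 1 0) (K 0 1) := c0.antipode_left (K1 0 0) (K2 0 0) a0
  have c01 : IsMagma 0 1 (D 0 1) (K 1 0) := (c0.symm.antipode_left (D1 0 0) (D2 0 0) b0).symm
  have b01 : IsAntipodal 0 (K 1 1) (K 0 1) (D 1 0) :=
    b0.antipode_right a0 (K2 0 0) (K1 1 0) c10.multColon c0.multDot
  have c1 : IsMagma 1 1 (D 1 1) (K 1 1) := (c10.symm.antipode_left (D1 1 0) (D2 1 0) b01).symm
  have key : ∀ i, IsAntipodal i (D (i + 1) i) (D i i) (K i i) ∧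
      IsAntipodal i (K (i + 1) i) (K i i) (D i i) ∧ IsMagma i i (D i i) (K i i) := by
    intro i
    rcases Int.even_or_odd' i with ⟨m, rfl | rfl⟩
    · have e : ∀ F : ℤ → ℤ → X →ₗ[k] X →ₗ[k] X, (∀ i j m, F (i + 2 * m) (j + 2 * m) = F i j) →
          F (2 * m + 1) (2 * m) = F 1 0 ∧ F (2 * m) (2 * m) = F 0 0 := fun F hF =>
        ⟨by rw [← hF 1 0 m]; congr 1 <;> ring, by rw [← hF 0 0 m]; congr 1 <;> ring⟩
      rw [(e D hD).1, (e D hD).2, (e K hK).1, (e K hK).2]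
      have hp : Even (0 : ℤ) ↔ Even (2 * m) := by simp
      exact ⟨a0.congr hp, b0.congr hp, c0.congr hp hp⟩
    · have e : ∀ F : ℤ → ℤ → X →ₗ[k] X →ₗ[k] X, (∀ i j m, F (i + 2 * m) (j + 2 * m) = F i j) →
          F (2 * m + 1 + 1) (2 * m + 1) = F 2 1 ∧ F (2 * m + 1) (2 * m + 1) = F 1 1 := fun F hF =>
        ⟨by rw [← hF 2 1 m]; congr 1 <;> ring, by rw [← hF 1 1 m]; congr 1 <;> ring⟩
      rw [(e D hD).1, (e D hD).2, (e K hK).1, (e K hK).2]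
      have hp : Even (1 : ℤ) ↔ Even (2 * m + 1) := by simp
      exact ⟨a1.congr hp, b1.congr hp, c1.congr hp hp⟩
  have up := relations_of_diagonal D1 D2 K1 K2 (fun i => (key i).1) (fun i => (key i).2.1)
    fun i => (key i).2.2
  have down := relations_of_diagonal K1 K2 D1 D2 (fun i => (key i).2.1) (fun i => (key i).1)
    fun i => (key i).2.2.symm
  have all : ∀ i j, IsAntipodal i (D (i + 1) j) (D i j) (K j i) ∧
      IsAntipodal j (K (j + 1) i) (K j i) (D i j) ∧ IsMagma i j (D i j) (K j i) := by
    intro i j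
    rcases le_total i j with h | h
    · exact up (j - i).toNat i j (by rw [Int.toNat_of_nonneg (by linarith)]; ring)
    · obtain ⟨a, b, c⟩ := down (i - j).toNat j i (by rw [Int.toNat_of_nonneg (by linarith)]; ring)
      exact ⟨b, a, c.symm⟩
  exact ⟨D1, D2, K1, K2, fun i j => (all i j).1, fun i j => (all j i).2.1, fun i j => (all i j).2.2⟩

/-- A left and a right convolution inverse of `g` agree. -/
theorem IsConvInv.unique {j : ℤ} {f g h : X →ₗ[k] X →ₗ[k] X} (h1 : IsConvInv j f g)
    (h2 : IsConvInv j g h) : f = h := by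
  ext x y
  suffices f x = h x by rw [this]
  refine ext_isMult j fun r w hw a b => ?_
  calc f x (w a b) = ∑ c, if a = c then f x (w c b) else 0 := by simp
    _ = ∑ c, ∑ d, h (g (f x (w c b)) (w d c)) (w a d) := by
      simp only [fun c => h2 w hw a c (f x (w c b))]
    _ = ∑ d, h (∑ c, g (f x (w c b)) (w d c)) (w a d) := by
      rw [Finset.sum_comm]; simp only [map_sum, LinearMap.sum_apply]
    _ = h x (w a b) := by
      simp only [fun d => h1 w hw d b x]
      simp [apply_ite h, apply_ite (DFunLike.coe : (X →ₗ[k] X) → X → X), ite_apply]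

/-- The convolution inverse of a coalgebra morphism is one too, with the other comultiplication on
the second factor. -/
theorem IsMultOp.of_convInv {i j : ℤ} {f g : X →ₗ[k] X →ₗ[k] X} (h : IsMultOp j i f)
    (h1 : IsConvInv i f g) (h2 : IsConvInv i g f) : IsMultOp j (i + 1) g := by
  intro n m _ _ _ _ w u hw hu
  have ex := fun a b x => comul_leftInv (h1.isLeftInv hu.transpose') (h2.isLeftInv hu.transpose')
    (Δ := levelComul k X j) (fun a b x => h.comul_flip hu.transpose' a b x) a b x
  refine ⟨fun p q => ?_, fun p q => ?_⟩
  · have := ex p.2 q.2 (w p.1 q.1)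
    simp only [LinearMap.flip_apply, hw.comul_apply, map_sum, TensorProduct.map_tmul] at this
    rw [this, Fintype.sum_prod_type, Finset.sum_comm]
  · have := congrArg (counit (R := k)) (h2 _ hu.transpose' p.2 q.2 (w p.1 q.1))
    rw [map_sum] at this
    simp only [h.counit_apply, hu.transpose'.counit_apply] at this
    simp only [mul_ite, mul_one, mul_zero, Finset.sum_ite_eq, Finset.mem_univ, if_true] at this
    rw [this]
    by_cases h2 : p.2 = q.2 <;> simp [h2, hw.counit_apply, Prod.ext_iff]

/-! ### Relations on the diagonal -/

variable {i : ℤ} {t : X ⊗[k] X →ₗ[k] X ⊗[k] X} {D D' D₁ K K' K₀ K₁ : X →ₗ[k] X →ₗ[k] X}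

/-- `t (a₍₁₎ ⊗ (l : a₍₂₎)) = l₍₂₎ ⊗ a · l₍₁₎`. -/
def IsInverseBraiding (i : ℤ) (t : X ⊗[k] X →ₗ[k] X ⊗[k] X) (D K : X →ₗ[k] X →ₗ[k] X) : Prop :=
  ∀ ⦃n m : Type⦄ [Fintype n] [DecidableEq n] [Fintype m] [DecidableEq m] (u : n → n → X)
    (w : m → m → X), IsMult k i u → IsMult k i w → ∀ a b c d,
    t (∑ e, u a e ⊗ₜ[k] K (w c d) (u e b)) = ∑ e, w e d ⊗ₜ[k] D (u a b) (w c e)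

/-- `t (a · l₍₁₎ ⊗ l₍₂₎) = (l : a₍₂₎) ⊗ a₍₁₎`. -/
def IsBraiding (i : ℤ) (t : X ⊗[k] X →ₗ[k] X ⊗[k] X) (D K : X →ₗ[k] X →ₗ[k] X) : Prop :=
  ∀ ⦃n m : Type⦄ [Fintype n] [DecidableEq n] [Fintype m] [DecidableEq m] (u : n → n → X)
    (w : m → m → X), IsMult k i u → IsMult k i w → ∀ a b c d,
    t (∑ e, D (u a b) (w c e) ⊗ₜ[k] w e d) = ∑ e, K (w c d) (u e b) ⊗ₜ[k] u a e

theorem projL_tmul (x y : X) : projL (k := k) (x ⊗ₜ[k] y) = counit (R := k) y • x := by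
  simp [projL]

theorem projR_tmul (x y : X) : projR (k := k) (x ⊗ₜ[k] y) = counit (R := k) x • y := by
  simp [projR]

theorem IsInverseBraiding.projR_apply (h : IsInverseBraiding i t D K) {n : Type} [Fintype n]
    [DecidableEq n] {u : n → n → X} (hu : IsMult k i u) (a b : n) (l : X) :
    projR (t (∑ e, u a e ⊗ₜ[k] K l (u e b))) = D (u a b) l := by
  suffices H : ∑ e, projR ∘ₗ t ∘ₗ (TensorProduct.mk k X X (u a e)) ∘ₗ K.flip (u e b) = D (u a b) by
    simpa using LinearMap.congr_fun H l
  refine ext_isMult i fun r w hw c d => ?_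
  have := congrArg (projR (k := k)) (h u w hu hw a b c d)
  simp only [map_sum, projR_tmul, hw.counit_apply] at this
  simpa using this

theorem IsInverseBraiding.projL_apply (h : IsInverseBraiding i t D K) (hD : IsMultOp i i D)
    {n : Type} [Fintype n]
    [DecidableEq n] {u : n → n → X} (hu : IsMult k i u) (a b : n) (l : X) :
    projL (t (∑ e, u a e ⊗ₜ[k] K l (u e b))) = if a = b then l else 0 := by
  suffices H : ∑ e, projL ∘ₗ t ∘ₗ (TensorProduct.mk k X X (u a e)) ∘ₗ K.flip (u e b)
      = if a = b then LinearMap.id else 0 by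
    have := LinearMap.congr_fun H l
    simp only [LinearMap.sum_apply, LinearMap.comp_apply, LinearMap.flip_apply,
      TensorProduct.mk_apply] at this
    rw [map_sum, map_sum, this]
    split_ifs <;> simp
  refine ext_isMult i fun r w hw c d => ?_
  have := congrArg (projL (k := k)) (h u w hu hw a b c d)
  simp only [map_sum, projL_tmul, hD.counit_apply, hu.counit_apply, hw.counit_apply] at this
  simp only [LinearMap.sum_apply, LinearMap.comp_apply, LinearMap.flip_apply,
      TensorProduct.mk_apply, this]
  split_ifs <;> simp

theorem IsInverseBraiding.isAntipodal (h : IsInverseBraiding i t D K)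
    (ht : ∀ x y, D' x y = projR (t (x ⊗ₜ[k] y))) : IsAntipodal i D' D K := by
  intro n _ _ u hu a b l
  simp only [ht, ← map_sum, h.projR_apply hu]

/-- The relation `K' y₍₁₎ (D l y₍₂₎) = K y l`.  It amounts to
`K₁ (l₍₁₎ : a₍₂₎) (a₍₁₎ · l₍₂₎) = ε(a) l`, which is the first component of the formula for
`t (a₍₁₎ ⊗ (l : a₍₂₎))`. -/
theorem IsInverseBraiding.isAntipodal_colon (h : IsInverseBraiding i t D K)
    (hD : IsMultOp i i D) (hK : IsMultOp i i K)
    (ht : ∀ x y, D' x y = projR (t (x ⊗ₜ[k] y))) (h1 : IsConvInv i D' D₁)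
    (h2 : ∀ ⦃m : Type⦄ [Fintype m] [DecidableEq m] (w : m → m → X), IsMult k (i + 1) w →
      ∀ x c d, projL (t (∑ e, D₁ x (w c e) ⊗ₜ[k] w e d)) = K₁ (w c d) x)
    (h3 : IsConvInv i K₁ K') : IsAntipodal i K' K D := by
  have hA : IsAntipodal i D' D K := h.isAntipodal ht
  have t1 : ∀ ⦃m : Type⦄ [Fintype m] [DecidableEq m] (w : m → m → X), IsMult k i w →
      ∀ x c d, projL (t (x ⊗ₜ[k] w c d)) = ∑ e, K₁ (w c e) (D' x (w e d)) := by
    intro m _ _ w hw x c d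
    calc projL (t (x ⊗ₜ[k] w c d))
        = projL (t (∑ f, (∑ e, D₁ (D' x (w e d)) (w f e)) ⊗ₜ[k] w c f)) := by
          simp only [h1 w hw, TensorProduct.ite_tmul]
          simp
      _ = ∑ e, projL (t (∑ f, D₁ (D' x (w e d)) (w f e) ⊗ₜ[k] w c f)) := by
          simp only [TensorProduct.sum_tmul]
          rw [Finset.sum_comm]
          simp only [map_sum]
      _ = _ := Finset.sum_congr rfl fun e _ => h2 _ hw.transpose (D' x (w e d)) e c
  intro m _ _ w hw c d x
  suffices H : ∑ e, K' (w c e) ∘ₗ D.flip (w e d) = K (w c d) by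
    simpa using LinearMap.congr_fun H x
  refine ext_isMult i fun s u hu a b => ?_
  have hy := hD u w hu hw
  have hv := hK w u hw hu
  have key := sum_eq_of_leftInverse
    (M := fun P Q z => K' z (D (u P.1 Q.1) (w Q.2 P.2)))
    (N := fun P Q z => K₁ z (D (u P.1 Q.1) (w Q.2 P.2)))
    (r := fun Q : Fin s × m => K (w c Q.2) (u Q.1 b))
    (s := fun P => if P.1 = b then w c P.2 else 0)
    (fun P Q t => by simp [map_sum, LinearMap.sum_apply])
    (fun P Q t => h3 _ hy P Q t) ?_ (a, d)
  · rw [← key]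
    simp only [Fintype.sum_prod_type, LinearMap.sum_apply, LinearMap.comp_apply,
      LinearMap.flip_apply]
    rw [Finset.sum_eq_single b]
    · simp
    · intro q _ hq
      simp [hq]
    · simp
  · rintro ⟨p, q⟩
    have h5 := h.projL_apply hD hu p b (w c q)
    rw [map_sum, map_sum] at h5
    have h6 := fun e => t1 _ hv (u p e) (c, b) (q, e)
    simp only at h6
    simp only [h6] at h5
    rw [Finset.sum_comm] at h5
    simp only [← map_sum, hA u hu] at h5
    refine Eq.trans ?_ h5
    simp only [Fintype.sum_prod_type]
    exact Finset.sum_comm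

end LevelSystems

end QBrace

namespace QBrace

/-! ### Braidings and strong regularity -/

section Diagonal

theorem sum_comm_three {M : Type*} [AddCommMonoid M] {α β γ : Type*} [Fintype α] [Fintype β]
    [Fintype γ] (F : α → β → γ → M) : ∑ a, ∑ b, ∑ c, F a b c = ∑ c, ∑ b, ∑ a, F a b c := by
  calc _ = ∑ a, ∑ c, ∑ b, F a b c := Finset.sum_congr rfl fun _ _ => Finset.sum_comm
    _ = ∑ c, ∑ a, ∑ b, F a b c := Finset.sum_comm
    _ = _ := Finset.sum_congr rfl fun _ _ => Finset.sum_comm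

theorem sum_comm_four {M : Type*} [AddCommMonoid M] {α β γ δ : Type*} [Fintype α] [Fintype β]
    [Fintype γ] [Fintype δ] (F : α → β → γ → δ → M) :
    ∑ a, ∑ b, ∑ c, ∑ d, F a b c d = ∑ d, ∑ c, ∑ b, ∑ a, F a b c d := by
  calc _ = ∑ a, ∑ d, ∑ c, ∑ b, F a b c d := Finset.sum_congr rfl fun _ _ => sum_comm_three _
    _ = ∑ d, ∑ a, ∑ c, ∑ b, F a b c d := Finset.sum_comm
    _ = ∑ d, ∑ c, ∑ a, ∑ b, F a b c d := Finset.sum_congr rfl fun _ _ => Finset.sum_comm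
    _ = _ := Finset.sum_congr rfl fun _ _ => Finset.sum_congr rfl fun _ _ => Finset.sum_comm

variable {k : Type u} [Field k] {X : Type v} [AddCommGroup X] [Module k X] [Coalgebra k X]
variable {i : ℤ} {t s : X ⊗[k] X →ₗ[k] X ⊗[k] X} {D D' D₁ K K' K₀ K₁ : X →ₗ[k] X →ₗ[k] X}

/-- `t` is determined by its two components: `t z = t₁ z₍₁₎ ⊗ t₂ z₍₂₎`. -/
theorem IsInverseBraiding.eq_components (h : IsInverseBraiding i t D K) (hm : IsMagma i i D K)
    (h1 : IsConvInv i K₀ K) :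
    t = TensorProduct.map (projL ∘ₗ t) (projR ∘ₗ t) ∘ₗ
      (TensorProduct.tensorTensorTensorComm k X X X X).toLinearMap ∘ₗ
        TensorProduct.map (levelComul k X i) (levelComul k X i) := by
  set T := TensorProduct.map (projL ∘ₗ t) (projR ∘ₗ t) ∘ₗ
      (TensorProduct.tensorTensorTensorComm k X X X X).toLinearMap ∘ₗ
        TensorProduct.map (levelComul k X i) (levelComul k X i) with hT
  have key : ∀ (r : ℕ) (u : Fin r → Fin r → X), IsMult k i u → ∀ a b l,
      t (∑ e, u a e ⊗ₜ[k] K l (u e b)) = T (∑ e, u a e ⊗ₜ[k] K l (u e b)) := by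
    intro r u hu a b l
    suffices H : ∑ e, t ∘ₗ TensorProduct.mk k X X (u a e) ∘ₗ K.flip (u e b)
        = ∑ e, T ∘ₗ TensorProduct.mk k X X (u a e) ∘ₗ K.flip (u e b) by
      simpa using LinearMap.congr_fun H l
    refine ext_isMult i fun r' w hw c d => ?_
    simp only [LinearMap.sum_apply, LinearMap.comp_apply, LinearMap.flip_apply,
      TensorProduct.mk_apply]
    rw [← map_sum, h u w hu hw]
    have hv := fun e => (hm.multColon w u hw hu).comul_apply (c, b) (d, e)
    simp only at hv
    have hx := fun e => congrArg (TensorProduct.map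
      (projL ∘ₗ t ∘ₗ TensorProduct.mk k X X (u a e)) LinearMap.id) (hm.exchange u w hu hw e b c d)
    simp only [map_sum, TensorProduct.map_tmul, LinearMap.id_coe, id_eq, LinearMap.comp_apply,
      TensorProduct.mk_apply] at hx
    have p1 := h.projL_apply hm.multDot hu
    have p2 := h.projR_apply hu
    symm
    calc ∑ e, T (u a e ⊗ₜ[k] K (w c d) (u e b))
        = ∑ e, ∑ g, ∑ q, ∑ f, projL (t (u a f ⊗ₜ[k] K (w c g) (u q b))) ⊗ₜ[k]
            projR (t (u f e ⊗ₜ[k] K (w g d) (u e q))) := by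
          simp only [hT, LinearMap.comp_apply, TensorProduct.map_tmul, hu.comul_apply, hv,
            TensorProduct.sum_tmul, TensorProduct.tmul_sum, map_sum, LinearEquiv.coe_coe,
            TensorProduct.tensorTensorTensorComm_tmul, Fintype.sum_prod_type]
      _ = ∑ f, ∑ q, ∑ g, projL (t (u a f ⊗ₜ[k] K (w c g) (u q b))) ⊗ₜ[k] D (u f q) (w g d) := by
          rw [sum_comm_four]
          simp only [← p2, map_sum, TensorProduct.tmul_sum]
      _ = ∑ q, ∑ g, ∑ f, projL (t (u a f ⊗ₜ[k] K (w g d) (u f q))) ⊗ₜ[k] D (u q b) (w c g) := by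
          simp only [hx]
          rw [Finset.sum_comm]
          exact Finset.sum_congr rfl fun q _ => Finset.sum_comm
      _ = ∑ g, w g d ⊗ₜ[k] D (u a b) (w c g) := by
          simp only [← TensorProduct.sum_tmul, ← map_sum, p1]
          rw [Finset.sum_comm]
          simp [TensorProduct.ite_tmul]
  refine TensorProduct.ext (ext_isMult i fun r u hu a b => ?_)
  ext l
  have hl : u a b ⊗ₜ[k] l = ∑ d, ∑ e, u a e ⊗ₜ[k] K (K₀ l (u d b)) (u e d) := by
    calc _ = ∑ e, u a e ⊗ₜ[k] (if e = b then l else 0) := by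
          rw [Finset.sum_eq_single b] <;> simp +contextual
      _ = ∑ e, ∑ d, u a e ⊗ₜ[k] K (K₀ l (u d b)) (u e d) := by
          refine Finset.sum_congr rfl fun e _ => ?_
          rw [← h1 u hu, TensorProduct.tmul_sum]
      _ = _ := Finset.sum_comm
  change t (u a b ⊗ₜ[k] l) = T (u a b ⊗ₜ[k] l)
  rw [hl, map_sum, map_sum]
  exact Finset.sum_congr rfl fun d _ => key r u hu a d _

theorem IsInverseBraiding.isBraiding (h : IsInverseBraiding i t D K) (hm : IsMagma i i D K)
    (hK : IsConvInv i K₀ K) (hD₁ : IsMultOp (i + 1) (i + 1) D₁)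
    (ht : ∀ x y, D' x y = projR (t (x ⊗ₜ[k] y))) (h1 : IsConvInv i D₁ D')
    (h2 : ∀ ⦃m : Type⦄ [Fintype m] [DecidableEq m] (w : m → m → X), IsMult k (i + 1) w →
      ∀ x c d, projL (t (∑ e, D₁ x (w c e) ⊗ₜ[k] w e d)) = K₁ (w c d) x) :
    IsBraiding (i + 1) t D₁ K₁ := by
  intro n m _ _ _ _ u w hu hw a b c d
  have hM := fun e => (hD₁ u w hu hw).transpose'.comul_apply (b, c) (a, e)
  have hw' := fun e => hw.transpose'.comul_apply d e
  simp only at hM hw'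
  rw [h.eq_components hm hK]
  simp only [LinearMap.comp_apply, TensorProduct.map_tmul, hM, hw',
    TensorProduct.sum_tmul, TensorProduct.tmul_sum, map_sum, LinearEquiv.coe_coe,
    TensorProduct.tensorTensorTensorComm_tmul, Fintype.sum_prod_type]
  have hp : ∀ e p q, ∑ f, projR (t (D₁ (u a e) (w p f) ⊗ₜ[k] w f q)) = if p = q then u a e else 0 := by
    intro e p q
    simp only [← ht]
    rw [h1 _ hw.transpose' q p]
    simp only [eq_comm]
  rw [sum_comm_four, Finset.sum_comm]
  calc _ = ∑ e, ∑ p, ∑ q, projL (t (D₁ (u e b) (w c p) ⊗ₜ[k] w q d)) ⊗ₜ[k]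
            ∑ f, projR (t (D₁ (u a e) (w p f) ⊗ₜ[k] w f q)) := by
        simp only [TensorProduct.tmul_sum]
    _ = ∑ e, ∑ p, projL (t (D₁ (u e b) (w c p) ⊗ₜ[k] w p d)) ⊗ₜ[k] u a e := by
        simp [hp, TensorProduct.tmul_ite]
    _ = _ := by
        simp only [← TensorProduct.sum_tmul, ← map_sum, h2 w hw]

theorem IsBraiding.isInverseBraiding (h : IsBraiding i t D K)
    (hs : ∀ z, s (TensorProduct.comm k X X (t (TensorProduct.comm k X X z))) = z) :
    IsInverseBraiding i s D K := by
  intro n m _ _ _ _ u w hu hw a b c d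
  have := hs (∑ e, w e d ⊗ₜ[k] D (u a b) (w c e))
  rw [map_sum] at this
  simp only [TensorProduct.comm_tmul] at this
  rw [h u w hu hw, map_sum] at this
  simpa only [TensorProduct.comm_tmul] using this

theorem IsBraiding.projL_apply (h : IsBraiding i t D K) ⦃m : Type⦄ [Fintype m] [DecidableEq m]
    (w : m → m → X) (hw : IsMult k i w) (x : X) (c d : m) :
    projL (t (∑ e, D x (w c e) ⊗ₜ[k] w e d)) = K (w c d) x := by
  suffices H : ∑ e, projL ∘ₗ t ∘ₗ (TensorProduct.mk k X X).flip (w e d) ∘ₗ D.flip (w c e)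
      = K (w c d) by
    simpa using LinearMap.congr_fun H x
  refine ext_isMult i fun r u hu a b => ?_
  have := congrArg (projL (k := k)) (h u w hu hw a b c d)
  simp only [map_sum, projL_tmul, hu.counit_apply] at this
  simpa using this

end Diagonal

section StrongRegularity

variable {k : Type u} [Field k] {X : Type v} [AddCommGroup X] [Module k X] [Coalgebra k X]

theorem G_tmul (p : X ⊗[k] X →ₗ[k] X) {m : Type} [Fintype m] [DecidableEq m] {w : m → m → X}
    (hw : IsMult k 0 w) (x : X) (a b : m) :
    G p (x ⊗ₜ[k] w a b) = ∑ c, p (x ⊗ₜ[k] w a c) ⊗ₜ[k] w c b := by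
  have := hw.comul_apply a b
  rw [levelComul_zero] at this
  simp [G, this, TensorProduct.tmul_sum]

theorem Gcop_tmul (p : X ⊗[k] X →ₗ[k] X) {m : Type} [Fintype m] [DecidableEq m] {w : m → m → X}
    (hw : IsMult k 1 w) (x : X) (a b : m) :
    Gcop p (x ⊗ₜ[k] w a b) = ∑ c, p (x ⊗ₜ[k] w a c) ⊗ₜ[k] w c b := by
  have := hw.comul_apply a b
  rw [levelComul_of_odd (by simp)] at this
  simp [Gcop, this, TensorProduct.tmul_sum]

theorem isConvInv_of_G {i : ℤ} (hi : ¬ Even i) {p q : X ⊗[k] X →ₗ[k] X} (h : q ∘ₗ G p = projL) :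
    IsConvInv i (TensorProduct.curry p) (TensorProduct.curry q) := by
  intro m _ _ w hw a b x
  have hw' : IsMult k 0 (fun a b => w b a) := hw.transpose.congr (by simpa using hi)
  have := LinearMap.congr_fun h (x ⊗ₜ w a b)
  rw [LinearMap.comp_apply, G_tmul p hw' x b a, projL_tmul, hw.counit_apply] at this
  simp only [TensorProduct.curry_apply, ← map_sum, this]
  simp

theorem isConvInv_of_Gcop {i : ℤ} (hi : Even i) {p q : X ⊗[k] X →ₗ[k] X}
    (h : q ∘ₗ Gcop p = projL) :
    IsConvInv i (TensorProduct.curry p) (TensorProduct.curry q) := by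
  intro m _ _ w hw a b x
  have hw' : IsMult k 1 (fun a b => w b a) := hw.transpose.congr (by simp [hi])
  have := LinearMap.congr_fun h (x ⊗ₜ w a b)
  rw [LinearMap.comp_apply, Gcop_tmul p hw' x b a, projL_tmul, hw.counit_apply] at this
  simp only [TensorProduct.curry_apply, ← map_sum, this]
  simp

theorem projInv_comp_G {p : X ⊗[k] X →ₗ[k] X} (h : IsLeftRegular p) :
    projInv (G p) h ∘ₗ G p = projL := by
  ext x y
  simp only [projInv, LinearMap.comp_apply, LinearEquiv.coe_coe, TensorProduct.AlgebraTensorModule.curry_apply,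
    LinearMap.restrictScalars_self, TensorProduct.curry_apply]
  congr 1
  exact (LinearEquiv.ofBijective (G p) h).symm_apply_apply _

/-- The operations of a strongly regular structure, indexed by a single integer: the even indices
carry `pᵢ` and `dᵢ`, the odd ones their inverses. -/
theorem IsStronglyRegular.exists_levels {p d : X ⊗[k] X →ₗ[k] X} (h : IsStronglyRegular p d) :
    ∃ (hl : IsLeftRegular p) (F K : ℤ → X →ₗ[k] X →ₗ[k] X),
      F 0 = TensorProduct.curry p ∧ K 0 = TensorProduct.curry d ∧
      F (-1) = TensorProduct.curry (projInv (G p) hl) ∧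
      ∀ j, (IsConvInv j (F j) (F (j + 1)) ∧ IsConvInv j (F (j + 1)) (F j)) ∧
        IsConvInv j (K j) (K (j + 1)) ∧ IsConvInv j (K (j + 1)) (K j) := by
  obtain ⟨hl, hr, P, D, gp, gd, hP, hD, hgp, -, h⟩ := h
  refine ⟨hl, fun j => TensorProduct.curry (if Even j then P (j / 2) else gp ((j + 1) / 2)),
    fun j => TensorProduct.curry (if Even j then D (j / 2) else gd (j / 2)), by simp [hP],
    by simp [hD], by simp [hgp], fun j => ?_⟩
  rcases Int.even_or_odd' j with ⟨m, rfl | rfl⟩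
  · have e1 : (2 * m + 1 + 1) / 2 = m + 1 := by omega
    have e2 : (2 * m + 1) / 2 = m := by omega
    have e3 : 2 * m / 2 = m := by omega
    have ev : Even (2 * m) := by simp
    have od : ¬ Even (2 * m + 1) := by simp
    simp only [if_pos ev, if_neg od, e1, e2, e3]
    obtain ⟨⟨h1, h2⟩, -⟩ := h (m + 1)
    rw [add_sub_cancel_right] at h1 h2
    obtain ⟨-, -, -, h3, h4⟩ := h m
    exact ⟨⟨isConvInv_of_Gcop ev h2, isConvInv_of_Gcop ev h1⟩, isConvInv_of_Gcop ev h4,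
      isConvInv_of_Gcop ev h3⟩
  · have e1 : (2 * m + 1 + 1) / 2 = m + 1 := by omega
    have e2 : (2 * m + 1) / 2 = m := by omega
    have ev : Even (2 * m + 1 + 1) := by simp [parity_simps]
    have od : ¬ Even (2 * m + 1) := by simp
    simp only [if_pos ev, if_neg od, e1, e2]
    obtain ⟨-, ⟨h1, h2⟩, ⟨h3, h4⟩, -⟩ := h (m + 1)
    rw [add_sub_cancel_right] at h1 h2
    exact ⟨⟨isConvInv_of_G od h3, isConvInv_of_G od h4⟩, isConvInv_of_G od h1,
      isConvInv_of_G od h2⟩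

theorem levelComul_cop (n : ℤ) (x : X) :
    levelComul k (Cop X) n x = levelComul k X (n + 1) x := by
  by_cases hn : Even n
  · rw [levelComul_of_even hn, levelComul_of_odd (by simp [hn])]
    rfl
  · rw [levelComul_of_odd hn, levelComul_of_even (by simpa using hn)]
    exact (TensorProduct.comm k X X).apply_symm_apply _

theorem isMult_cop {i : ℤ} {m : Type} [Fintype m] [DecidableEq m] {w : m → m → X} :
    IsMult (X := Cop X) k i w ↔ IsMult (X := X) k (i + 1) w :=
  ⟨fun h => ⟨fun a b => (levelComul_cop i (w a b)).symm.trans (h.comul_apply a b), h.counit_apply⟩,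
   fun h => ⟨fun a b => (levelComul_cop i (w a b)).trans (h.comul_apply a b), h.counit_apply⟩⟩

/-- An operation on `X^cop`, as an operation on `X`. -/
def ofCop (f : Cop X →ₗ[k] Cop X →ₗ[k] Cop X) : X →ₗ[k] X →ₗ[k] X := f

theorem isConvInv_cop {i : ℤ} {f g : Cop X →ₗ[k] Cop X →ₗ[k] Cop X} (h : IsConvInv i f g) :
    IsConvInv (i + 1) (ofCop f) (ofCop g) :=
  fun _ _ _ w hw => h w (isMult_cop.2 hw)

end StrongRegularity

end QBrace

namespace QBrace

/-! ### `q`-magma coalgebras in terms of multiplicative matrices -/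

section Interface

variable {k : Type u} [Field k] {X : Type v} [AddCommGroup X] [Module k X] [Coalgebra k X]
variable {p d : X ⊗[k] X →ₗ[k] X}

theorem IsMult.comul_zero {n : Type} [Fintype n] [DecidableEq n] {u : n → n → X}
    (hu : IsMult k 0 u) (a b : n) : comul (R := k) (u a b) = ∑ c, u a c ⊗ₜ[k] u c b := by
  rw [← hu.comul_apply, levelComul_zero]

theorem IsMult.comul_cop {n : Type} [Fintype n] [DecidableEq n] {u : n → n → X}
    (hu : IsMult k 0 u) (a b : n) : comul (R := k) (toCop k X (u a b))
      = ∑ c, toCop k X (u c b) ⊗ₜ[k] toCop k X (u a c) := by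
  change TensorProduct.comm k X X (comul (R := k) (u a b)) = _
  rw [hu.comul_zero, map_sum]
  rfl

theorem hMap_tmul {n m : Type} [Fintype n] [DecidableEq n] [Fintype m] [DecidableEq m]
    {u : n → n → X} {w : m → m → X} (hu : IsMult k 0 u) (hw : IsMult k 0 w) (a b : n) (c e : m) :
    hMap p d (u a b ⊗ₜ[k] toCop k X (w c e))
      = ∑ q : n × m, toCop k X (d (w c q.2 ⊗ₜ[k] u q.1 b)) ⊗ₜ[k] p (u a q.1 ⊗ₜ[k] w q.2 e) := by
  simp only [hMap, LinearMap.comp_apply, TensorProduct.comul_tmul, hu.comul_zero, hw.comul_cop,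
    TensorProduct.sum_tmul, TensorProduct.tmul_sum, map_sum,
    TensorProduct.AlgebraTensorModule.tensorTensorTensorComm_tmul, TensorProduct.map_tmul,
    LinearEquiv.coe_coe, LinearMap.lTensor_tmul, TensorProduct.comm_tmul,
    LinearEquiv.symm_apply_apply, Fintype.sum_prod_type]
  exact Finset.sum_comm

theorem IsMagma.counit_comp (h : IsMagma 0 0 (TensorProduct.curry p) (TensorProduct.curry d)) :
    counit ∘ₗ p = (counit : X ⊗[k] X →ₗ[k] k) ∧ counit ∘ₗ d = (counit : X ⊗[k] X →ₗ[k] k) := by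
  constructor
  · refine TensorProduct.ext' fun x y => ?_
    have := h.multDot.counit_apply x y
    simpa [mul_comm] using this
  · refine TensorProduct.ext' fun x y => ?_
    have := h.multColon.counit_apply x y
    simpa [mul_comm] using this

theorem map_hMap_comul {n m : Type} [Fintype n] [DecidableEq n] [Fintype m] [DecidableEq m]
    {u : n → n → X} {w : m → m → X} (hu : IsMult k 0 u) (hw : IsMult k 0 w) (a b : n) (c e : m) :
    TensorProduct.map (hMap p d) (hMap p d) (comul (u a b ⊗ₜ[k] toCop k X (w c e)))
      = ∑ P : n × m, hMap p d (u a P.1 ⊗ₜ[k] toCop k X (w P.2 e)) ⊗ₜ[k]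
          hMap p d (u P.1 b ⊗ₜ[k] toCop k X (w c P.2)) := by
  simp only [TensorProduct.comul_tmul, hu.comul_zero, hw.comul_cop,
    TensorProduct.sum_tmul, TensorProduct.tmul_sum, map_sum,
    TensorProduct.AlgebraTensorModule.tensorTensorTensorComm_tmul, TensorProduct.map_tmul,
    Fintype.sum_prod_type]
  exact Finset.sum_comm

theorem ext_tmul_cop {M : Type*} [AddCommGroup M] [Module k M] {f g : X ⊗[k] Cop X →ₗ[k] M}
    (h : ∀ (r s : ℕ) (u : Fin r → Fin r → X) (w : Fin s → Fin s → X), IsMult k 0 u →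
      IsMult k 0 w → ∀ a b c e,
        f (u a b ⊗ₜ[k] toCop k X (w c e)) = g (u a b ⊗ₜ[k] toCop k X (w c e))) : f = g := by
  refine TensorProduct.ext (ext_isMult 0 fun r u hu a b => ?_)
  have : (TensorProduct.mk k X (Cop X)).compr₂ f (u a b) ∘ₗ (toCop k X).toLinearMap
      = (TensorProduct.mk k X (Cop X)).compr₂ g (u a b) ∘ₗ (toCop k X).toLinearMap :=
    ext_isMult 0 fun s w hw c e => h r s u w hu hw a b c e
  refine LinearMap.ext fun y => ?_
  obtain ⟨y, rfl⟩ := (toCop k X).surjective y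
  exact LinearMap.congr_fun this y

theorem IsMagma.isCoalgMap_hMap
    (h : IsMagma 0 0 (TensorProduct.curry p) (TensorProduct.curry d)) :
    IsCoalgMap (hMap p d) := by
  obtain ⟨hp, hd⟩ := h.counit_comp
  have hp' := fun x y => LinearMap.congr_fun hp (x ⊗ₜ[k] y)
  have hd' := fun x y => LinearMap.congr_fun hd (x ⊗ₜ[k] y)
  simp only [LinearMap.comp_apply, TensorProduct.counit_tmul] at hp' hd'
  constructor
  · refine ext_tmul_cop fun r s u w hu hw a b c e => ?_
    have ec : ∀ x, counit (R := k) (toCop k X x) = counit (R := k) x := fun _ => rfl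
    rw [LinearMap.comp_apply, hMap_tmul hu hw]
    simp [ec, hp', hd', hu.counit_apply, hw.counit_apply, Fintype.sum_prod_type]
  · refine ext_tmul_cop fun r s u w hu hw a b c e => ?_
    rw [LinearMap.comp_apply, LinearMap.comp_apply, map_hMap_comul hu hw, hMap_tmul hu hw, map_sum]
    have hK : ∀ P : Fin r × Fin s, comul (R := k) (toCop k X (d (w c P.2 ⊗ₜ[k] u P.1 b)))
        = ∑ R : Fin r × Fin s, toCop k X (d (w R.2 P.2 ⊗ₜ[k] u P.1 R.1)) ⊗ₜ[k]
          toCop k X (d (w c R.2 ⊗ₜ[k] u R.1 b)) := by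
      intro P
      have := (h.multColon w u hw hu).comul_cop (c, b) (P.2, P.1)
      simp only [TensorProduct.curry_apply] at this
      rw [this, ← Equiv.sum_comp (Equiv.prodComm (Fin r) (Fin s))]
      rfl
    have hD : ∀ P : Fin r × Fin s, comul (R := k) (p (u a P.1 ⊗ₜ[k] w P.2 e))
        = ∑ Q : Fin r × Fin s, p (u a Q.1 ⊗ₜ[k] w Q.2 e) ⊗ₜ[k] p (u Q.1 P.1 ⊗ₜ[k] w P.2 Q.2) :=
      fun P => (h.multDot u w hu hw).comul_zero (a, e) P
    have hC : ∀ Q R : Fin r × Fin s,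
        ∑ P : Fin r × Fin s, d (w P.2 Q.2 ⊗ₜ[k] u Q.1 P.1) ⊗ₜ[k] p (u P.1 R.1 ⊗ₜ[k] w R.2 P.2)
        = ∑ P : Fin r × Fin s, d (w R.2 P.2 ⊗ₜ[k] u P.1 R.1) ⊗ₜ[k]
            p (u Q.1 P.1 ⊗ₜ[k] w P.2 Q.2) := by
      intro Q R
      simp only [Fintype.sum_prod_type]
      exact (h.exchange u w hu hw Q.1 R.1 R.2 Q.2).symm
    simp only [hMap_tmul hu hw, TensorProduct.sum_tmul, TensorProduct.tmul_sum]
    calc _ = ∑ R : Fin r × Fin s, ∑ Q : Fin r × Fin s, TensorProduct.map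
          ((TensorProduct.mk k (Cop X) X).flip (p (u a Q.1 ⊗ₜ[k] w Q.2 e)) ∘ₗ
            (toCop k X).toLinearMap)
          (TensorProduct.mk k (Cop X) X (toCop k X (d (w c R.2 ⊗ₜ[k] u R.1 b))))
          (∑ P : Fin r × Fin s, d (w P.2 Q.2 ⊗ₜ[k] u Q.1 P.1) ⊗ₜ[k]
            p (u P.1 R.1 ⊗ₜ[k] w R.2 P.2)) := by
          rw [sum_comm_three, Finset.sum_comm]
          simp only [map_sum, TensorProduct.map_tmul]
          rfl
      _ = ∑ R : Fin r × Fin s, ∑ Q : Fin r × Fin s, TensorProduct.map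
          ((TensorProduct.mk k (Cop X) X).flip (p (u a Q.1 ⊗ₜ[k] w Q.2 e)) ∘ₗ
            (toCop k X).toLinearMap)
          (TensorProduct.mk k (Cop X) X (toCop k X (d (w c R.2 ⊗ₜ[k] u R.1 b))))
          (∑ P : Fin r × Fin s, d (w R.2 P.2 ⊗ₜ[k] u P.1 R.1) ⊗ₜ[k]
            p (u Q.1 P.1 ⊗ₜ[k] w P.2 Q.2)) := by simp only [hC]
      _ = ∑ P : Fin r × Fin s, ∑ Q : Fin r × Fin s, ∑ R : Fin r × Fin s,
          (toCop k X (d (w R.2 P.2 ⊗ₜ[k] u P.1 R.1)) ⊗ₜ[k] p (u a Q.1 ⊗ₜ[k] w Q.2 e)) ⊗ₜ[k]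
          (toCop k X (d (w c R.2 ⊗ₜ[k] u R.1 b)) ⊗ₜ[k] p (u Q.1 P.1 ⊗ₜ[k] w P.2 Q.2)) := by
          rw [sum_comm_three]
          simp only [map_sum, TensorProduct.map_tmul]
          rfl
      _ = _ := by
          simp only [TensorProduct.comul_tmul, hK, hD, TensorProduct.sum_tmul,
            TensorProduct.tmul_sum, map_sum,
            TensorProduct.AlgebraTensorModule.tensorTensorTensorComm_tmul]

section Legs

variable {A B : Type*} [AddCommGroup A] [Module k A] [AddCommGroup B] [Module k B]

variable (k A B) in
/-- `A ⊗ ε`. -/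
noncomputable def legL [Coalgebra k B] : A ⊗[k] B →ₗ[k] A :=
  (TensorProduct.rid k A).toLinearMap ∘ₗ counit.lTensor A

variable (k A B) in
/-- `ε ⊗ B`. -/
noncomputable def legR [Coalgebra k A] : A ⊗[k] B →ₗ[k] B :=
  (TensorProduct.lid k B).toLinearMap ∘ₗ counit.rTensor B

@[simp]
theorem legL_tmul [Coalgebra k B] (a : A) (b : B) : legL k A B (a ⊗ₜ b) = counit (R := k) b • a := by simp [legL]

@[simp]
theorem legR_tmul [Coalgebra k A] (a : A) (b : B) : legR k A B (a ⊗ₜ b) = counit (R := k) a • b := by simp [legR]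

variable [Coalgebra k A] [Coalgebra k B]

theorem ext_tmul_isMult {M : Type*} [AddCommGroup M] [Module k M] {f g : A ⊗[k] B →ₗ[k] M}
    (h : ∀ (r s : ℕ) (u : Fin r → Fin r → A) (w : Fin s → Fin s → B), IsMult k 0 u →
      IsMult k 0 w → ∀ a b c e, f (u a b ⊗ₜ[k] w c e) = g (u a b ⊗ₜ[k] w c e)) : f = g :=
  TensorProduct.ext (ext_isMult₂ 0 0 h)

theorem map_legL_legL (z : A ⊗[k] B) :
    TensorProduct.map (legL k A B) (legL k A B) (comul z) = comul (legL k A B z) := by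
  suffices H : TensorProduct.map (legL k A B) (legL k A B) ∘ₗ comul = comul ∘ₗ legL k A B from
    LinearMap.congr_fun H z
  refine ext_tmul_isMult fun r s u w hu hw a b c e => ?_
  simp only [LinearMap.comp_apply, TensorProduct.comul_tmul, hu.comul_zero, hw.comul_zero]
  by_cases hce : c = e <;>
  simp [hu.comul_zero, hce, TensorProduct.sum_tmul, TensorProduct.tmul_sum,
    hw.counit_apply, ite_smul, TensorProduct.ite_tmul, TensorProduct.tmul_ite]

theorem map_legR_legR (z : A ⊗[k] B) :
    TensorProduct.map (legR k A B) (legR k A B) (comul z) = comul (legR k A B z) := by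
  suffices H : TensorProduct.map (legR k A B) (legR k A B) ∘ₗ comul = comul ∘ₗ legR k A B from
    LinearMap.congr_fun H z
  refine ext_tmul_isMult fun r s u w hu hw a b c e => ?_
  simp only [LinearMap.comp_apply, TensorProduct.comul_tmul, hu.comul_zero, hw.comul_zero]
  by_cases hab : a = b <;>
  simp [hw.comul_zero, hab, TensorProduct.sum_tmul, TensorProduct.tmul_sum,
    hu.counit_apply, ite_smul, TensorProduct.ite_tmul, TensorProduct.tmul_ite]

theorem map_legL_legR (z : A ⊗[k] B) :
    TensorProduct.map (legL k A B) (legR k A B) (comul z) = z := by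
  suffices H : TensorProduct.map (legL k A B) (legR k A B) ∘ₗ comul = LinearMap.id from
    LinearMap.congr_fun H z
  refine ext_tmul_isMult fun r s u w hu hw a b c e => ?_
  simp [hu.comul_zero, hw.comul_zero, TensorProduct.sum_tmul, TensorProduct.tmul_sum,
    hu.counit_apply, hw.counit_apply, ite_smul, TensorProduct.ite_tmul, TensorProduct.tmul_ite]

end Legs

theorem legR_hMap (hd : counit ∘ₗ d = (counit : X ⊗[k] X →ₗ[k] k)) {n m : Type} [Fintype n]
    [DecidableEq n] [Fintype m] [DecidableEq m] {u : n → n → X} {w : m → m → X}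
    (hu : IsMult k 0 u) (hw : IsMult k 0 w) (a b : n) (c e : m) :
    legR k (Cop X) X (hMap p d (u a b ⊗ₜ[k] toCop k X (w c e))) = p (u a b ⊗ₜ[k] w c e) := by
  have hd' := fun x y => LinearMap.congr_fun hd (x ⊗ₜ[k] y)
  simp only [LinearMap.comp_apply, TensorProduct.counit_tmul] at hd'
  have ec : ∀ x, counit (R := k) (toCop k X x) = counit (R := k) x := fun _ => rfl
  rw [hMap_tmul hu hw]
  simp [ec, hd', hu.counit_apply, hw.counit_apply, Fintype.sum_prod_type]

theorem legL_hMap (hp : counit ∘ₗ p = (counit : X ⊗[k] X →ₗ[k] k)) {n m : Type} [Fintype n]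
    [DecidableEq n] [Fintype m] [DecidableEq m] {u : n → n → X} {w : m → m → X}
    (hu : IsMult k 0 u) (hw : IsMult k 0 w) (a b : n) (c e : m) :
    legL k (Cop X) X (hMap p d (u a b ⊗ₜ[k] toCop k X (w c e)))
      = toCop k X (d (w c e ⊗ₜ[k] u a b)) := by
  have hp' := fun x y => LinearMap.congr_fun hp (x ⊗ₜ[k] y)
  simp only [LinearMap.comp_apply, TensorProduct.counit_tmul] at hp'
  rw [hMap_tmul hu hw]
  simp [hp', hu.counit_apply, hw.counit_apply, Fintype.sum_prod_type]

/-- The two operations are recovered from the coalgebra morphism `hMap` by composing with counits,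
which shows that each of them is a coalgebra morphism, and comparing both orders of the two
components gives the exchange relation. -/
theorem isMagma_of_isCoalgMap (hp : counit ∘ₗ p = (counit : X ⊗[k] X →ₗ[k] k))
    (hd : counit ∘ₗ d = (counit : X ⊗[k] X →ₗ[k] k)) (h : IsCoalgMap (hMap p d)) :
    IsMagma 0 0 (TensorProduct.curry p) (TensorProduct.curry d) := by
  have hp' := fun x y => LinearMap.congr_fun hp (x ⊗ₜ[k] y)
  have hd' := fun x y => LinearMap.congr_fun hd (x ⊗ₜ[k] y)
  simp only [LinearMap.comp_apply, TensorProduct.counit_tmul] at hp' hd'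
  have E := fun z => LinearMap.congr_fun h.2 z
  simp only [LinearMap.comp_apply] at E
  refine ⟨?_, ?_, ?_⟩
  · intro n m _ _ _ _ u w hu hw
    refine ⟨fun P Q => ?_, fun P Q => ?_⟩
    · have := congrArg (TensorProduct.map (legR k (Cop X) X) (legR k (Cop X) X))
        (E (u P.1 Q.1 ⊗ₜ toCop k X (w Q.2 P.2)))
      rw [map_hMap_comul hu hw, map_legR_legR] at this
      simp only [map_sum, TensorProduct.map_tmul, legR_hMap hd hu hw] at this
      rw [levelComul_zero]
      exact this.symm
    · simp only [TensorProduct.curry_apply, hp', hu.counit_apply, hw.counit_apply, Prod.ext_iff]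
      by_cases h1 : P.1 = Q.1 <;> by_cases h2 : P.2 = Q.2 <;> simp [h1, h2, eq_comm]
  · intro m n _ _ _ _ w u hw hu
    refine ⟨fun P Q => ?_, fun P Q => ?_⟩
    · have := congrArg (TensorProduct.map (legL k (Cop X) X) (legL k (Cop X) X))
        (E (u Q.2 P.2 ⊗ₜ toCop k X (w P.1 Q.1)))
      rw [map_hMap_comul hu hw, map_legL_legL] at this
      simp only [map_sum, TensorProduct.map_tmul, legL_hMap hp hu hw] at this
      have h2 : TensorProduct.comm k X X (comul (d (w P.1 Q.1 ⊗ₜ[k] u Q.2 P.2)))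
          = ∑ R : n × m, d (w R.2 Q.1 ⊗ₜ[k] u Q.2 R.1) ⊗ₜ[k] d (w P.1 R.2 ⊗ₜ[k] u R.1 P.2) :=
        this.symm
      apply (TensorProduct.comm k X X).injective
      rw [levelComul_zero, TensorProduct.curry_apply, h2, map_sum,
        ← Equiv.sum_comp (Equiv.prodComm n m)]
      rfl
    · simp only [TensorProduct.curry_apply, hd', hu.counit_apply, hw.counit_apply, Prod.ext_iff]
      by_cases h1 : P.1 = Q.1 <;> by_cases h2 : P.2 = Q.2 <;> simp [h1, h2, eq_comm]
  · intro n m _ _ _ _ u w hu hw a b c e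
    have := congrArg (TensorProduct.map (legL k (Cop X) X) (legR k (Cop X) X))
        (E (u a b ⊗ₜ toCop k X (w c e)))
    rw [map_hMap_comul hu hw, map_legL_legR, hMap_tmul hu hw] at this
    simp only [map_sum, TensorProduct.map_tmul, legL_hMap hp hu hw, legR_hMap hd hu hw,
      Fintype.sum_prod_type] at this
    exact this.symm

end Interface

end QBrace

namespace QBrace

/-! ### Level systems from very strong regularity -/

section VeryStrongRegularity

variable {k : Type u} [Field k] {X : Type v} [AddCommGroup X] [Module k X] [Coalgebra k X]
variable {p d : X ⊗[k] X →ₗ[k] X}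

/-- `s_𝒳` is determined by its values on the elements `x · y₍₁₎ ⊗ y₍₂₎`. -/
theorem sMap_isBraiding (hm : IsMagma 0 0 (TensorProduct.curry p) (TensorProduct.curry d))
    (hl : IsLeftRegular p) :
    IsBraiding 0 (sMap p d hl) (TensorProduct.curry p) (TensorProduct.curry d) := by
  intro n m _ _ _ _ u w hu hw a b c e
  have hD := fun f => (hm.multDot u w hu hw).comul_zero (a, f) (b, c)
  simp only [TensorProduct.curry_apply] at hD ⊢
  have h1 : ∀ (x : X) (f g : m), sup p hl (∑ q, p (x ⊗ₜ[k] w f q) ⊗ₜ[k] w q g)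
      = if f = g then x else 0 := by
    intro x f g
    rw [← G_tmul p hw]
    have := LinearMap.congr_fun (projInv_comp_G hl) (x ⊗ₜ w f g)
    rw [LinearMap.comp_apply, projL_tmul, hw.counit_apply] at this
    rw [sup, this]
    split_ifs <;> simp
  have h2 : ∀ (x : X) (f g : m), lsup p d hl (∑ q, p (x ⊗ₜ[k] w f q) ⊗ₜ[k] w q g)
      = d (w f g ⊗ₜ[k] x) := by
    intro x f g
    simp only [lsup, LinearMap.comp_apply, map_sum, G_tmul _ hw, LinearEquiv.coe_coe,
      TensorProduct.comm_tmul]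
    rw [Finset.sum_comm]
    simp only [← map_sum, ← TensorProduct.tmul_sum]
    simp only [map_sum] at h1
    calc _ = ∑ q, d (w q g ⊗ₜ[k] if f = q then x else 0) := by
          simp only [← h1, map_sum]
      _ = _ := by
          rw [Finset.sum_eq_single f] <;> simp +contextual [eq_comm]
  simp only [sMap, LinearMap.comp_apply, map_sum, TensorProduct.comul_tmul, hD, hw.comul_zero,
    TensorProduct.sum_tmul, TensorProduct.tmul_sum, LinearEquiv.coe_coe,
    TensorProduct.AlgebraTensorModule.tensorTensorTensorComm_tmul, TensorProduct.map_tmul,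
    TensorProduct.comm_tmul, Fintype.sum_prod_type]
  rw [sum_comm_four, Finset.sum_comm]
  simp only [← TensorProduct.tmul_sum]
  simp only [map_sum] at h1 h2
  simp only [h1, TensorProduct.tmul_ite, Finset.sum_ite_eq,
    Finset.mem_univ, if_true]
  simp only [← TensorProduct.sum_tmul, h2]

/-- A very strongly regular structure gives rise to operations between all iterated antipodes of
its elements: the strong regularity of `𝒳` provides `Sⁱ(y) · Sʲ(l)` and `Sⁱ(y) : Sʲ(l)` for even
`i`, and that of the structure on `X^cop` provides them for odd `i`.  The braiding `s_𝒳` and its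
inverse relate the two parities. -/
theorem exists_isLevelSystem
    (hm : IsMagma 0 0 (TensorProduct.curry p) (TensorProduct.curry d))
    (h : IsVeryStronglyRegular p d) :
    ∃ D K : ℤ → ℤ → X →ₗ[k] X →ₗ[k] X, IsLevelSystem D K ∧
      D 0 0 = TensorProduct.curry p ∧ K 0 0 = TensorProduct.curry d := by
  obtain ⟨h, hl, hs, ht, h'⟩ := h
  have hsB := sMap_isBraiding hm hl
  generalize sMap p d hl = s at hs ht h' hsB
  obtain ⟨_, F, K, F0, K0, F1, hF⟩ := h.exists_levels
  obtain ⟨hl', F', K', F0', K0', F1', hF'⟩ := h'.exists_levels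
  let t : X ⊗[k] X →ₗ[k] X ⊗[k] X := (TensorProduct.comm k X X).toLinearMap ∘ₗ
    (LinearEquiv.ofBijective s hs).symm.toLinearMap ∘ₗ (TensorProduct.comm k X X).toLinearMap
  have ht_eq : ∀ z : X ⊗[k] X, (tildeTauInv s hs : X ⊗[k] X →ₗ[k] X ⊗[k] X) z = t z := by
    intro z
    change TensorProduct.map LinearMap.id LinearMap.id (TensorProduct.comm k X X
      ((LinearEquiv.ofBijective s hs).symm (TensorProduct.comm k X X
        (TensorProduct.map LinearMap.id LinearMap.id z)))) = _
    rw [TensorProduct.map_id]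
    rfl
  have hst : ∀ z, s (TensorProduct.comm k X X (t (TensorProduct.comm k X X z))) = z := by
    intro z
    simp only [t, LinearMap.comp_apply, LinearEquiv.coe_coe, TensorProduct.comm_comm]
    exact (LinearEquiv.ofBijective s hs).apply_symm_apply z
  have hts : ∀ z, t (TensorProduct.comm k X X (s (TensorProduct.comm k X X z))) = z := by
    intro z
    simp only [t, LinearMap.comp_apply, LinearEquiv.coe_coe, TensorProduct.comm_comm]
    have := (LinearEquiv.ofBijective s hs).symm_apply_apply (TensorProduct.comm k X X z)
    rw [LinearEquiv.ofBijective_apply] at this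
    rw [this, TensorProduct.comm_comm]
  have htI : IsInverseBraiding 0 t (TensorProduct.curry p) (TensorProduct.curry d) :=
    hsB.isInverseBraiding hts
  let DD : ℤ → ℤ → X →ₗ[k] X →ₗ[k] X := fun i j => if Even i then F (j - i) else ofCop (F' (j - i))
  let KK : ℤ → ℤ → X →ₗ[k] X →ₗ[k] X := fun i j => if Even i then K (j - i) else ofCop (K' (j - i))
  have parity : ∀ i j : ℤ, Even i → (Even (j - i) ↔ Even j) := fun i j hi => by
    simp [Int.even_sub, hi]
  have parity' : ∀ i j : ℤ, ¬ Even i → (Even (j - i + 1) ↔ Even j) := fun i j hi => by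
    simp only [Int.even_add_one, Int.even_sub, hi]; tauto
  have inv : ∀ i j, (IsConvInv j (DD i j) (DD i (j + 1)) ∧ IsConvInv j (DD i (j + 1)) (DD i j)) ∧
      IsConvInv j (KK i j) (KK i (j + 1)) ∧ IsConvInv j (KK i (j + 1)) (KK i j) := by
    intro i j
    have e : j + 1 - i = j - i + 1 := by ring
    by_cases hi : Even i
    · simp only [DD, KK, if_pos hi, e]
      have := hF (j - i)
      exact ⟨⟨this.1.1.congr (parity i j hi), this.1.2.congr (parity i j hi)⟩,
        this.2.1.congr (parity i j hi), this.2.2.congr (parity i j hi)⟩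
    · simp only [DD, KK, if_neg hi, e]
      have := hF' (j - i)
      exact ⟨⟨(isConvInv_cop this.1.1).congr (parity' i j hi),
        (isConvInv_cop this.1.2).congr (parity' i j hi)⟩,
        (isConvInv_cop this.2.1).congr (parity' i j hi),
        (isConvInv_cop this.2.2).congr (parity' i j hi)⟩
  have D00 : DD 0 0 = TensorProduct.curry p := by simp [DD, F0]
  have K00 : KK 0 0 = TensorProduct.curry d := by simp [KK, K0]
  have D22 : DD 2 2 = TensorProduct.curry p := by simp [DD, F0]
  have K22 : KK 2 2 = TensorProduct.curry d := by simp [KK, K0]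
  have D11 : DD 1 1 = ofCop (TensorProduct.curry (dotOf (tildeTauInv s hs) ht)) := by
    simp [DD, F0']
  have K11 : KK 1 1 = ofCop (TensorProduct.curry (colonOf (tildeTauInv s hs) ht)) := by
    simp [KK, K0']
  -- the second component of `t` acts as the antipode of the first argument of `·`
  have D10 : ∀ x y, DD 1 0 x y = projR (t (x ⊗ₜ[k] y)) := by
    have e1 : IsConvInv (-1) (TensorProduct.curry (projR ∘ₗ tildeTauInv s hs)) (F' 0) := by
      rw [F0']
      exact isConvInv_of_G (by decide) (projInv_comp_G ht)
    have e2 := e1.unique (hF' (-1)).1.2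
    intro x y
    have e3 : DD 1 0 = ofCop (F' (-1)) := by simp [DD]
    rw [e3, ← e2, ← ht_eq]
    rfl
  have D21 : ∀ x y, DD 2 1 x y = projR (s (x ⊗ₜ[k] y)) := by
    have e1 : projR ∘ₗ s ∘ₗ G p = projL := by
      refine TensorProduct.ext (ext_isMult₂ 0 0 fun r r' u w hu hw a b c e => ?_)
      have := congrArg (projR (k := k)) (hsB u w hu hw a b c e)
      simp only [TensorProduct.curry_apply] at this
      rw [← G_tmul p hw] at this
      refine this.trans ?_
      have hd' := hm.multColon.counit_apply
      simp only [TensorProduct.curry_apply] at hd'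
      change _ = projL (u a b ⊗ₜ[k] w c e)
      rw [projL_tmul, map_sum]
      simp only [projR_tmul, hd', hu.counit_apply]
      simp
    intro x y
    have e3 : DD 2 1 = TensorProduct.curry (projInv (G p) hl) := by simp [DD, F1]
    rw [e3, TensorProduct.curry_apply]
    obtain ⟨z, hz⟩ := hl.2 (x ⊗ₜ y)
    rw [← hz]
    exact (LinearMap.congr_fun (projInv_comp_G hl) z).trans (LinearMap.congr_fun e1 z).symm
  have D11' : ∀ ⦃m : Type⦄ [Fintype m] [DecidableEq m] (w : m → m → X), IsMult k 1 w →
      ∀ x c e, projL (t (∑ f, DD 1 1 x (w c f) ⊗ₜ[k] w f e)) = KK 1 1 (w c e) x := by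
    intro m _ _ w hw x c e
    have hw' : IsMult (X := Cop X) k 0 w := isMult_cop.2 hw
    rw [D11, K11, ← ht_eq]
    have := G_tmul (dotOf (tildeTauInv s hs) ht) hw' x c e
    refine Eq.trans ?_ (congrArg (fun z => projL (tildeTauInv s hs z)) this).symm
    rfl
  rw [← D00, ← K00] at hm htI
  have a0 : IsAntipodal 0 (DD 1 0) (DD 0 0) (KK 0 0) := htI.isAntipodal D10
  have b0 : IsAntipodal 0 (KK 1 0) (KK 0 0) (DD 0 0) :=
    htI.isAntipodal_colon hm.multDot hm.multColon D10 (inv 1 0).1.1 D11' (inv 1 0).2.2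
  have m10 : IsMultOp 1 0 (DD 1 0) :=
    (hm.antipode_left (inv 0 0).2.1 (inv 0 0).2.2 a0).multDot
  have m11 : IsMultOp 1 1 (DD 1 1) := m10.of_convInv (inv 1 0).1.1 (inv 1 0).1.2
  have n10 : IsMultOp 1 0 (KK 1 0) :=
    (hm.symm.antipode_left (inv 0 0).1.1 (inv 0 0).1.2 b0).multDot
  have n11 : IsMultOp 1 1 (KK 1 1) := n10.of_convInv (inv 1 0).2.1 (inv 1 0).2.2
  have hsI : IsInverseBraiding 1 s (DD 1 1) (KK 1 1) :=
    (htI.isBraiding hm (inv 0 0).2.2 m11 D10 (inv 1 0).1.2 D11').isInverseBraiding hst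
  have a1 : IsAntipodal 1 (DD 2 1) (DD 1 1) (KK 1 1) := hsI.isAntipodal D21
  have b1 : IsAntipodal 1 (KK 2 1) (KK 1 1) (DD 1 1) := by
    refine hsI.isAntipodal_colon m11 n11 D21 (inv 2 1).1.1 ?_ (inv 2 1).2.2
    intro m _ _ w hw x c e
    rw [show (1 : ℤ) + 1 = 2 from rfl, D22, K22]
    exact hsB.projL_apply w (hw.congr (by decide)) x c e
  refine ⟨DD, KK, .of_base (fun i j => (inv i j).1.1) (fun i j => (inv i j).1.2)
    (fun i j => (inv i j).2.1) (fun i j => (inv i j).2.2) (fun i j m => ?_) (fun i j m => ?_)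
    a0 b0 a1 b1 hm, D00, K00⟩
  · simp [DD, Int.even_add]
  · simp [KK, Int.even_add]

end VeryStrongRegularity

end QBrace

namespace QBrace

/-! ### The free Hopf algebra with bijective antipode -/

section FreeHopfAlgebra

variable {k : Type u} [Field k] {X : Type v} [AddCommGroup X] [Module k X] [Coalgebra k X]

/-- A family of maps `fᵢ : X → A`, `i ∈ ℤ`, is antipodal when `fᵢ₊₁` is the convolution inverse of
`fᵢ`, for the comultiplication of level `i`. -/
structure IsAntipodalFamily {A : Type*} [Ring A] [Algebra k A] (f : ℤ → X →ₗ[k] A) : Prop where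
  succ_mul : ∀ (i : ℤ) ⦃n : Type⦄ [Fintype n] [DecidableEq n] (u : n → n → X), IsMult k i u →
    ∀ a b, ∑ c, f (i + 1) (u a c) * f i (u c b) = if a = b then 1 else 0
  mul_succ : ∀ (i : ℤ) ⦃n : Type⦄ [Fintype n] [DecidableEq n] (u : n → n → X), IsMult k i u →
    ∀ a b, ∑ c, f i (u a c) * f (i + 1) (u c b) = if a = b then 1 else 0

/-- The tautological map of level `i` from `X` to the tensor algebra of `⨁ i : ℤ, X`. -/
noncomputable def preGen (k : Type u) [Field k] {X : Type v} [AddCommGroup X] [Module k X] (i : ℤ) :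
    X →ₗ[k] TensorAlgebra k (ℤ →₀ X) :=
  TensorAlgebra.ι k ∘ₗ Finsupp.lsingle i

/-- The relations which make the maps `preGen k i` an antipodal family. -/
inductive FreeHopfRel (k : Type u) [Field k] (X : Type v) [AddCommGroup X] [Module k X]
    [Coalgebra k X] : TensorAlgebra k (ℤ →₀ X) → TensorAlgebra k (ℤ →₀ X) → Prop
  | succ_mul (i : ℤ) (n : Type) [Fintype n] [DecidableEq n] (u : n → n → X) (hu : IsMult k i u)
      (a b : n) : FreeHopfRel k X (∑ c, preGen k (i + 1) (u a c) * preGen k i (u c b))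
        (if a = b then 1 else 0)
  | mul_succ (i : ℤ) (n : Type) [Fintype n] [DecidableEq n] (u : n → n → X) (hu : IsMult k i u)
      (a b : n) : FreeHopfRel k X (∑ c, preGen k i (u a c) * preGen k (i + 1) (u c b))
        (if a = b then 1 else 0)

/-- The free Hopf algebra with bijective antipode on the coalgebra `X`: the algebra generated by
elements `gen i x`, which stand for `Sⁱ(x)`, subject to the antipode relations. -/
def FreeHopf (k : Type u) [Field k] (X : Type v) [AddCommGroup X] [Module k X]
    [Coalgebra k X] : Type max u v := RingQuot (FreeHopfRel k X)

namespace FreeHopf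

noncomputable instance : Ring (FreeHopf k X) := inferInstanceAs (Ring (RingQuot (FreeHopfRel k X)))

noncomputable instance : Algebra k (FreeHopf k X) :=
  inferInstanceAs (Algebra k (RingQuot (FreeHopfRel k X)))

/-- The element `Sⁱ(x)` of the free Hopf algebra. -/
noncomputable def gen (k : Type u) [Field k] {X : Type v} [AddCommGroup X] [Module k X]
    [Coalgebra k X] (i : ℤ) : X →ₗ[k] FreeHopf k X :=
  (RingQuot.mkAlgHom k (FreeHopfRel k X)).toLinearMap ∘ₗ preGen k i

theorem isAntipodalFamily_gen : IsAntipodalFamily (gen k (X := X)) := by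
  constructor
  · intro i n _ _ u hu a b
    have := RingQuot.mkAlgHom_rel k (FreeHopfRel.succ_mul i n u hu a b)
    rw [map_sum] at this
    simp only [map_mul, apply_ite (RingQuot.mkAlgHom k (FreeHopfRel k X)), map_one, map_zero]
      at this
    exact this
  · intro i n _ _ u hu a b
    have := RingQuot.mkAlgHom_rel k (FreeHopfRel.mul_succ i n u hu a b)
    rw [map_sum] at this
    simp only [map_mul, apply_ite (RingQuot.mkAlgHom k (FreeHopfRel k X)), map_one, map_zero]
      at this
    exact this

variable {A : Type*} [Ring A] [Algebra k A]

theorem tensorLift_preGen (f : ℤ → X →ₗ[k] A) (i : ℤ) (x : X) :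
    TensorAlgebra.lift k (Finsupp.lsum ℕ f) (preGen k i x) = f i x := by
  simp [preGen]

theorem tensorLift_eq_of_rel {f : ℤ → X →ₗ[k] A} (hf : IsAntipodalFamily f)
    ⦃x y : TensorAlgebra k (ℤ →₀ X)⦄ (h : FreeHopfRel k X x y) :
    TensorAlgebra.lift k (Finsupp.lsum ℕ f) x = TensorAlgebra.lift k (Finsupp.lsum ℕ f) y := by
  induction h with
  | succ_mul i n u hu a b =>
    rw [map_sum]
    simp only [map_mul, tensorLift_preGen, hf.succ_mul i u hu]
    split_ifs <;> simp
  | mul_succ i n u hu a b =>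
    rw [map_sum]
    simp only [map_mul, tensorLift_preGen, hf.mul_succ i u hu]
    split_ifs <;> simp

/-- The algebra morphism defined by an antipodal family. -/
noncomputable def lift (f : ℤ → X →ₗ[k] A) (hf : IsAntipodalFamily f) : FreeHopf k X →ₐ[k] A :=
  RingQuot.liftAlgHom k ⟨TensorAlgebra.lift k (Finsupp.lsum ℕ f), tensorLift_eq_of_rel hf⟩

@[simp]
theorem lift_gen (f : ℤ → X →ₗ[k] A) (hf : IsAntipodalFamily f) (i : ℤ) (x : X) :
    lift f hf (gen k i x) = f i x :=
  (RingQuot.liftAlgHom_mkAlgHom_apply k _ (tensorLift_eq_of_rel hf) (preGen k i x)).trans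
    (tensorLift_preGen f i x)

theorem algHom_ext {f g : FreeHopf k X →ₐ[k] A} (h : ∀ i x, f (gen k i x) = g (gen k i x)) :
    f = g := by
  refine RingQuot.ringQuot_ext' k f g (TensorAlgebra.hom_ext ?_)
  ext i x
  exact h i x

theorem mem_of_gen_mem (S : Subalgebra k (FreeHopf k X)) (h : ∀ i x, gen k i x ∈ S)
    (a : FreeHopf k X) : a ∈ S := by
  have hg := isAntipodalFamily_gen (k := k) (X := X)
  let φ : FreeHopf k X →ₐ[k] S := lift (fun i => (gen k i).codRestrict S.toSubmodule (h i))
    ⟨fun i n _ _ u hu a b => Subtype.ext (by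
      have := hg.succ_mul i u hu a b
      simp only [AddSubmonoidClass.coe_finsetSum, MulMemClass.coe_mul]
      refine Eq.trans this ?_
      split_ifs <;> simp), fun i n _ _ u hu a b => Subtype.ext (by
      have := hg.mul_succ i u hu a b
      simp only [AddSubmonoidClass.coe_finsetSum, MulMemClass.coe_mul]
      refine Eq.trans this ?_
      split_ifs <;> simp)⟩
  have hφ : S.val.comp φ = AlgHom.id k _ := algHom_ext fun i x => by
    simp only [φ, AlgHom.comp_apply, lift_gen]
    rfl
  have h2 : (φ a : FreeHopf k X) = a := DFunLike.congr_fun hφ a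
  rw [← h2]
  exact (φ a).2

section Induction

variable {M M' : Type*} [AddCommGroup M] [Module k M] [AddCommGroup M'] [Module k M']

/-- If `F` intertwines the entries of a matrix, it intertwines those of the inverse matrix. -/
theorem intertwines_inverse {B : Type*} [Ring B] [Algebra k B] {Θ : B →ₐ[k] Module.End k M}
    {Θ' : B →ₐ[k] Module.End k M'} {F : M →ₗ[k] M'} {n : Type} [Fintype n] [DecidableEq n]
    {α β : n → n → B} (h1 : ∀ a b, ∑ c, α a c * β c b = if a = b then 1 else 0)
    (h2 : ∀ a b, ∑ c, β a c * α c b = if a = b then 1 else 0)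
    (h : ∀ a b m, F (Θ (α a b) m) = Θ' (α a b) (F m)) (a b : n) (m : M) :
    F (Θ (β a b) m) = Θ' (β a b) (F m) := by
  have e1 : ∀ a b m, ∑ c, Θ (α a c) (Θ (β c b) m) = if a = b then m else 0 := by
    intro a b m
    have := LinearMap.congr_fun (congrArg Θ (h1 a b)) m
    simp only [map_sum, map_mul, LinearMap.sum_apply, Module.End.mul_apply] at this
    rw [this]; split_ifs <;> simp
  have e2 : ∀ a b m, ∑ c, Θ' (β a c) (Θ' (α c b) m) = if a = b then m else 0 := by
    intro a b m
    have := LinearMap.congr_fun (congrArg Θ' (h2 a b)) m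
    simp only [map_sum, map_mul, LinearMap.sum_apply, Module.End.mul_apply] at this
    rw [this]; split_ifs <;> simp
  calc F (Θ (β a b) m) = ∑ c, if a = c then F (Θ (β c b) m) else 0 := by simp
    _ = ∑ c, ∑ d, Θ' (β a d) (F (Θ (α d c) (Θ (β c b) m))) := by simp only [← e2, h]
    _ = ∑ d, Θ' (β a d) (F (∑ c, Θ (α d c) (Θ (β c b) m))) := by
      rw [Finset.sum_comm]; simp only [map_sum]
    _ = Θ' (β a b) (F m) := by simp [e1, apply_ite F, apply_ite (Θ' _)]

/-- A linear map between representations of the free Hopf algebra is a morphism as soon as it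
commutes with the elements of `X`. -/
theorem intertwines {Θ : FreeHopf k X →ₐ[k] Module.End k M}
    {Θ' : FreeHopf k X →ₐ[k] Module.End k M'} {F : M →ₗ[k] M'}
    (h : ∀ x m, F (Θ (gen k 0 x) m) = Θ' (gen k 0 x) (F m)) (a : FreeHopf k X) (m : M) :
    F (Θ a m) = Θ' a (F m) := by
  have ext : ∀ i j, (∀ (r : ℕ) (u : Fin r → Fin r → X), IsMult k j u → ∀ a b m,
      F (Θ (gen k i (u a b)) m) = Θ' (gen k i (u a b)) (F m)) → ∀ x m,
      F (Θ (gen k i x) m) = Θ' (gen k i x) (F m) := by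
    intro i j h x m
    have : F ∘ₗ LinearMap.applyₗ m ∘ₗ Θ.toLinearMap ∘ₗ gen k i
        = LinearMap.applyₗ (F m) ∘ₗ Θ'.toLinearMap ∘ₗ gen k i :=
      ext_isMult j fun r u hu a b => h r u hu a b m
    exact LinearMap.congr_fun this x
  have hg := isAntipodalFamily_gen (k := k) (X := X)
  have gens : ∀ (i : ℤ) x m, F (Θ (gen k i x) m) = Θ' (gen k i x) (F m) := by
    intro i
    induction i using Int.induction_on with
    | zero => exact h
    | succ i ih =>
      exact ext _ i fun r u hu => intertwines_inverse (hg.mul_succ i u hu) (hg.succ_mul i u hu)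
        fun a b => ih _
    | pred i ih =>
      refine ext _ (-i - 1) fun r u hu => intertwines_inverse
        (hg.succ_mul (-i - 1) u hu) (hg.mul_succ (-i - 1) u hu) fun a b m => ?_
      rw [sub_add_cancel]
      exact ih _ m
  let S : Subalgebra k (FreeHopf k X) :=
    { carrier := {a | ∀ m, F (Θ a m) = Θ' a (F m)}
      mul_mem' := fun {a b} ha hb m => by
        simp only [Set.mem_ofPred_eq] at ha hb
        simp only [map_mul, Module.End.mul_apply, ha, hb]
      add_mem' := fun {a b} ha hb m => by
        simp only [Set.mem_ofPred_eq] at ha hb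
        simp only [map_add, LinearMap.add_apply, ha, hb]
      algebraMap_mem' := fun r m => by
        simp only [AlgHom.commutes, Module.algebraMap_end_apply, map_smul] }
  exact mem_of_gen_mem S gens a m

/-- `X` generates its free Hopf algebra as far as morphisms are concerned: the matrices `Sⁱ(u)` are
obtained from `u` by successive inversion, and inverses are unique. -/
theorem algHom_ext_zero {f g : FreeHopf k X →ₐ[k] A} (h : ∀ x, f (gen k 0 x) = g (gen k 0 x)) :
    f = g := by
  ext a
  have := intertwines (Θ := (Algebra.lmul k A).comp f) (Θ' := (Algebra.lmul k A).comp g)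
    (F := LinearMap.id) (fun x m => by simp [h]) a 1
  simpa using this

end Induction

end FreeHopf

end FreeHopfAlgebra

end QBrace

namespace QBrace

/-! ### The Hopf algebra structure -/

section HopfStructure

variable {k : Type u} [Field k] {X : Type v} [AddCommGroup X] [Module k X] [Coalgebra k X]

namespace FreeHopf

/-- The comultiplication of the free Hopf algebra. -/
noncomputable def comulHom (k : Type u) [Field k] (X : Type v) [AddCommGroup X] [Module k X]
    [Coalgebra k X] : FreeHopf k X →ₐ[k] FreeHopf k X ⊗[k] FreeHopf k X :=
  lift (fun i => TensorProduct.map (gen k i) (gen k i) ∘ₗ levelComul k X i) <| by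
    have hg := isAntipodalFamily_gen (k := k) (X := X)
    constructor
    · intro i n _ _ u hu a b
      have h1 := fun c => hu.transpose.comul_apply c a
      simp only [LinearMap.comp_apply, h1, hu.comul_apply, map_sum, TensorProduct.map_tmul,
        Finset.sum_mul_sum, Algebra.TensorProduct.tmul_mul_tmul]
      calc _ = ∑ e, ∑ d, (∑ c, gen k (i + 1) (u e c) * gen k i (u c d)) ⊗ₜ[k]
            (gen k (i + 1) (u a e) * gen k i (u d b)) := by
            rw [Finset.sum_comm]
            simp only [TensorProduct.sum_tmul]
            exact Finset.sum_congr rfl fun _ _ => Finset.sum_comm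
        _ = if a = b then 1 else 0 := by
            simp only [hg.succ_mul i u hu, TensorProduct.ite_tmul, Finset.sum_ite_eq,
              Finset.mem_univ, if_true, ← TensorProduct.tmul_sum]
            split_ifs <;> simp [Algebra.TensorProduct.one_def]
    · intro i n _ _ u hu a b
      have h1 := fun c => hu.transpose.comul_apply b c
      simp only [LinearMap.comp_apply, h1, hu.comul_apply, map_sum, TensorProduct.map_tmul,
        Finset.sum_mul_sum, Algebra.TensorProduct.tmul_mul_tmul]
      calc _ = ∑ e, ∑ d, (gen k i (u a e) * gen k (i + 1) (u d b)) ⊗ₜ[k]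
            (∑ c, gen k i (u e c) * gen k (i + 1) (u c d)) := by
            rw [Finset.sum_comm]
            simp only [TensorProduct.tmul_sum]
            exact Finset.sum_congr rfl fun _ _ => Finset.sum_comm
        _ = if a = b then 1 else 0 := by
            simp only [hg.mul_succ i u hu, TensorProduct.tmul_ite, Finset.sum_ite_eq,
              Finset.mem_univ, if_true, ← TensorProduct.sum_tmul]
            split_ifs <;> simp [Algebra.TensorProduct.one_def]

/-- The counit of the free Hopf algebra. -/
noncomputable def counitHom (k : Type u) [Field k] (X : Type v) [AddCommGroup X] [Module k X]
    [Coalgebra k X] : FreeHopf k X →ₐ[k] k :=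
  lift (fun _ => counit) ⟨fun i n _ _ u hu a b => by simp [hu.counit_apply],
    fun i n _ _ u hu a b => by simp [hu.counit_apply]⟩

theorem comulHom_gen {i : ℤ} {n : Type} [Fintype n] [DecidableEq n] {u : n → n → X}
    (hu : IsMult k i u) (a b : n) :
    comulHom k X (gen k i (u a b)) = ∑ c, gen k i (u a c) ⊗ₜ[k] gen k i (u c b) := by
  simp [comulHom, hu.comul_apply]

theorem counitHom_gen (i : ℤ) (x : X) : counitHom k X (gen k i x) = counit x := by
  simp [counitHom]

/-- Algebra morphisms which agree on the entries of multiplicative matrices are equal. -/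
theorem algHom_ext_isMult {A : Type*} [Ring A] [Algebra k A] {f g : FreeHopf k X →ₐ[k] A}
    (h : ∀ (i : ℤ) (r : ℕ) (u : Fin r → Fin r → X), IsMult k i u →
      ∀ a b, f (gen k i (u a b)) = g (gen k i (u a b))) : f = g := by
  refine algHom_ext fun i x => ?_
  have : f.toLinearMap ∘ₗ gen k i = g.toLinearMap ∘ₗ gen k i := ext_isMult i (h i)
  exact LinearMap.congr_fun this x

/-- The bialgebra structure for which `gen k i` is a coalgebra morphism from `X` or from `X^cop`,
according to the parity of `i`. -/
noncomputable instance : Bialgebra k (FreeHopf k X) :=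
  Bialgebra.ofAlgHom (comulHom k X) (counitHom k X)
    (algHom_ext_isMult fun i r u hu a b => by
      simp only [AlgHom.comp_apply, comulHom_gen hu, map_sum, Algebra.TensorProduct.map_tmul,
        TensorProduct.sum_tmul, TensorProduct.tmul_sum, AlgHom.id_apply]
      rw [Finset.sum_comm]
      rfl)
    (algHom_ext_isMult fun i r u hu a b => by
      simp only [AlgHom.comp_apply, comulHom_gen hu, map_sum, Algebra.TensorProduct.map_tmul,
        AlgHom.id_apply, counitHom_gen, hu.counit_apply, TensorProduct.ite_tmul]
      simp)
    (algHom_ext_isMult fun i r u hu a b => by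
      simp only [AlgHom.comp_apply, comulHom_gen hu, map_sum, Algebra.TensorProduct.map_tmul,
        AlgHom.id_apply, counitHom_gen, hu.counit_apply, TensorProduct.tmul_ite]
      simp)

theorem comul_gen {i : ℤ} {n : Type} [Fintype n] [DecidableEq n] {u : n → n → X}
    (hu : IsMult k i u) (a b : n) :
    comul (R := k) (gen k i (u a b)) = ∑ c, gen k i (u a c) ⊗ₜ[k] gen k i (u c b) :=
  comulHom_gen hu a b

theorem counit_gen (i : ℤ) (x : X) : counit (R := k) (gen k i x) = counit (R := k) x :=
  counitHom_gen i x

theorem isMult_gen {i : ℤ} {n : Type} [Fintype n] [DecidableEq n] {u : n → n → X}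
    (hu : IsMult k i u) : IsMult k 0 (fun a b => gen k i (u a b)) :=
  ⟨fun a b => by rw [levelComul_zero, comul_gen hu], fun a b => by
    rw [counit_gen, hu.counit_apply]⟩

theorem not_even_neg_one : ¬ Even (-1 : ℤ) := by decide

/-- The antihomomorphism `Sⁱ(x) ↦ Sⁱ⁺ᵉ(x)` for odd `e`. -/
noncomputable def shiftOp (k : Type u) [Field k] (X : Type v) [AddCommGroup X] [Module k X]
    [Coalgebra k X] (e : ℤ) (he : ¬ Even e) : FreeHopf k X →ₐ[k] (FreeHopf k X)ᵐᵒᵖ :=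
  lift (fun i => (MulOpposite.opLinearEquiv k).toLinearMap ∘ₗ gen k (i + e)) <| by
    have hg := isAntipodalFamily_gen (k := k) (X := X)
    constructor
    · intro i n _ _ u hu a b
      have hu' : IsMult k (i + e) (fun a b => u b a) :=
        hu.transpose.congr (by simp only [Int.even_add, he]; simp)
      have := congrArg MulOpposite.op (hg.mul_succ (i + e) _ hu' b a)
      simp only [LinearMap.comp_apply, LinearEquiv.coe_coe, MulOpposite.coe_opLinearEquiv,
        ← MulOpposite.op_mul, ← Finset.op_sum, add_right_comm i 1 e, this]
      simp only [eq_comm (a := b)]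
      split_ifs <;> rfl
    · intro i n _ _ u hu a b
      have hu' : IsMult k (i + e) (fun a b => u b a) :=
        hu.transpose.congr (by simp only [Int.even_add, he]; simp)
      have := congrArg MulOpposite.op (hg.succ_mul (i + e) _ hu' b a)
      simp only [LinearMap.comp_apply, LinearEquiv.coe_coe, MulOpposite.coe_opLinearEquiv,
        ← MulOpposite.op_mul, ← Finset.op_sum, add_right_comm i 1 e, this]
      simp only [eq_comm (a := b)]
      split_ifs <;> rfl

/-- The antipode of the free Hopf algebra is `shift k X 1`, its inverse is `shift k X (-1)`. -/
noncomputable def shift (k : Type u) [Field k] (X : Type v) [AddCommGroup X] [Module k X]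
    [Coalgebra k X] (e : ℤ) (he : ¬ Even e) : FreeHopf k X →ₗ[k] FreeHopf k X :=
  (MulOpposite.opLinearEquiv k).symm.toLinearMap ∘ₗ (shiftOp k X e he).toLinearMap

theorem shift_gen (e : ℤ) (he : ¬ Even e) (i : ℤ) (x : X) :
    shift k X e he (gen k i x) = gen k (i + e) x := by
  simp [shift, shiftOp]

theorem shift_mul (e : ℤ) (he : ¬ Even e) (a b : FreeHopf k X) :
    shift k X e he (a * b) = shift k X e he b * shift k X e he a := by
  simp [shift]

theorem shift_one (e : ℤ) (he : ¬ Even e) : shift k X e he 1 = 1 := by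
  simp [shift]

theorem shift_shift_neg (e : ℤ) (he : ¬ Even e) (he' : ¬ Even (-e)) (a : FreeHopf k X) :
    shift k X e he (shift k X (-e) he' a) = a := by
  let φ : FreeHopf k X →ₐ[k] FreeHopf k X :=
    AlgHom.ofLinearMap (shift k X e he ∘ₗ shift k X (-e) he') (by simp [shift_one])
      (by simp [shift_mul])
  have : φ = AlgHom.id k _ := algHom_ext fun i x => by
    simp [φ, shift_gen]
  exact DFunLike.congr_fun this a

/-- To verify an antipode relation it suffices to do so on the generators. -/
theorem comul_eq_counit {A : Type*} [Ring A] [Algebra k A]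
    (Φ : FreeHopf k X ⊗[k] FreeHopf k X →ₗ[k] A) (h1 : Φ 1 = 1)
    (hmul : ∀ t s r r', Φ t = algebraMap k A r → Φ s = algebraMap k A r' →
      Φ (t * s) = algebraMap k A (r * r'))
    (h : ∀ (i : ℤ) (r : ℕ) (u : Fin r → Fin r → X), IsMult k i u → ∀ a b,
      ∑ c, Φ (gen k i (u a c) ⊗ₜ gen k i (u c b)) = if a = b then 1 else 0)
    (a : FreeHopf k X) : Φ (comul a) = algebraMap k A (counit a) := by
  let S : Subalgebra k (FreeHopf k X) :=
    { carrier := {a | Φ (comul a) = algebraMap k A (counit a)}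
      mul_mem' := fun {a b} ha hb => by
        simp only [Set.mem_ofPred_eq] at ha hb ⊢
        rw [Bialgebra.comul_mul, hmul _ _ _ _ ha hb, Bialgebra.counit_mul]
      add_mem' := fun {a b} ha hb => by
        simp only [Set.mem_ofPred_eq] at ha hb ⊢
        simp only [map_add, ha, hb]
      algebraMap_mem' := fun r => by
        simp [Algebra.algebraMap_eq_smul_one, h1] }
  refine mem_of_gen_mem S (fun i x => ?_) a
  have : Φ ∘ₗ comul ∘ₗ gen k i
      = Algebra.linearMap k A ∘ₗ counit ∘ₗ gen k i := ext_isMult i fun r u hu a b => by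
    simp only [LinearMap.comp_apply, comul_gen hu, map_sum, h i r u hu, counit_gen,
      hu.counit_apply]
    split_ifs <;> simp
  exact LinearMap.congr_fun this x

noncomputable instance : HopfAlgebra k (FreeHopf k X) where
  antipode := shift k X 1 Int.not_even_one
  mul_antipode_rTensor_comul := by
    ext a
    refine comul_eq_counit (LinearMap.mul' k _ ∘ₗ (shift k X 1 Int.not_even_one).rTensor _)
      (by simp [Algebra.TensorProduct.one_def, shift_one]) (fun t s r r' ht hs => ?_)
      (fun i r u hu a b => ?_) a
    · have e1 : ∀ x y t, LinearMap.mul' k _ ((shift k X 1 Int.not_even_one).rTensor _ (t * x ⊗ₜ[k] y))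
          = shift k X 1 Int.not_even_one x *
            LinearMap.mul' k _ ((shift k X 1 Int.not_even_one).rTensor _ t) * y := by
        intro x y t
        induction t using TensorProduct.induction_on with
        | zero => simp
        | add x y hx hy => simp only [add_mul, mul_add, map_add, hx, hy]
        | tmul z w => simp [shift_mul, mul_assoc]
      rw [LinearMap.comp_apply] at ht hs ⊢
      rw [map_mul (algebraMap k (FreeHopf k X)), ← hs]
      clear hs
      induction s using TensorProduct.induction_on with
      | zero => simp
      | add x y hx hy => simp only [mul_add, map_add, hx, hy]
      | tmul x y =>
        rw [e1, ht, LinearMap.rTensor_tmul, LinearMap.mul'_apply, ← Algebra.commutes, mul_assoc]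
    · simp only [LinearMap.comp_apply, LinearMap.rTensor_tmul, LinearMap.mul'_apply, shift_gen]
      exact isAntipodalFamily_gen.succ_mul i u hu a b
  mul_antipode_lTensor_comul := by
    ext a
    refine comul_eq_counit (LinearMap.mul' k _ ∘ₗ (shift k X 1 Int.not_even_one).lTensor _)
      (by simp [Algebra.TensorProduct.one_def, shift_one]) (fun t s r r' ht hs => ?_)
      (fun i r u hu a b => ?_) a
    · have e1 : ∀ x y s, LinearMap.mul' k _ ((shift k X 1 Int.not_even_one).lTensor _ (x ⊗ₜ[k] y * s))
          = x * LinearMap.mul' k _ ((shift k X 1 Int.not_even_one).lTensor _ s) *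
            shift k X 1 Int.not_even_one y := by
        intro x y t
        induction t using TensorProduct.induction_on with
        | zero => simp
        | add x y hx hy => simp only [add_mul, mul_add, map_add, hx, hy]
        | tmul z w => simp [shift_mul, mul_assoc]
      rw [LinearMap.comp_apply] at ht hs ⊢
      rw [map_mul (algebraMap k (FreeHopf k X)), ← ht]
      clear ht
      induction t using TensorProduct.induction_on with
      | zero => simp
      | add x y hx hy => simp only [add_mul, map_add, hx, hy]
      | tmul x y =>
        rw [e1, hs, LinearMap.lTensor_tmul, LinearMap.mul'_apply, ← Algebra.commutes, mul_assoc,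
          Algebra.commutes]
    · simp only [LinearMap.comp_apply, LinearMap.lTensor_tmul, LinearMap.mul'_apply, shift_gen]
      exact isAntipodalFamily_gen.mul_succ i u hu a b

theorem antipode_bijective : Function.Bijective (HopfAlgebra.antipode k (A := FreeHopf k X)) :=
  Function.bijective_iff_has_inverse.2 ⟨shift k X (-1) not_even_neg_one,
    fun a =>
      shift_shift_neg (-1) not_even_neg_one Int.not_even_one a,
    fun a => shift_shift_neg 1 Int.not_even_one not_even_neg_one a⟩

end FreeHopf

end HopfStructure

end QBrace

namespace QBrace

/-! ### Right linear representations -/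

section RightLinearExtension

variable {k : Type u} [Field k] {B : Type*} [Ring B] [Algebra k B]
variable {M N P : Type*} [AddCommGroup M] [Module k M] [AddCommGroup N] [Module k N]
  [AddCommGroup P] [Module k P]

/-- Right multiplication on `M ⊗ B`. -/
noncomputable def rightMul (k : Type u) [Field k] {B : Type*} [Ring B] [Algebra k B] (M : Type*)
    [AddCommGroup M] [Module k M] (c : B) : M ⊗[k] B →ₗ[k] M ⊗[k] B :=
  (LinearMap.mulRight k c).lTensor M

@[simp]
theorem rightMul_tmul (c : B) (m : M) (b : B) : rightMul k M c (m ⊗ₜ b) = m ⊗ₜ (b * c) := by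
  simp [rightMul]

theorem rightMul_one (z : M ⊗[k] B) : rightMul k M (1 : B) z = z := by
  simp [rightMul]

theorem rightMul_mul (c d : B) (z : M ⊗[k] B) :
    rightMul k M (c * d) z = rightMul k M d (rightMul k M c z) := by
  induction z using TensorProduct.induction_on with
  | zero => simp
  | tmul m b => simp [mul_assoc]
  | add x y hx hy => simp only [map_add, hx, hy]

/-- The right `B`-linear map `N ⊗ B → M ⊗ B` which extends `φ : N → M ⊗ B`. -/
noncomputable def rext (k : Type u) [Field k] (B : Type*) [Ring B] [Algebra k B] (N M : Type*)
    [AddCommGroup M] [Module k M] [AddCommGroup N] [Module k N] :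
    (N →ₗ[k] M ⊗[k] B) →ₗ[k] (N ⊗[k] B →ₗ[k] M ⊗[k] B) :=
  LinearMap.llcomp k _ _ _ ((LinearMap.mul' k B).lTensor M ∘ₗ
    (TensorProduct.assoc k M B B).toLinearMap) ∘ₗ LinearMap.rTensorHom B

theorem rext_tmul (φ : N →ₗ[k] M ⊗[k] B) (n : N) (c : B) :
    rext k B N M φ (n ⊗ₜ c) = rightMul k M c (φ n) := by
  have : ∀ z : M ⊗[k] B, (LinearMap.mul' k B).lTensor M
      (TensorProduct.assoc k M B B (z ⊗ₜ c)) = rightMul k M c z := by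
    intro z
    induction z using TensorProduct.induction_on with
    | zero => simp
    | tmul m b => simp
    | add x y hx hy => simp only [map_add, TensorProduct.add_tmul, hx, hy]
  exact this (φ n)

theorem rext_tmul_one (φ : N →ₗ[k] M ⊗[k] B) (n : N) : rext k B N M φ (n ⊗ₜ 1) = φ n := by
  rw [rext_tmul, rightMul_one]

theorem rext_rightMul (φ : N →ₗ[k] M ⊗[k] B) (c : B) (z : N ⊗[k] B) :
    rext k B N M φ (rightMul k N c z) = rightMul k M c (rext k B N M φ z) := by
  induction z using TensorProduct.induction_on with
  | zero => simp
  | tmul m b => rw [rightMul_tmul, rext_tmul, rext_tmul, rightMul_mul]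
  | add x y hx hy => simp only [map_add, hx, hy]

/-- Representations of `B` on `M ⊗ B` by right `B`-linear maps. -/
def IsRightLinear (Θ : B →ₐ[k] Module.End k (M ⊗[k] B)) : Prop :=
  ∀ l c z, Θ l (rightMul k M c z) = rightMul k M c (Θ l z)

theorem IsRightLinear.apply_tmul {Θ : B →ₐ[k] Module.End k (M ⊗[k] B)} (h : IsRightLinear Θ)
    (l : B) (m : M) (c : B) : Θ l (m ⊗ₜ c) = rightMul k M c (Θ l (m ⊗ₜ 1)) := by
  rw [← h]; simp

/-- `(m ⊗ c) ⊗ n ↦ m ⊗ c n`. -/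
noncomputable def actTmul (Ψ : B →ₐ[k] Module.End k N) (M : Type*) [AddCommGroup M] [Module k M]
    (n : N) : M ⊗[k] B →ₗ[k] M ⊗[k] N :=
  (LinearMap.applyₗ n ∘ₗ Ψ.toLinearMap).lTensor M

@[simp]
theorem actTmul_tmul (Ψ : B →ₐ[k] Module.End k N) (n : N) (m : M) (c : B) :
    actTmul Ψ M n (m ⊗ₜ c) = m ⊗ₜ Ψ c n := by simp [actTmul]

theorem actTmul_rightMul (Ψ : B →ₐ[k] Module.End k N) (n : N) (c : B) (z : M ⊗[k] B) :
    actTmul Ψ M n (rightMul k M c z) = actTmul Ψ M (Ψ c n) z := by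
  induction z using TensorProduct.induction_on with
  | zero => simp
  | tmul m b => simp
  | add x y hx hy => simp only [map_add, hx, hy]

/-- The map `m ⊗ n ↦ ∑ mᵢ ⊗ cᵢ n`, where `Θ l (m ⊗ 1) = ∑ mᵢ ⊗ cᵢ`. -/
noncomputable def starMap (Θ : B →ₐ[k] Module.End k (M ⊗[k] B)) (Ψ : B →ₐ[k] Module.End k N)
    (l : B) : M ⊗[k] N →ₗ[k] M ⊗[k] N :=
  TensorProduct.lift (LinearMap.flip
    ((LinearMap.lcomp k (M ⊗[k] N) (Θ l ∘ₗ (TensorProduct.mk k M B).flip 1)) ∘ₗ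
      LinearMap.lTensorHom M ∘ₗ Ψ.toLinearMap.flip))

theorem starMap_tmul (Θ : B →ₐ[k] Module.End k (M ⊗[k] B)) (Ψ : B →ₐ[k] Module.End k N)
    (l : B) (m : M) (n : N) : starMap Θ Ψ l (m ⊗ₜ n) = actTmul Ψ M n (Θ l (m ⊗ₜ 1)) := rfl

theorem starMap_actTmul {Θ : B →ₐ[k] Module.End k (M ⊗[k] B)} (hΘ : IsRightLinear Θ)
    (Ψ : B →ₐ[k] Module.End k N) (l : B) (n : N) (z : M ⊗[k] B) :
    starMap Θ Ψ l (actTmul Ψ M n z) = actTmul Ψ M n (Θ l z) := by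
  induction z using TensorProduct.induction_on with
  | zero => simp
  | tmul m b => rw [actTmul_tmul, starMap_tmul, hΘ.apply_tmul l m b, actTmul_rightMul]
  | add x y hx hy => simp only [map_add, hx, hy]

/-- The tensor product `M ⊗ N` of `M`, on which `B` acts through `Θ`, and of a representation `N`
of `B`, as a representation of `B`. -/
noncomputable def star (Θ : B →ₐ[k] Module.End k (M ⊗[k] B)) (hΘ : IsRightLinear Θ)
    (Ψ : B →ₐ[k] Module.End k N) : B →ₐ[k] Module.End k (M ⊗[k] N) :=
  AlgHom.ofLinearMap
    { toFun := starMap Θ Ψ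
      map_add' := fun a b => TensorProduct.ext' fun m n => by
        simp only [LinearMap.add_apply, starMap_tmul, map_add]
      map_smul' := fun r a => TensorProduct.ext' fun m n => by
        simp only [LinearMap.smul_apply, starMap_tmul, map_smul, RingHom.id_apply] }
    (TensorProduct.ext' fun m n => by simp [starMap_tmul])
    (fun a b => TensorProduct.ext' fun m n => by
      simp only [LinearMap.coe_mk, AddHom.coe_mk, Module.End.mul_apply, starMap_tmul, map_mul]
      rw [← starMap_actTmul hΘ])

theorem star_tmul {Θ : B →ₐ[k] Module.End k (M ⊗[k] B)} (hΘ : IsRightLinear Θ)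
    (Ψ : B →ₐ[k] Module.End k N) (l : B) (m : M) (n : N) :
    star Θ hΘ Ψ l (m ⊗ₜ n) = actTmul Ψ M n (Θ l (m ⊗ₜ 1)) := rfl

end RightLinearExtension

section Action

variable {k : Type u} [Field k] {X : Type v} [AddCommGroup X] [Module k X] [Coalgebra k X]
variable {M : Type*} [AddCommGroup M] [Module k M]

open FreeHopf

theorem ext_isMult_tmul (j : ℤ) {N : Type*} [AddCommGroup N] [Module k N] {f g : X ⊗[k] N →ₗ[k] M}
    (h : ∀ (r : ℕ) (w : Fin r → Fin r → X), IsMult k j w → ∀ a b c,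
      f (w a b ⊗ₜ c) = g (w a b ⊗ₜ c)) : f = g :=
  TensorProduct.ext (ext_isMult j fun r w hw a b => LinearMap.ext fun c => h r w hw a b c)

/-- The map `x ↦ (y ↦ y₍₂₎ · x₍₁₎ ⊗ Sⁱ(x₍₂₎ : y₍₁₎))`, for `x` of level `i` and `y` of level `j`. -/
noncomputable def twist (i j : ℤ) (D K : X →ₗ[k] X →ₗ[k] X) : X →ₗ[k] X →ₗ[k] X ⊗[k] FreeHopf k X :=
  (TensorProduct.curry (TensorProduct.map (TensorProduct.lift D)
      (gen k i ∘ₗ TensorProduct.lift K.flip) ∘ₗ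
    (TensorProduct.tensorTensorTensorComm k X X X X).toLinearMap ∘ₗ
    TensorProduct.map (levelComul k X (j + 1)) (levelComul k X i))).flip

variable {n m : Type} [Fintype n] [DecidableEq n] [Fintype m] [DecidableEq m]

theorem twist_apply {i j : ℤ} (D K : X →ₗ[k] X →ₗ[k] X) {u : n → n → X} {w : m → m → X}
    (hu : IsMult k i u) (hw : IsMult k j w) (p q : n) (a b : m) :
    twist i j D K (u p q) (w a b)
      = ∑ e, ∑ f, D (w e b) (u p f) ⊗ₜ[k] gen k i (K (u f q) (w a e)) := by
  have h1 := hw.transpose.comul_apply b a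
  simp only [twist, LinearMap.flip_apply, TensorProduct.curry_apply, LinearMap.comp_apply,
    TensorProduct.map_tmul, h1, hu.comul_apply, TensorProduct.sum_tmul, TensorProduct.tmul_sum,
    map_sum, LinearEquiv.coe_coe, TensorProduct.tensorTensorTensorComm_tmul,
    TensorProduct.lift.tmul]
  exact Finset.sum_comm

theorem twist_apply' {i j : ℤ} {D K : X →ₗ[k] X →ₗ[k] X} (h : IsCommuting j i D K)
    {u : n → n → X} {w : m → m → X}
    (hu : IsMult k i u) (hw : IsMult k j w) (p q : n) (a b : m) :
    twist i j D K (u p q) (w a b)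
      = ∑ e, ∑ f, D (w a e) (u f q) ⊗ₜ[k] gen k i (K (u p f) (w e b)) := by
  have := congrArg ((gen k i).lTensor X ∘ₗ (TensorProduct.comm k X X).toLinearMap)
    (h w u hw hu a b p q)
  simp only [map_sum, LinearMap.comp_apply, LinearEquiv.coe_coe, TensorProduct.comm_tmul,
    LinearMap.lTensor_tmul] at this
  rw [twist_apply D K hu hw, this]

end Action

end QBrace

namespace QBrace

/-! ### The antipode relations for the action on `X ⊗ H` -/

theorem sum_rotate {ι κ μ M : Type*} [Fintype ι] [Fintype κ] [Fintype μ] [AddCommMonoid M]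
    (f : ι → κ → μ → M) : ∑ a, ∑ b, ∑ c, f a b c = ∑ c, ∑ a, ∑ b, f a b c := by
  simp_rw [Finset.sum_comm (s := (Finset.univ : Finset κ)) (t := (Finset.univ : Finset μ))]
  exact Finset.sum_comm

section Action

variable {k : Type u} [Field k] {X : Type v} [AddCommGroup X] [Module k X] [Coalgebra k X]
variable {D K : ℤ → ℤ → X →ₗ[k] X →ₗ[k] X}

open FreeHopf

/-- The operator `y ⊗ c ↦ y₍₂₎ ⊗ f(x, y₍₁₎) c` on `X ⊗ H`, for `y` of level `j`. -/
noncomputable def insertOp (j : ℤ) (f : X →ₗ[k] X →ₗ[k] FreeHopf k X) (x : X) :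
    X ⊗[k] FreeHopf k X →ₗ[k] X ⊗[k] FreeHopf k X :=
  rext k _ X X ((f x).lTensor X ∘ₗ levelComul k X (j + 1))

theorem insertOp_tmul {j : ℤ} (f : X →ₗ[k] X →ₗ[k] FreeHopf k X) (x : X) {m : Type} [Fintype m]
    [DecidableEq m] {w : m → m → X} (hw : IsMult k j w) (a b : m) (c : FreeHopf k X) :
    insertOp j f x (w a b ⊗ₜ c) = ∑ e, w e b ⊗ₜ[k] (f x (w a e) * c) := by
  have h1 := hw.transpose.comul_apply b a
  rw [insertOp, rext_tmul, LinearMap.comp_apply, h1, map_sum, map_sum]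
  simp

/-- The matrix of the operators `y ⊗ c ↦ y₍₁₎ · l₍₂₎ ⊗ (l₍₁₎ : y₍₂₎) c` is the product of the matrices
of `y ⊗ c ↦ y · l ⊗ c` and of `y ⊗ c ↦ y₍₂₎ ⊗ (l : y₍₁₎) c`.  Both of them have an inverse, and the
product of the inverses is the matrix attached to the antipode of `l`. -/
theorem IsLevelSystem.isAntipodalFamily_twist (h : IsLevelSystem D K) (j : ℤ) :
    IsAntipodalFamily (A := Module.End k (X ⊗[k] FreeHopf k X))
      (fun i => rext k _ X X ∘ₗ twist i j (D j i) (K i j)) := by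
  have hg := isAntipodalFamily_gen (k := k) (X := X)
  -- the operator `y ⊗ c ↦ y · x ⊗ c`
  let Dm : ℤ → X → Module.End k (X ⊗[k] FreeHopf k X) := fun i x => ((D j i).flip x).rTensor _
  -- the operators `y ⊗ c ↦ y₍₂₎ ⊗ (x : y₍₁₎) c` and `y ⊗ c ↦ y₍₂₎ ⊗ S(x : y₍₁₎) c`
  let L : ℤ → X → Module.End k (X ⊗[k] FreeHopf k X) :=
    fun i x => insertOp j ((K i j).compr₂ (gen k i)) x
  let L' : ℤ → X → Module.End k (X ⊗[k] FreeHopf k X) :=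
    fun i x => insertOp j ((K i j).compr₂ (gen k (i + 1))) x
  have e1 : ∀ i ⦃n : Type⦄ [Fintype n] [DecidableEq n] (u : n → n → X), IsMult k i u → ∀ a b,
      rext k _ X X (twist i j (D j i) (K i j) (u a b)) = ∑ c, Dm i (u a c) * L i (u c b) := by
    intro i n _ _ u hu a b
    refine ext_isMult_tmul j fun r w hw p q c => ?_
    rw [rext_tmul, twist_apply _ _ hu hw, map_sum]
    simp only [map_sum, rightMul_tmul, LinearMap.sum_apply, Module.End.mul_apply, Dm, L,
      insertOp_tmul _ _ hw, LinearMap.rTensor_tmul, LinearMap.flip_apply, LinearMap.compr₂_apply]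
    exact Finset.sum_comm
  have e2 : ∀ i ⦃n : Type⦄ [Fintype n] [DecidableEq n] (u : n → n → X), IsMult k i u → ∀ a b,
      ∑ c, rext k _ X X (twist (i + 1) j (D j (i + 1)) (K (i + 1) j) (u a c)) * Dm i (u c b)
        = L' i (u a b) := by
    intro i n _ _ u hu a b
    refine ext_isMult_tmul j fun r w hw p q c => ?_
    have h1 : ∀ e, twist (i + 1) j (D j (i + 1)) (K (i + 1) j) (u a e) (D j i (w p q) (u e b))
        = ∑ f : Fin r × n, ∑ g, D j (i + 1) (D j i (w f.1 q) (u e f.2)) (u g e) ⊗ₜ[k]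
          gen k (i + 1) (K (i + 1) j (u a g) (D j i (w p f.1) (u f.2 b))) := fun e =>
      twist_apply _ _ hu.transpose ((h.magma j i).multDot w u hw hu) e a (p, b) (q, e)
    calc _ = ∑ f, ∑ g, ∑ d, (∑ e, D j (i + 1) (D j i (w f q) (u e d)) (u g e)) ⊗ₜ[k]
            (gen k (i + 1) (K (i + 1) j (u a g) (D j i (w p f) (u d b))) * c) := by
          simp only [LinearMap.sum_apply, Module.End.mul_apply, Dm, LinearMap.rTensor_tmul,
            LinearMap.flip_apply, rext_tmul, h1, map_sum, rightMul_tmul, TensorProduct.sum_tmul,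
            Fintype.sum_prod_type]
          rw [Finset.sum_comm]
          exact Finset.sum_congr rfl fun f _ => sum_comm_three _
      _ = ∑ f, w f q ⊗ₜ[k] (gen k (i + 1) (∑ g, K (i + 1) j (u a g) (D j i (w p f) (u g b))) * c) := by
          refine Finset.sum_congr rfl fun f _ => ?_
          simp only [h.inv_dot j i u hu, TensorProduct.ite_tmul, map_sum, Finset.sum_mul,
            Finset.sum_ite_eq, Finset.mem_univ, if_true,
            TensorProduct.tmul_sum]
      _ = _ := by
          simp only [h.antipodal_colon i j u hu, L', insertOp_tmul _ _ hw, LinearMap.compr₂_apply]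
  have e3 : ∀ i ⦃n : Type⦄ [Fintype n] [DecidableEq n] (u : n → n → X), IsMult k i u → ∀ a b,
      ∑ c, L' i (u a c) * L i (u c b) = if a = b then 1 else 0 := by
    intro i n _ _ u hu a b
    refine ext_isMult_tmul j fun r w hw p q c => ?_
    have h1 := fun d => hg.succ_mul i _ ((h.magma j i).multColon u w hu hw) (a, d) (b, p)
    simp only [Fintype.sum_prod_type] at h1
    simp only [LinearMap.sum_apply, Module.End.mul_apply, L, L', insertOp_tmul _ _ hw, map_sum,
      LinearMap.compr₂_apply]
    rw [sum_rotate]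
    simp only [← mul_assoc, ← TensorProduct.tmul_sum, ← Finset.sum_mul, h1, Prod.mk.injEq]
    split_ifs with hab <;> simp [hab, TensorProduct.tmul_ite]
  have e4 : ∀ i ⦃n : Type⦄ [Fintype n] [DecidableEq n] (u : n → n → X), IsMult k i u → ∀ a b,
      ∑ c, L i (u a c) * L' i (u c b) = if a = b then 1 else 0 := by
    intro i n _ _ u hu a b
    refine ext_isMult_tmul j fun r w hw p q c => ?_
    have h1 := fun d => hg.mul_succ i _ ((h.magma j i).multColon u w hu hw) (a, d) (b, p)
    simp only [Fintype.sum_prod_type] at h1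
    simp only [LinearMap.sum_apply, Module.End.mul_apply, L, L', insertOp_tmul _ _ hw, map_sum,
      LinearMap.compr₂_apply]
    rw [sum_rotate]
    simp only [← mul_assoc, ← TensorProduct.tmul_sum, ← Finset.sum_mul, h1, Prod.mk.injEq]
    split_ifs with hab <;> simp [hab, TensorProduct.tmul_ite]
  have e5 : ∀ i ⦃n : Type⦄ [Fintype n] [DecidableEq n] (u : n → n → X), IsMult k i u → ∀ a b,
      ∑ c, Dm i (u a c) * Dm (i + 1) (u c b) = if a = b then 1 else 0 := by
    intro i n _ _ u hu a b
    refine ext_isMult_tmul j fun r w hw p q c => ?_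
    simp only [LinearMap.sum_apply, Module.End.mul_apply, Dm, LinearMap.rTensor_tmul,
      LinearMap.flip_apply, ← TensorProduct.sum_tmul, h.inv_dot' j i u hu]
    split_ifs <;> simp
  have key : ∀ i ⦃n : Type⦄ [Fintype n] [DecidableEq n] (u : n → n → X), IsMult k i u →
      Matrix.of (fun a b => rext k _ X X (twist (i + 1) j (D j (i + 1)) (K (i + 1) j) (u a b)))
        * Matrix.of (fun a b => rext k _ X X (twist i j (D j i) (K i j) (u a b))) = 1 ∧
      Matrix.of (fun a b => rext k _ X X (twist i j (D j i) (K i j) (u a b)))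
        * Matrix.of (fun a b => rext k _ X X (twist (i + 1) j (D j (i + 1)) (K (i + 1) j) (u a b)))
          = 1 := by
    intro i n _ _ u hu
    have m1 : Matrix.of (fun a b => rext k _ X X (twist i j (D j i) (K i j) (u a b)))
        = Matrix.of (fun a b => Dm i (u a b)) * Matrix.of fun a b => L i (u a b) := by
      ext1 a b; rw [Matrix.mul_apply]; exact e1 i u hu a b
    have m2 : Matrix.of (fun a b =>
          rext k _ X X (twist (i + 1) j (D j (i + 1)) (K (i + 1) j) (u a b)))
        * Matrix.of (fun a b => Dm i (u a b)) = Matrix.of fun a b => L' i (u a b) := by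
      ext1 a b; rw [Matrix.mul_apply]; exact e2 i u hu a b
    have m3 : Matrix.of (fun a b => L' i (u a b)) * Matrix.of (fun a b => L i (u a b)) = 1 := by
      ext1 a b; rw [Matrix.mul_apply, Matrix.one_apply]; exact e3 i u hu a b
    have m4 : Matrix.of (fun a b => L i (u a b)) * Matrix.of (fun a b => L' i (u a b)) = 1 := by
      ext1 a b; rw [Matrix.mul_apply, Matrix.one_apply]; exact e4 i u hu a b
    have m5 : Matrix.of (fun a b => Dm i (u a b)) * Matrix.of (fun a b => Dm (i + 1) (u a b))
        = 1 := by
      ext1 a b; rw [Matrix.mul_apply, Matrix.one_apply]; exact e5 i u hu a b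
    refine ⟨by rw [m1, ← mul_assoc, m2, m3], ?_⟩
    have m6 := congrArg (· * Matrix.of (fun a b => Dm (i + 1) (u a b))) m2
    simp only [mul_assoc, m5, mul_one] at m6
    rw [m6, m1, mul_assoc, ← mul_assoc (Matrix.of fun a b => L i (u a b)), m4, one_mul, m5]
  constructor
  · intro i n _ _ u hu a b
    have := congrFun (congrFun (key i u hu).1 a) b
    rwa [Matrix.mul_apply, Matrix.one_apply] at this
  · intro i n _ _ u hu a b
    have := congrFun (congrFun (key i u hu).2 a) b
    rwa [Matrix.mul_apply, Matrix.one_apply] at this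

end Action

end QBrace

namespace QBrace

/-! ### The action of the free Hopf algebra on `X ⊗ H` -/

section Twist

variable {k : Type u} [Field k] {X : Type v} [AddCommGroup X] [Module k X] [Coalgebra k X]
variable {D K : ℤ → ℤ → X →ₗ[k] X →ₗ[k] X}

open FreeHopf

/-- The representation `l ↦ (y ⊗ c ↦ y₍₁₎ · l₍₂₎ ⊗ (l₍₁₎ : y₍₂₎) c)` of `H` on `X ⊗ H`, for `y` of
level `j`. -/
noncomputable def IsLevelSystem.twistRep (h : IsLevelSystem D K) (j : ℤ) :
    FreeHopf k X →ₐ[k] Module.End k (X ⊗[k] FreeHopf k X) :=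
  lift _ (h.isAntipodalFamily_twist j)

theorem IsLevelSystem.twistRep_gen (h : IsLevelSystem D K) (i j : ℤ) (x : X) :
    h.twistRep j (gen k i x) = rext k _ X X (twist i j (D j i) (K i j) x) := by
  rw [twistRep, lift_gen]; rfl

theorem IsLevelSystem.isRightLinear_twistRep (h : IsLevelSystem D K) (j : ℤ) :
    IsRightLinear (h.twistRep j) := by
  intro l c z
  refine (intertwines (Θ := h.twistRep j) (Θ' := h.twistRep j) (F := rightMul k X c)
    (fun x m => ?_) l z).symm
  rw [h.twistRep_gen, rext_rightMul]

theorem IsLevelSystem.isAntipodalFamily_dot (h : IsLevelSystem D K) (j : ℤ) :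
    IsAntipodalFamily (A := Module.End k X) (fun i => (D j i).flip) := by
  constructor
  · intro i n _ _ u hu a b
    ext x
    simp only [LinearMap.sum_apply, Module.End.mul_apply, LinearMap.flip_apply, h.inv_dot j i u hu]
    split_ifs <;> rfl
  · intro i n _ _ u hu a b
    ext x
    simp only [LinearMap.sum_apply, Module.End.mul_apply, LinearMap.flip_apply,
      h.inv_dot' j i u hu]
    split_ifs <;> rfl

/-- The representation `l ↦ (y ↦ y · l)` of `H` on `X`, for `y` of level `j`. -/
noncomputable def IsLevelSystem.dotRep (h : IsLevelSystem D K) (j : ℤ) :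
    FreeHopf k X →ₐ[k] Module.End k X :=
  lift _ (h.isAntipodalFamily_dot j)

theorem IsLevelSystem.dotRep_gen (h : IsLevelSystem D K) (i j : ℤ) (x : X) :
    h.dotRep j (gen k i x) = (D j i).flip x := by
  rw [dotRep, lift_gen]

end Twist

section Diagonal

variable {k : Type u} [Field k] {B : Type*} [Ring B] [Bialgebra k B]
variable {M N : Type*} [AddCommGroup M] [Module k M] [AddCommGroup N] [Module k N]

/-- The tensor product of two representations of a bialgebra. -/
noncomputable def diagRep (Θ : B →ₐ[k] Module.End k M) (Ψ : B →ₐ[k] Module.End k N) :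
    B →ₐ[k] Module.End k (M ⊗[k] N) :=
  (Module.endTensorEndAlgHom.comp (Algebra.TensorProduct.map Θ Ψ)).comp
    (Bialgebra.comulAlgHom k B)

/-- The tensor product of two representations of a bialgebra, in the opposite order. -/
noncomputable def diagRep' (Θ : B →ₐ[k] Module.End k M) (Ψ : B →ₐ[k] Module.End k N) :
    B →ₐ[k] Module.End k (M ⊗[k] N) :=
  ((Module.endTensorEndAlgHom.comp (Algebra.TensorProduct.map Θ Ψ)).comp
    (Algebra.TensorProduct.comm k B B).toAlgHom).comp (Bialgebra.comulAlgHom k B)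

variable {n : Type} [Fintype n] [DecidableEq n] {u : n → n → B}

theorem diagRep_apply (Θ : B →ₐ[k] Module.End k M) (Ψ : B →ₐ[k] Module.End k N)
    (hu : IsMult k 0 u) (a b : n) (x : M) (y : N) :
    diagRep Θ Ψ (u a b) (x ⊗ₜ y) = ∑ c, Θ (u a c) x ⊗ₜ[k] Ψ (u c b) y := by
  simp only [diagRep, AlgHom.comp_apply, Bialgebra.comulAlgHom_apply, hu.comul_zero, map_sum,
    LinearMap.sum_apply]
  rfl

theorem diagRep'_apply (Θ : B →ₐ[k] Module.End k M) (Ψ : B →ₐ[k] Module.End k N)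
    (hu : IsMult k 0 u) (a b : n) (x : M) (y : N) :
    diagRep' Θ Ψ (u a b) (x ⊗ₜ y) = ∑ c, Θ (u c b) x ⊗ₜ[k] Ψ (u a c) y := by
  simp only [diagRep', AlgHom.comp_apply, Bialgebra.comulAlgHom_apply, hu.comul_zero, map_sum,
    LinearMap.sum_apply]
  rfl

/-- The left regular representation. -/
noncomputable abbrev leftReg (k : Type u) [Field k] (B : Type*) [Ring B] [Algebra k B] :
    B →ₐ[k] Module.End k B := Algebra.lmul k B

theorem leftReg_apply (a b : B) : leftReg k B a b = a * b := rfl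

end Diagonal

section Comultiplication

theorem FreeHopf.intertwines_isMult {k : Type u} [Field k] {X : Type v} [AddCommGroup X]
    [Module k X] [Coalgebra k X] {M M' : Type*} [AddCommGroup M] [Module k M] [AddCommGroup M']
    [Module k M'] {Θ : FreeHopf k X →ₐ[k] Module.End k M}
    {Θ' : FreeHopf k X →ₐ[k] Module.End k M'} {F : M →ₗ[k] M'}
    (h : ∀ (r : ℕ) (u : Fin r → Fin r → X), IsMult k 0 u → ∀ a b,
      F ∘ₗ Θ (gen k 0 (u a b)) = Θ' (gen k 0 (u a b)) ∘ₗ F) (a : FreeHopf k X) (m : M) :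
    F (Θ a m) = Θ' a (F m) := by
  refine intertwines (fun x m => ?_) a m
  have : F ∘ₗ LinearMap.applyₗ m ∘ₗ Θ.toLinearMap ∘ₗ gen k 0
      = LinearMap.applyₗ (F m) ∘ₗ Θ'.toLinearMap ∘ₗ gen k 0 :=
    ext_isMult 0 fun r u hu a b => LinearMap.congr_fun (h r u hu a b) m
  exact LinearMap.congr_fun this x

variable {k : Type u} [Field k] {X : Type v} [AddCommGroup X] [Module k X] [Coalgebra k X]

open FreeHopf

/-- `y ⊗ c ↦ y₍₂₎ ⊗ (y₍₁₎ ⊗ c)`, for `y` of level `j`. -/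
noncomputable def splitOff (k : Type u) [Field k] (X : Type v) [AddCommGroup X] [Module k X]
    [Coalgebra k X] (N : Type*) [AddCommGroup N] [Module k N] (j : ℤ) :
    X ⊗[k] N →ₗ[k] X ⊗[k] (X ⊗[k] N) :=
  (TensorProduct.assoc k X X N).toLinearMap ∘ₗ (levelComul k X (j + 1)).rTensor N

theorem splitOff_tmul {N : Type*} [AddCommGroup N] [Module k N] {j : ℤ} {m : Type} [Fintype m]
    [DecidableEq m] {w : m → m → X} (hw : IsMult k j w) (a b : m) (c : N) :
    splitOff k X N j (w a b ⊗ₜ c) = ∑ e, w e b ⊗ₜ[k] (w a e ⊗ₜ[k] c) := by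
  have h1 := hw.transpose.comul_apply b a
  simp [splitOff, h1, TensorProduct.sum_tmul]

end Comultiplication

section Relations

variable {k : Type u} [Field k] {X : Type v} [AddCommGroup X] [Module k X] [Coalgebra k X]
variable {D K : ℤ → ℤ → X →ₗ[k] X →ₗ[k] X}

open FreeHopf

theorem IsLevelSystem.twistRep_gen_tmul_one (h : IsLevelSystem D K) (i j : ℤ) (x y : X) :
    h.twistRep j (gen k i x) (y ⊗ₜ 1) = twist i j (D j i) (K i j) x y := by
  rw [twistRep_gen, rext_tmul_one]

/-- The action of `l` on `y₍₂₎`, followed by the action of the resulting element of `H` on `y₍₁₎`,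
reduces to `y ⊗ c ↦ y · l₍₁₎ ⊗ l₍₂₎ c`.  Here `y₍₂₎` has level `j` and `y₍₁₎` has level `j + 1`, as
in the product `S(y₍₁₎) y₍₂₎`. -/
theorem IsLevelSystem.splitOff_diagRep (h : IsLevelSystem D K) (j : ℤ) (l : FreeHopf k X)
    (z : X ⊗[k] FreeHopf k X) :
    splitOff k X _ j (diagRep (h.dotRep j) (leftReg k _) l z)
      = star (h.twistRep j) (h.isRightLinear_twistRep j) (h.twistRep (j + 1)) l
          (splitOff k X _ j z) := by
  refine intertwines_isMult (fun n u hu p q => ext_isMult_tmul j fun r w hw a b c => ?_) l z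
  simp only [LinearMap.comp_apply]
  have e1 := (h.magma j 0).multDot w u hw hu
  calc _ = ∑ f, ∑ g, D j 0 (w f b) (u p g) ⊗ₜ[k] (∑ s, D j 0 (w a f) (u g s) ⊗ₜ[k]
            (gen k 0 (u s q) * c)) := by
        have e := fun s d => splitOff_tmul (N := FreeHopf k X) e1 (a, s) (b, p) d
        simp only [Fintype.sum_prod_type] at e
        simp only [diagRep_apply _ _ (isMult_gen hu), dotRep_gen, LinearMap.flip_apply, map_sum, e,
          TensorProduct.tmul_sum, leftReg_apply]
        rw [Finset.sum_comm]
        exact Finset.sum_congr rfl fun f _ => Finset.sum_comm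
    _ = ∑ f, ∑ g, ∑ e, D j 0 (w f b) (u p g) ⊗ₜ[k] h.twistRep (j + 1)
            (gen k 0 (K 0 j (u g q) (w e f))) (w a e ⊗ₜ c) := by
        refine Finset.sum_congr rfl fun f _ => Finset.sum_congr rfl fun g _ => ?_
        rw [← TensorProduct.tmul_sum]
        congr 1
        have e3 := fun e => twist_apply (i := 0) (j := j + 1) (D (j + 1) 0) (K 0 (j + 1))
          ((h.magma j 0).multColon u w hu hw) hw.transpose (g, f) (q, e) e a
        simp only [twistRep_gen, rext_tmul, e3, map_sum, rightMul_tmul, Fintype.sum_prod_type]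
        rw [sum_comm_four, Finset.sum_comm]
        refine Finset.sum_congr rfl fun s _ => ?_
        simp only [← TensorProduct.tmul_sum, ← Finset.sum_mul, ← map_sum, h.inv_colon 0 j w hw,
          ← h.antipodal_dot j 0 w hw a f, TensorProduct.sum_tmul]
        refine Finset.sum_congr rfl fun d _ => ?_
        simp [apply_ite]
    _ = _ := by
        rw [splitOff_tmul hw, map_sum]
        simp only [star_tmul, twistRep_gen_tmul_one, twist_apply _ _ hu hw, map_sum, actTmul_tmul]
        exact sum_rotate _

theorem IsLevelSystem.splitOff_diagRep' (h : IsLevelSystem D K) (j : ℤ) (l : FreeHopf k X)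
    (z : X ⊗[k] FreeHopf k X) :
    splitOff k X _ j (diagRep' (h.dotRep (j + 1)) (leftReg k _) l z)
      = star (h.twistRep (j + 1)) (h.isRightLinear_twistRep (j + 1)) (h.twistRep j) l
          (splitOff k X _ j z) := by
  refine intertwines_isMult (fun n u hu p q => ext_isMult_tmul j fun r w hw a b c => ?_) l z
  simp only [LinearMap.comp_apply]
  have e1 := (h.magma (j + 1) 0).multDot _ u hw.transpose hu
  calc _ = ∑ f, ∑ g, D (j + 1) 0 (w f b) (u g q) ⊗ₜ[k] (∑ s, D (j + 1) 0 (w a f) (u s g) ⊗ₜ[k]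
            (gen k 0 (u p s) * c)) := by
        have e := fun s d => splitOff_tmul (N := FreeHopf k X) e1.transpose' (a, s) (b, q) d
        simp only [Fintype.sum_prod_type] at e
        simp only [diagRep'_apply _ _ (isMult_gen hu), dotRep_gen, LinearMap.flip_apply, map_sum, e,
          TensorProduct.tmul_sum, leftReg_apply]
        rw [Finset.sum_comm]
        exact Finset.sum_congr rfl fun f _ => Finset.sum_comm
    _ = ∑ f, ∑ g, ∑ e, D (j + 1) 0 (w f b) (u g q) ⊗ₜ[k] h.twistRep j
            (gen k 0 (K 0 (j + 1) (u p g) (w e f))) (w a e ⊗ₜ c) := by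
        refine Finset.sum_congr rfl fun f _ => Finset.sum_congr rfl fun g _ => ?_
        rw [← TensorProduct.tmul_sum]
        congr 1
        have e3 := fun e => twist_apply' (i := 0) (j := j) (h.magma j 0).exchange
          ((h.magma (j + 1) 0).multColon u _ hu hw.transpose) hw (p, e) (g, f) a e
        simp only [twistRep_gen, rext_tmul, e3, map_sum, rightMul_tmul, Fintype.sum_prod_type]
        rw [sum_comm_four, Finset.sum_comm]
        refine Finset.sum_congr rfl fun s _ => ?_
        simp only [← TensorProduct.tmul_sum, ← Finset.sum_mul, ← map_sum, h.inv_colon' 0 j w hw,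
          (h.antipodal_dot j 0).eq_sum (h.inv_colon' 0 j) hw a f, TensorProduct.sum_tmul]
        refine Finset.sum_congr rfl fun d _ => ?_
        simp [apply_ite]
    _ = _ := by
        rw [splitOff_tmul hw, map_sum]
        simp only [star_tmul, twistRep_gen_tmul_one,
          twist_apply' (h.magma (j + 1) 0).exchange hu hw.transpose, map_sum, actTmul_tmul]
        exact sum_rotate _

end Relations

end QBrace

namespace QBrace

/-! ### The action of the free Hopf algebra on `H ⊗ H` -/

section ActionOnFree

variable {k : Type u} [Field k] {X : Type v} [AddCommGroup X] [Module k X] [Coalgebra k X]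
variable {D K : ℤ → ℤ → X →ₗ[k] X →ₗ[k] X}

open FreeHopf

/-- `m ⊗ c ↦ c ⊗ Sʲ(m)`. -/
noncomputable def swapGen (k : Type u) [Field k] (X : Type v) [AddCommGroup X] [Module k X]
    [Coalgebra k X] (j : ℤ) : X ⊗[k] FreeHopf k X →ₗ[k] FreeHopf k X ⊗[k] FreeHopf k X :=
  (TensorProduct.comm k _ _).toLinearMap ∘ₗ (gen k j).rTensor _

@[simp]
theorem swapGen_tmul (j : ℤ) (m : X) (c : FreeHopf k X) :
    swapGen k X j (m ⊗ₜ c) = c ⊗ₜ gen k j m := by simp [swapGen]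

/-- The operator `l ⊗ c ↦ (l₍₁₎ : a₍₂₎) ⊗ (a₍₁₎ · l₍₂₎) c` on `H ⊗ H`, for a generator `a = Sʲ(x)`
of `H`. -/
noncomputable def IsLevelSystem.genAct (h : IsLevelSystem D K) (j : ℤ) :
    X →ₗ[k] Module.End k (FreeHopf k X ⊗[k] FreeHopf k X) :=
  rext k _ _ _ ∘ₗ ((h.twistRep j).toLinearMap.flip ∘ₗ (TensorProduct.mk k X _).flip 1).compr₂
    (swapGen k X j)

theorem IsLevelSystem.genAct_tmul (h : IsLevelSystem D K) (j : ℤ) (x : X) (l c : FreeHopf k X) :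
    h.genAct j x (l ⊗ₜ c) = rightMul k _ c (swapGen k X j (h.twistRep j l (x ⊗ₜ 1))) :=
  rext_tmul _ _ _

/-- `m ⊗ (m' ⊗ c') ↦ c' ⊗ Sʲ'(m') Sʲ(m) c`. -/
noncomputable def mulGens (j j' : ℤ) (c : FreeHopf k X) :
    X ⊗[k] (X ⊗[k] FreeHopf k X) →ₗ[k] FreeHopf k X ⊗[k] FreeHopf k X :=
  TensorProduct.lift (LinearMap.lcomp k _ (swapGen k X j') ∘ₗ LinearMap.lTensorHom _ ∘ₗ
    (LinearMap.mul k (FreeHopf k X)).flip ∘ₗ LinearMap.mulRight k c ∘ₗ gen k j)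

theorem mulGens_tmul (j j' : ℤ) (c : FreeHopf k X) (m : X) (z : X ⊗[k] FreeHopf k X) :
    mulGens j j' c (m ⊗ₜ z) = rightMul k _ (gen k j m * c) (swapGen k X j' z) := rfl

theorem IsLevelSystem.genAct_swapGen (h : IsLevelSystem D K) (j j' : ℤ) (x : X)
    (c : FreeHopf k X) (z : X ⊗[k] FreeHopf k X) :
    h.genAct j' x (rightMul k _ c (swapGen k X j z))
      = mulGens j j' c (actTmul (h.twistRep j') X (x ⊗ₜ 1) z) := by
  induction z using TensorProduct.induction_on with
  | zero => simp
  | tmul m b => rw [swapGen_tmul, rightMul_tmul, genAct_tmul, actTmul_tmul, mulGens_tmul]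
  | add x y hx hy => simp only [map_add, hx, hy]

theorem IsLevelSystem.counit_dot (h : IsLevelSystem D K) (i j : ℤ) (x y : X) :
    counit (R := k) (D i j x y) = counit (R := k) x * counit (R := k) y :=
  (h.magma i j).multDot.counit_apply x y

theorem IsLevelSystem.legR_diagRep (h : IsLevelSystem D K) {N : Type*} [AddCommGroup N] [Module k N] (j : ℤ)
    (Ψ : FreeHopf k X →ₐ[k] Module.End k N) (l : FreeHopf k X) (z : X ⊗[k] N) :
    legR k X N (diagRep (h.dotRep j) Ψ l z) = Ψ l (legR k X N z) := by
  refine intertwines_isMult (fun n u hu p q => TensorProduct.ext' fun x c => ?_) l z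
  simp only [LinearMap.comp_apply, diagRep_apply _ _ (isMult_gen hu), dotRep_gen, map_sum,
    LinearMap.flip_apply, legR_tmul, h.counit_dot, hu.counit_apply, map_smul]
  simp

theorem IsLevelSystem.legR_diagRep' (h : IsLevelSystem D K) {N : Type*} [AddCommGroup N] [Module k N] (j : ℤ)
    (Ψ : FreeHopf k X →ₐ[k] Module.End k N) (l : FreeHopf k X) (z : X ⊗[k] N) :
    legR k X N (diagRep' (h.dotRep j) Ψ l z) = Ψ l (legR k X N z) := by
  refine intertwines_isMult (fun n u hu p q => TensorProduct.ext' fun x c => ?_) l z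
  simp only [LinearMap.comp_apply, diagRep'_apply _ _ (isMult_gen hu), dotRep_gen, map_sum,
    LinearMap.flip_apply, legR_tmul, h.counit_dot, hu.counit_apply, map_smul]
  simp

theorem mulGens_splitOff {j j' i : ℤ} (c : FreeHopf k X)
    (hg : ∀ ⦃n : Type⦄ [Fintype n] [DecidableEq n] (w : n → n → X), IsMult k i w →
      ∀ a b, ∑ e, gen k j' (w a e) * gen k j (w e b) = if a = b then 1 else 0)
    (z : X ⊗[k] FreeHopf k X) :
    mulGens j j' c (splitOff k X _ i z) = legR k X _ z ⊗ₜ[k] c := by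
  suffices H : mulGens j j' c ∘ₗ splitOff k X _ i
      = (TensorProduct.mk k _ _).flip c ∘ₗ legR k X _ from LinearMap.congr_fun H z
  refine ext_isMult_tmul i fun r w hw a b d => ?_
  simp only [LinearMap.comp_apply, splitOff_tmul hw, map_sum, mulGens_tmul, swapGen_tmul,
    rightMul_tmul, ← mul_assoc, ← TensorProduct.tmul_sum, ← Finset.sum_mul, hg w hw, legR_tmul,
    hw.counit_apply, LinearMap.flip_apply, TensorProduct.mk_apply]
  split_ifs <;> simp

/-- By `splitOff_diagRep`, the action of `S(y₍₁₎) y₍₂₎` on `l ⊗ c` is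
`l₍₂₎ ⊗ S(z₍₁₎) z₍₂₎ c` with `z = y · l₍₁₎`, which the antipode relations in `H` reduce to
`ε(y) l ⊗ c`. -/
theorem IsLevelSystem.isAntipodalFamily_genAct (h : IsLevelSystem D K) :
    IsAntipodalFamily (A := Module.End k (FreeHopf k X ⊗[k] FreeHopf k X)) h.genAct := by
  have hg := isAntipodalFamily_gen (k := k) (X := X)
  constructor
  · intro j n _ _ w hw a b
    refine TensorProduct.ext' fun l c => ?_
    have e1 := h.splitOff_diagRep j l (w a b ⊗ₜ 1)
    have e2 := congrArg (mulGens j (j + 1) c) e1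
    rw [mulGens_splitOff c (hg.succ_mul j), h.legR_diagRep, legR_tmul, splitOff_tmul hw] at e2
    simp only [map_sum, star_tmul, ← h.genAct_swapGen, ← h.genAct_tmul] at e2
    simp only [LinearMap.sum_apply, Module.End.mul_apply, ← e2, hw.counit_apply]
    split_ifs <;> simp
  · intro j n _ _ w hw a b
    refine TensorProduct.ext' fun l c => ?_
    have e1 := h.splitOff_diagRep' j l (w a b ⊗ₜ 1)
    have e2 := congrArg (mulGens (j + 1) j c) e1
    rw [mulGens_splitOff c (hg.mul_succ j), h.legR_diagRep', legR_tmul, splitOff_tmul hw] at e2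
    simp only [map_sum, star_tmul, ← h.genAct_swapGen, ← h.genAct_tmul] at e2
    simp only [LinearMap.sum_apply, Module.End.mul_apply, ← e2, hw.counit_apply]
    split_ifs <;> simp

/-- The representation `a ↦ (l ⊗ c ↦ (l₍₁₎ : a₍₂₎) ⊗ (a₍₁₎ · l₍₂₎) c)` of `H` on `H ⊗ H`. -/
noncomputable def IsLevelSystem.freeRep (h : IsLevelSystem D K) :
    FreeHopf k X →ₐ[k] Module.End k (FreeHopf k X ⊗[k] FreeHopf k X) :=
  lift _ h.isAntipodalFamily_genAct

theorem IsLevelSystem.freeRep_gen_tmul (h : IsLevelSystem D K) (j : ℤ) (x : X)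
    (l c : FreeHopf k X) : h.freeRep (gen k j x) (l ⊗ₜ c)
      = rightMul k _ c (swapGen k X j (h.twistRep j l (x ⊗ₜ 1))) := by
  rw [freeRep, lift_gen, genAct_tmul]

theorem IsLevelSystem.isRightLinear_freeRep (h : IsLevelSystem D K) : IsRightLinear h.freeRep := by
  intro a c z
  refine (intertwines (Θ := h.freeRep) (Θ' := h.freeRep) (F := rightMul k _ c)
    (fun x m => ?_) a z).symm
  rw [freeRep, lift_gen]
  exact (rext_rightMul _ c m).symm

end ActionOnFree

end QBrace

namespace QBrace

/-! ### The actions and products, counits and comultiplications -/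

theorem sum_rotate_two_five {α β ι₁ ι₂ ι₃ ι₄ ι₅ M : Type*} [Fintype α] [Fintype β] [Fintype ι₁]
    [Fintype ι₂] [Fintype ι₃] [Fintype ι₄] [Fintype ι₅] [AddCommMonoid M]
    (F : α → β → ι₁ → ι₂ → ι₃ → ι₄ → ι₅ → M) :
    ∑ a, ∑ b, ∑ i, ∑ j, ∑ l, ∑ p, ∑ q, F a b i j l p q
      = ∑ i, ∑ j, ∑ l, ∑ p, ∑ q, ∑ a, ∑ b, F a b i j l p q := by
  rw [sum_rotate]
  refine Finset.sum_congr rfl fun i _ => ?_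
  rw [sum_rotate]
  refine Finset.sum_congr rfl fun j _ => ?_
  rw [sum_rotate]
  refine Finset.sum_congr rfl fun l _ => ?_
  rw [sum_rotate]
  refine Finset.sum_congr rfl fun p _ => ?_
  rw [sum_rotate]

section Hexagon

variable {k : Type u} [Field k] {X : Type v} [AddCommGroup X] [Module k X] [Coalgebra k X]
variable {D K : ℤ → ℤ → X →ₗ[k] X →ₗ[k] X}

open FreeHopf

/-- `l ⊗ (m ⊗ c) ↦ m l ⊗ c`. -/
noncomputable def mulOp (k : Type u) [Field k] (B : Type*) [Ring B] [Algebra k B] (N : Type*)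
    [AddCommGroup N] [Module k N] : B ⊗[k] (B ⊗[k] N) →ₗ[k] B ⊗[k] N :=
  (LinearMap.mul' k B ∘ₗ (TensorProduct.comm k B B).toLinearMap).rTensor N ∘ₗ
    (TensorProduct.assoc k B B N).symm.toLinearMap

@[simp]
theorem mulOp_tmul {B : Type*} [Ring B] [Algebra k B] {N : Type*}
    [AddCommGroup N] [Module k N] (l m : B) (c : N) :
    mulOp k B N (l ⊗ₜ (m ⊗ₜ c)) = (m * l) ⊗ₜ c := by simp [mulOp]

/-- Compatibility of the action with products in the argument: `T_m T_l = T_{ml}`. -/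
theorem IsLevelSystem.freeRep_mulOp (h : IsLevelSystem D K) (a : FreeHopf k X)
    (z : FreeHopf k X ⊗[k] (FreeHopf k X ⊗[k] FreeHopf k X)) :
    mulOp k _ _ (star h.freeRep h.isRightLinear_freeRep h.freeRep a z)
      = h.freeRep a (mulOp k _ _ z) := by
  refine intertwines_isMult (Θ := star h.freeRep h.isRightLinear_freeRep h.freeRep)
    (fun n u hu p q => TensorProduct.ext' fun l z => ?_) a z
  simp only [LinearMap.comp_apply]
  induction z using TensorProduct.induction_on with
  | zero => simp
  | add x y hx hy => simp only [map_add, TensorProduct.tmul_add, hx, hy]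
  | tmul m c =>
    have key : ∀ z, mulOp k _ _ (actTmul h.freeRep _ (m ⊗ₜ c) (swapGen k X 0 z))
        = rightMul k _ c (swapGen k X 0 (h.twistRep 0 m z)) := by
      intro z
      induction z using TensorProduct.induction_on with
      | zero => simp
      | add x y hx hy => simp only [map_add, hx, hy]
      | tmul x b =>
        rw [swapGen_tmul, actTmul_tmul, h.freeRep_gen_tmul,
          (h.isRightLinear_twistRep 0).apply_tmul m x b]
        generalize h.twistRep 0 m (x ⊗ₜ 1) = y
        induction y using TensorProduct.induction_on with
        | zero => simp
        | add x y hx hy => simp only [map_add, TensorProduct.tmul_add, hx, hy]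
        | tmul x b => simp
    rw [star_tmul, h.freeRep_gen_tmul, rightMul_one, key, mulOp_tmul, h.freeRep_gen_tmul, map_mul]
    rfl

theorem IsLevelSystem.freeRep_one_tmul (h : IsLevelSystem D K) (a c : FreeHopf k X) :
    h.freeRep a (1 ⊗ₜ c) = 1 ⊗ₜ (a * c) := by
  refine (intertwines (Θ := leftReg k _) (Θ' := h.freeRep)
    (F := TensorProduct.mk k (FreeHopf k X) (FreeHopf k X) 1) (fun x m => ?_) a c).symm
  simp [h.freeRep_gen_tmul]

end Hexagon

section CoalgebraProperty

variable {k : Type u} [Field k] {X : Type v} [AddCommGroup X] [Module k X] [Coalgebra k X]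
variable {D K : ℤ → ℤ → X →ₗ[k] X →ₗ[k] X}

open FreeHopf

theorem IsLevelSystem.counit_twistRep (h : IsLevelSystem D K) (l : FreeHopf k X)
    (z : X ⊗[k] FreeHopf k X) : counit (R := k) (h.twistRep 0 l z)
      = counit (R := k) l * counit (R := k) z := by
  refine intertwines_isMult (Θ' := (Algebra.lmul k k).comp (Bialgebra.counitAlgHom k _))
    (fun n u hu p q => ext_isMult_tmul 0 fun r w hw a b c => ?_) l z
  simp only [LinearMap.comp_apply, h.twistRep_gen, rext_tmul, twist_apply _ _ hu hw, map_sum,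
    rightMul_tmul, TensorProduct.counit_tmul, h.counit_dot, h.symm.counit_dot,
    Bialgebra.counit_mul, counit_gen, hu.counit_apply, hw.counit_apply]
  simp [counit_gen, hu.counit_apply]

theorem IsLevelSystem.counit_freeRep (h : IsLevelSystem D K) (a : FreeHopf k X)
    (z : FreeHopf k X ⊗[k] FreeHopf k X) : counit (R := k) (h.freeRep a z)
      = counit (R := k) a * counit (R := k) z := by
  refine intertwines_isMult (Θ' := (Algebra.lmul k k).comp (Bialgebra.counitAlgHom k _))
    (fun n u hu p q => TensorProduct.ext' fun l c => ?_) a z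
  have key : ∀ z, counit (R := k) (rightMul k _ c (swapGen k X 0 z))
      = counit (R := k) z * counit (R := k) c := by
    intro z
    induction z using TensorProduct.induction_on with
    | zero => simp
    | add x y hx hy => simp only [map_add, add_mul, hx, hy]
    | tmul x b => simp [counit_gen]; ring
  simp only [LinearMap.comp_apply, h.freeRep_gen_tmul, key, h.counit_twistRep]
  simp [counit_gen]
  ring

/-- `m ⊗ c ↦ (m₍₁₎ ⊗ c₍₂₎) ⊗ (m₍₂₎ ⊗ c₍₁₎)`. -/
noncomputable def comulR (k : Type u) [Field k] (A B : Type*) [AddCommGroup A] [Module k A]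
    [Coalgebra k A] [AddCommGroup B] [Module k B] [Coalgebra k B] :
    A ⊗[k] B →ₗ[k] (A ⊗[k] B) ⊗[k] (A ⊗[k] B) :=
  (TensorProduct.tensorTensorTensorComm k A A B B).toLinearMap ∘ₗ
    TensorProduct.map comul (comulFlip k B)

/-- `l ⊗ c ↦ (l₍₂₎ ⊗ c₍₁₎) ⊗ (l₍₁₎ ⊗ c₍₂₎)`. -/
noncomputable def comulL (k : Type u) [Field k] (A B : Type*) [AddCommGroup A] [Module k A]
    [Coalgebra k A] [AddCommGroup B] [Module k B] [Coalgebra k B] :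
    A ⊗[k] B →ₗ[k] (A ⊗[k] B) ⊗[k] (A ⊗[k] B) :=
  (TensorProduct.tensorTensorTensorComm k A A B B).toLinearMap ∘ₗ
    TensorProduct.map (comulFlip k A) comul

section

variable {A B : Type*} [AddCommGroup A] [Module k A] [Coalgebra k A] [AddCommGroup B] [Module k B]
  [Coalgebra k B] {n m : Type} [Fintype n] [DecidableEq n] [Fintype m] [DecidableEq m]

theorem comulR_tmul {u : n → n → A} {w : m → m → B} (hu : IsMult k 0 u) (hw : IsMult k 0 w)
    (a b : n) (c d : m) : comulR k A B (u a b ⊗ₜ w c d)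
      = ∑ e, ∑ f, (u a e ⊗ₜ[k] w f d) ⊗ₜ[k] (u e b ⊗ₜ[k] w c f) := by
  simp only [comulR, comulFlip, LinearMap.comp_apply, TensorProduct.map_tmul, hu.comul_zero,
    hw.comul_zero, map_sum, LinearEquiv.coe_coe, TensorProduct.comm_tmul, TensorProduct.sum_tmul,
    TensorProduct.tmul_sum, TensorProduct.tensorTensorTensorComm_tmul]
  exact Finset.sum_comm

theorem comulL_tmul {u : n → n → A} {w : m → m → B} (hu : IsMult k 0 u) (hw : IsMult k 0 w)
    (a b : n) (c d : m) : comulL k A B (u a b ⊗ₜ w c d)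
      = ∑ e, ∑ f, (u e b ⊗ₜ[k] w c f) ⊗ₜ[k] (u a e ⊗ₜ[k] w f d) := by
  simp only [comulL, comulFlip, LinearMap.comp_apply, TensorProduct.map_tmul, hu.comul_zero,
    hw.comul_zero, map_sum, LinearEquiv.coe_coe, TensorProduct.comm_tmul, TensorProduct.sum_tmul,
    TensorProduct.tmul_sum, TensorProduct.tensorTensorTensorComm_tmul]
  exact Finset.sum_comm

theorem comulL_legL_legL (z : A ⊗[k] B) :
    TensorProduct.map (legL k A B) (legL k A B) (comulL k A B z) = comulFlip k A (legL k A B z) := by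
  suffices H : TensorProduct.map (legL k A B) (legL k A B) ∘ₗ comulL k A B
      = comulFlip k A ∘ₗ legL k A B from LinearMap.congr_fun H z
  refine ext_tmul_isMult fun r s u w hu hw a b c e => ?_
  simp only [LinearMap.comp_apply, comulL_tmul hu hw]
  by_cases hce : c = e <;>
  simp [comulFlip, hu.comul_zero, hce, hw.counit_apply, ite_smul, TensorProduct.ite_tmul,
    TensorProduct.tmul_ite]

theorem comulL_legR_legR (z : A ⊗[k] B) :
    TensorProduct.map (legR k A B) (legR k A B) (comulL k A B z) = comul (legR k A B z) := by
  suffices H : TensorProduct.map (legR k A B) (legR k A B) ∘ₗ comulL k A B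
      = comul ∘ₗ legR k A B from LinearMap.congr_fun H z
  refine ext_tmul_isMult fun r s u w hu hw a b c e => ?_
  simp only [LinearMap.comp_apply, comulL_tmul hu hw]
  by_cases hab : a = b <;>
  simp [hw.comul_zero, hab, hu.counit_apply, ite_smul, TensorProduct.ite_tmul,
    TensorProduct.tmul_ite]

theorem comulL_legL_legR (z : A ⊗[k] B) :
    TensorProduct.map (legL k A B) (legR k A B) (comulL k A B z) = z := by
  suffices H : TensorProduct.map (legL k A B) (legR k A B) ∘ₗ comulL k A B = LinearMap.id from
    LinearMap.congr_fun H z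
  refine ext_tmul_isMult fun r s u w hu hw a b c e => ?_
  simp [comulL_tmul hu hw, hu.counit_apply, hw.counit_apply, ite_smul, TensorProduct.ite_tmul,
    TensorProduct.tmul_ite]

theorem comulL_legR_legL (z : A ⊗[k] B) :
    TensorProduct.map (legR k A B) (legL k A B) (comulL k A B z) = TensorProduct.comm k A B z := by
  suffices H : TensorProduct.map (legR k A B) (legL k A B) ∘ₗ comulL k A B
    = (TensorProduct.comm k A B).toLinearMap from LinearMap.congr_fun H z
  refine ext_tmul_isMult fun r s u w hu hw a b c e => ?_
  simp [comulL_tmul hu hw, hu.counit_apply, hw.counit_apply, ite_smul, TensorProduct.ite_tmul,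
    TensorProduct.tmul_ite]

end

theorem IsMult.mul {B : Type*} [Ring B] [Bialgebra k B] {n m : Type} [Fintype n] [DecidableEq n]
    [Fintype m] [DecidableEq m] {u : n → n → B} {w : m → m → B} (hu : IsMult k 0 u)
    (hw : IsMult k 0 w) : IsMult k 0 (fun p q : n × m => u p.1 q.1 * w p.2 q.2) := by
  refine ⟨fun p q => ?_, fun p q => ?_⟩
  · rw [levelComul_zero, Bialgebra.comul_mul, hu.comul_zero, hw.comul_zero, Fintype.sum_prod_type,
      Finset.sum_mul_sum]
    simp only [Algebra.TensorProduct.tmul_mul_tmul]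
  · rw [Bialgebra.counit_mul, hu.counit_apply, hw.counit_apply]
    simp only [Prod.ext_iff, ite_and]
    split_ifs <;> simp

theorem isMult_one {B : Type*} [Ring B] [Bialgebra k B] :
    IsMult k 0 (fun _ _ : Unit => (1 : B)) := by
  refine ⟨fun p q => ?_, fun p q => ?_⟩ <;> simp [Algebra.TensorProduct.one_def]

theorem comulL_rightMul {A B : Type*} [AddCommGroup A] [Module k A] [Coalgebra k A] [Ring B]
    [Bialgebra k B] {m : Type} [Fintype m] [DecidableEq m] {v : m → m → B} (hv : IsMult k 0 v)
    (c d : m) (z : A ⊗[k] B) : comulL k A B (rightMul k A (v c d) z)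
      = ∑ g, TensorProduct.map (rightMul k A (v c g)) (rightMul k A (v g d)) (comulL k A B z) := by
  suffices H : comulL k A B ∘ₗ rightMul k A (v c d)
      = ∑ g, TensorProduct.map (rightMul k A (v c g)) (rightMul k A (v g d)) ∘ₗ comulL k A B by
    simpa using LinearMap.congr_fun H z
  refine ext_tmul_isMult fun r s u w hu hw a b e f => ?_
  have := comulL_tmul hu (hw.mul hv) a b (e, c) (f, d)
  simp only [LinearMap.comp_apply, rightMul_tmul, this, LinearMap.sum_apply, comulL_tmul hu hw,
    map_sum, TensorProduct.map_tmul, Fintype.sum_prod_type]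
  exact sum_rotate _

theorem IsLevelSystem.comulR_twistRep (h : IsLevelSystem D K) (l : FreeHopf k X)
    (z : X ⊗[k] FreeHopf k X) : comulR k X _ (h.twistRep 0 l z)
      = diagRep' (h.twistRep 0) (h.twistRep 0) l (comulR k X _ z) := by
  refine intertwines_isMult (fun n u hu p q => ext_tmul_isMult fun r s w v hw hv a b c d => ?_) l z
  have hN := (h.magma 0 0).multDot w u hw hu
  have hM := (h.magma 0 0).multColon u w hu hw
  have hMv := (isMult_gen hM).mul hv
  have e1 := fun e f => comulR_tmul hN hMv (a, q) (e, f) ((p, b), c) ((f, e), d)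
  have hT : ∀ p q a b c, h.twistRep 0 (gen k 0 (u p q)) (w a b ⊗ₜ c)
      = ∑ e, ∑ f, D 0 0 (w a e) (u f q) ⊗ₜ[k] (gen k 0 (K 0 0 (u p f) (w e b)) * c) := by
    intro p q a b c
    rw [h.twistRep_gen, rext_tmul, twist_apply' (h.magma 0 0).exchange hu hw]
    simp
  simp only [Fintype.sum_prod_type] at e1
  simp only [LinearMap.comp_apply, hT, map_sum, comulR_tmul hw hv, e1,
    diagRep'_apply _ _ (isMult_gen hu), TensorProduct.sum_tmul, TensorProduct.tmul_sum]
  let Φ : Fin r → Fin n → Fin n → Fin r → Fin s → X ⊗[k] X →ₗ[k]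
      (X ⊗[k] FreeHopf k X) ⊗[k] (X ⊗[k] FreeHopf k X) := fun e f f' e' g =>
    TensorProduct.map
      (TensorProduct.mk k _ _ (D 0 0 (w a e) (u f q)) ∘ₗ LinearMap.mulRight k (v g d) ∘ₗ gen k 0)
      ((TensorProduct.mk k _ _).flip (gen k 0 (K 0 0 (u p f') (w e' b)) * v c g))
  have hΦ : ∀ e f f' e' g x y, Φ e f f' e' g (x ⊗ₜ y)
      = (D 0 0 (w a e) (u f q) ⊗ₜ[k] (gen k 0 x * v g d)) ⊗ₜ[k]
        (y ⊗ₜ[k] (gen k 0 (K 0 0 (u p f') (w e' b)) * v c g)) := fun _ _ _ _ _ _ _ => rfl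
  calc _ = ∑ g, ∑ e', ∑ f', ∑ e, ∑ f, Φ e f f' e' g (∑ x, ∑ y,
            K 0 0 (u f' y) (w x e') ⊗ₜ[k] D 0 0 (w e x) (u y f)) := by
        simp only [map_sum, hΦ]
        rw [sum_rotate_two_five]
        simp only [sum_comm_three (α := Fin n) (β := Fin r) (γ := Fin s)]
        rw [sum_rotate]
        refine Finset.sum_congr rfl fun g _ => ?_
        rw [sum_rotate]
        refine Finset.sum_congr rfl fun e' _ => ?_
        rw [sum_rotate]
    _ = ∑ g, ∑ e', ∑ f', ∑ e, ∑ f, Φ e f f' e' g (∑ x, ∑ y,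
            K 0 0 (u y f) (w e x) ⊗ₜ[k] D 0 0 (w x e') (u f' y)) := by
        simp only [(h.magma 0 0).exchange w u hw hu]
    _ = _ := by
        simp only [map_sum, hΦ]
        rw [← sum_rotate_two_five]
        exact Finset.sum_congr rfl fun x _ => Finset.sum_comm

end CoalgebraProperty

end QBrace

namespace QBrace

/-! ### Brace representations -/

section FreeRepresentation

variable {k : Type u} [Field k] {X : Type v} [AddCommGroup X] [Module k X] [Coalgebra k X]
variable {D K : ℤ → ℤ → X →ₗ[k] X →ₗ[k] X}

open FreeHopf

theorem comulL_swapGen (z : X ⊗[k] FreeHopf k X) : comulL k (FreeHopf k X) (FreeHopf k X) (swapGen k X 0 z)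
    = TensorProduct.map (swapGen k X 0) (swapGen k X 0) (comulR k X (FreeHopf k X) z) := by
  suffices H : comulL k (FreeHopf k X) (FreeHopf k X) ∘ₗ swapGen k X 0
      = TensorProduct.map (swapGen k X 0) (swapGen k X 0) ∘ₗ comulR k X (FreeHopf k X) from
    LinearMap.congr_fun H z
  refine ext_tmul_isMult (k := k) (A := X) (B := FreeHopf k X)
    (M := (FreeHopf k X ⊗[k] FreeHopf k X) ⊗[k] (FreeHopf k X ⊗[k] FreeHopf k X)) fun r s u w hu hw a b c d => ?_
  simp only [LinearMap.comp_apply, swapGen_tmul, comulL_tmul hw (isMult_gen hu),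
    comulR_tmul hu hw, map_sum, TensorProduct.map_tmul]
  exact Finset.sum_comm

theorem IsLevelSystem.comulL_freeRep (h : IsLevelSystem D K) (a : FreeHopf k X)
    (z : FreeHopf k X ⊗[k] FreeHopf k X) : comulL k (FreeHopf k X) (FreeHopf k X) (h.freeRep a z)
      = diagRep h.freeRep h.freeRep a (comulL k _ _ z) := by
  refine intertwines_isMult (fun n y hy a b => ext_tmul_isMult (k := k)
    (A := FreeHopf k X) (B := FreeHopf k X)
    (M := (FreeHopf k X ⊗[k] FreeHopf k X) ⊗[k] (FreeHopf k X ⊗[k] FreeHopf k X)) fun r s l v hl hv p q c d => ?_) a z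
  have e1 := comulR_tmul hy (isMult_one (k := k) (B := FreeHopf k X)) a b () ()
  simp only [LinearMap.comp_apply, h.freeRep_gen_tmul, comulL_rightMul hv, comulL_swapGen,
    h.comulR_twistRep, e1, comulL_tmul hl hv, map_sum, diagRep_apply _ _ (isMult_gen hy),
    diagRep'_apply _ _ hl, TensorProduct.map_tmul, Finset.univ_unique, Finset.sum_singleton]
  exact sum_rotate _

end FreeRepresentation

section BraceRepresentations

variable {k : Type u} [Field k] {B : Type*} [Ring B] [Bialgebra k B]

/-- Representations `U` of a bialgebra `B` on `B ⊗ B` of the form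
`U_a (l ⊗ c) = (l₍₁₎ : a₍₂₎) ⊗ (a₍₁₎ · l₍₂₎) c`, where `·` and `:` are the operations of a Hopf
`q`-brace without the three identities of a `q`-cycle coalgebra. -/
structure IsBraceRep (U : B →ₐ[k] Module.End k (B ⊗[k] B)) : Prop where
  rightLinear : IsRightLinear U
  one_tmul : ∀ a c, U a (1 ⊗ₜ c) = 1 ⊗ₜ (a * c)
  mulOp_star : ∀ a z, mulOp k B B (star U rightLinear U a z) = U a (mulOp k B B z)
  counit_apply : ∀ a z, counit (R := k) (U a z) = counit (R := k) a * counit (R := k) z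
  comulL_apply : ∀ a z, comulL k B B (U a z) = diagRep U U a (comulL k B B z)

/-- The operation `a · l`. -/
noncomputable def repDot (U : B →ₐ[k] Module.End k (B ⊗[k] B)) : B →ₗ[k] B →ₗ[k] B :=
  (U.toLinearMap.compl₂ ((TensorProduct.mk k B B).flip 1)).compr₂ (legR k B B)

/-- The operation `l : a`. -/
noncomputable def repColon (U : B →ₐ[k] Module.End k (B ⊗[k] B)) : B →ₗ[k] B →ₗ[k] B :=
  ((U.toLinearMap.compl₂ ((TensorProduct.mk k B B).flip 1)).compr₂ (legL k B B)).flip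

variable {U : B →ₐ[k] Module.End k (B ⊗[k] B)}

theorem repDot_apply (a l : B) : repDot U a l = legR k B B (U a (l ⊗ₜ 1)) := rfl

theorem repColon_apply (l a : B) : repColon U l a = legL k B B (U a (l ⊗ₜ 1)) := rfl

variable {n m : Type} [Fintype n] [DecidableEq n] [Fintype m] [DecidableEq m]

namespace IsBraceRep

theorem comulL_matrix (h : IsBraceRep U) {u : n → n → B} {w : m → m → B} (hu : IsMult k 0 u)
    (hw : IsMult k 0 w) (a b : n) (c d : m) : comulL k B B (U (u a b) (w c d ⊗ₜ 1))
      = ∑ e, ∑ f, U (u a f) (w e d ⊗ₜ 1) ⊗ₜ[k] U (u f b) (w c e ⊗ₜ 1) := by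
  have e1 := comulL_tmul hw (isMult_one (k := k) (B := B)) c d () ()
  simp only [h.comulL_apply, e1, map_sum, diagRep_apply _ _ hu, Finset.univ_unique,
    Finset.sum_singleton]

theorem apply_matrix (h : IsBraceRep U) {u : n → n → B} {w : m → m → B} (hu : IsMult k 0 u)
    (hw : IsMult k 0 w) (a b : n) (c d : m) : U (u a b) (w c d ⊗ₜ 1)
      = ∑ e, ∑ f, repColon U (w e d) (u a f) ⊗ₜ[k] repDot U (u f b) (w c e) := by
  have := comulL_legL_legR (U (u a b) (w c d ⊗ₜ 1))
  rw [h.comulL_matrix hu hw] at this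
  rw [← this]
  simp only [map_sum, TensorProduct.map_tmul, repDot_apply, repColon_apply]

theorem apply_matrix' (h : IsBraceRep U) {u : n → n → B} {w : m → m → B} (hu : IsMult k 0 u)
    (hw : IsMult k 0 w) (a b : n) (c d : m) : U (u a b) (w c d ⊗ₜ 1)
      = ∑ e, ∑ f, repColon U (w c e) (u f b) ⊗ₜ[k] repDot U (u a f) (w e d) := by
  have := congrArg (TensorProduct.comm k B B) (comulL_legR_legL (U (u a b) (w c d ⊗ₜ 1)))
  rw [h.comulL_matrix hu hw] at this
  rw [TensorProduct.comm_comm] at this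
  rw [← this]
  simp only [map_sum, TensorProduct.map_tmul, TensorProduct.comm_tmul, repDot_apply,
    repColon_apply]

theorem counit_dot (h : IsBraceRep U) (a l : B) :
    counit (R := k) (repDot U a l) = counit (R := k) a * counit (R := k) l := by
  have : ∀ z : B ⊗[k] B, counit (R := k) (legR k B B z) = counit (R := k) z := by
    intro z
    induction z using TensorProduct.induction_on with
    | zero => simp
    | add x y hx hy => simp only [map_add, hx, hy]
    | tmul x y => simp [mul_comm]
  rw [repDot_apply, this, h.counit_apply]
  simp

theorem counit_colon (h : IsBraceRep U) (l a : B) :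
    counit (R := k) (repColon U l a) = counit (R := k) a * counit (R := k) l := by
  have : ∀ z : B ⊗[k] B, counit (R := k) (legL k B B z) = counit (R := k) z := by
    intro z
    induction z using TensorProduct.induction_on with
    | zero => simp
    | add x y hx hy => simp only [map_add, hx, hy]
    | tmul x y => simp [mul_comm]
  rw [repColon_apply, this, h.counit_apply]
  simp

theorem isMagma (h : IsBraceRep U) : IsMagma 0 0 (repDot U) (repColon U) := by
  refine ⟨?_, ?_, ?_⟩
  · intro n m _ _ _ _ u w hu hw
    refine ⟨fun p q => ?_, fun p q => ?_⟩
    · rw [levelComul_zero, repDot_apply, ← comulL_legR_legR, h.comulL_matrix hu hw,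
        Fintype.sum_prod_type, Finset.sum_comm]
      simp only [map_sum, TensorProduct.map_tmul]
      rfl
    · rw [h.counit_dot, hu.counit_apply, hw.counit_apply]
      simp only [Prod.ext_iff, ite_and, eq_comm (a := q.2)]
      split_ifs <;> simp
  · intro n m _ _ _ _ w u hw hu
    refine ⟨fun p q => ?_, fun p q => ?_⟩
    · have e1 := congrArg (TensorProduct.comm k B B)
        (comulL_legL_legL (U (u q.2 p.2) (w p.1 q.1 ⊗ₜ 1)))
      have e2 : ∀ x : B, TensorProduct.comm k B B (comulFlip k B x) = comul x := fun x => by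
        simp [comulFlip]
      rw [h.comulL_matrix hu hw, e2] at e1
      rw [levelComul_zero, repColon_apply, ← e1, Fintype.sum_prod_type]
      simp only [map_sum, TensorProduct.map_tmul, TensorProduct.comm_tmul]
      rfl
    · rw [h.counit_colon, hu.counit_apply, hw.counit_apply]
      simp only [Prod.ext_iff, ite_and, eq_comm (a := q.2)]
      split_ifs <;> simp
  · intro n m _ _ _ _ u w hu hw a b c d
    have := (h.apply_matrix' hu hw a b c d).symm.trans (h.apply_matrix hu hw a b c d)
    rw [Finset.sum_comm, this, Finset.sum_comm]

theorem dot_one (h : IsBraceRep U) (a : B) : repDot U a 1 = a := by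
  rw [repDot_apply, h.one_tmul]; simp

theorem colon_one (a : B) : repColon U a 1 = a := by
  rw [repColon_apply]; simp

theorem legL_apply (h : IsBraceRep U) (a : B) (z : B ⊗[k] B) :
    legL k B B (U a z) = repColon U (legL k B B z) a := by
  induction z using TensorProduct.induction_on with
  | zero => simp
  | add x y hx hy => simp only [map_add, LinearMap.add_apply, hx, hy]
  | tmul l c =>
    have e1 : ∀ z, legL k B B (rightMul k B c z) = counit (R := k) c • legL k B B z := by
      intro z
      induction z using TensorProduct.induction_on with
      | zero => simp
      | add x y hx hy => simp only [map_add, smul_add, hx, hy]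
      | tmul x y => simp [smul_smul, mul_comm]
    rw [h.rightLinear.apply_tmul, e1, legL_tmul, map_smul, LinearMap.smul_apply, repColon_apply]

theorem legR_rightMul (c : B) (z : B ⊗[k] B) : legR k B B (rightMul k B c z) = legR k B B z * c := by
  induction z using TensorProduct.induction_on with
  | zero => simp
  | add x y hx hy => simp only [map_add, add_mul, hx, hy]
  | tmul x y => simp

theorem legR_mulOp (x : B) (z : B ⊗[k] B) :
    legR k B B (mulOp k B B (x ⊗ₜ z)) = counit (R := k) x • legR k B B z := by
  induction z using TensorProduct.induction_on with
  | zero => simp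
  | add x y hx hy => simp only [map_add, TensorProduct.tmul_add, smul_add, hx, hy]
  | tmul y c => simp [smul_smul, mul_comm]

theorem legL_mulOp (x : B) (z : B ⊗[k] B) :
    legL k B B (mulOp k B B (x ⊗ₜ z)) = legL k B B z * x := by
  induction z using TensorProduct.induction_on with
  | zero => simp
  | add x y hx hy => simp only [map_add, TensorProduct.tmul_add, add_mul, hx, hy]
  | tmul y c => simp

theorem colon_mul (h : IsBraceRep U) (l a b : B) :
    repColon U l (a * b) = repColon U (repColon U l b) a := by
  rw [repColon_apply, map_mul, Module.End.mul_apply, h.legL_apply, ← repColon_apply]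

theorem dot_mul (h : IsBraceRep U) (x a b : B) :
    repDot U x (a * b) = repDot U (repDot U x b) a := by
  have e1 := h.mulOp_star x (b ⊗ₜ (a ⊗ₜ 1))
  have e2 : ∀ z, legR k B B (mulOp k B B (actTmul U B (a ⊗ₜ 1) z))
      = repDot U (legR k B B z) a := by
    intro z
    induction z using TensorProduct.induction_on with
    | zero => simp
    | add x y hx hy => simp only [map_add, LinearMap.add_apply, hx, hy]
    | tmul x y =>
      rw [actTmul_tmul, legR_mulOp, legR_tmul, map_smul, LinearMap.smul_apply, repDot_apply]
  rw [mulOp_tmul, star_tmul] at e1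
  rw [repDot_apply, ← e1, e2, ← repDot_apply]

/-- The product rule for `·` expresses that `U` is multiplicative in the acting element. -/
theorem mul_dot (h : IsBraceRep U) {u : n → n → B} {w : m → m → B} (hu : IsMult k 0 u)
    (hw : IsMult k 0 w) (x : B) (a b : n) (c d : m) : repDot U (x * u a b) (w c d)
      = ∑ e, ∑ f, repDot U x (repColon U (w c e) (u f b)) * repDot U (u a f) (w e d) := by
  rw [repDot_apply, map_mul, Module.End.mul_apply, h.apply_matrix' hu hw]
  have e1 : ∀ y c, legR k B B (U x (y ⊗ₜ c)) = repDot U x y * c := fun y c => by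
    rw [h.rightLinear.apply_tmul x y c, legR_rightMul, repDot_apply]
  simp only [map_sum, e1]

/-- The product rule for `:` expresses the compatibility of `U` with products in its argument. -/
theorem mul_colon (h : IsBraceRep U) {u : n → n → B} {w : m → m → B} (hu : IsMult k 0 u)
    (hw : IsMult k 0 w) (x : B) (a b : n) (c d : m) : repColon U (x * u a b) (w c d)
      = ∑ e, ∑ f, repColon U x (repDot U (w c e) (u f b)) * repColon U (u a f) (w e d) := by
  have e1 := h.mulOp_star (w c d) (u a b ⊗ₜ (x ⊗ₜ 1))
  rw [mulOp_tmul, star_tmul, h.apply_matrix' hw hu] at e1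
  rw [repColon_apply, ← e1]
  simp only [map_sum, actTmul_tmul, legL_mulOp]
  exact Finset.sum_comm

end IsBraceRep

end BraceRepresentations

/-- Each axiom states that a linear map is a morphism of representations of `H`, so that it is checked
on elements of `X` only. -/
theorem IsLevelSystem.isBraceRep_freeRep {k : Type u} [Field k] {X : Type v} [AddCommGroup X]
    [Module k X] [Coalgebra k X] {D K : ℤ → ℤ → X →ₗ[k] X →ₗ[k] X} (h : IsLevelSystem D K) :
    IsBraceRep h.freeRep :=
  ⟨h.isRightLinear_freeRep, h.freeRep_one_tmul, h.freeRep_mulOp, h.counit_freeRep,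
    h.comulL_freeRep⟩

end QBrace

namespace QBrace

/-! ### Cycle identities as intertwining relations -/

theorem sum_move_last {α ι₁ ι₂ ι₃ ι₄ ι₅ ι₆ M : Type*} [Fintype α] [Fintype ι₁]
    [Fintype ι₂] [Fintype ι₃] [Fintype ι₄] [Fintype ι₅] [Fintype ι₆] [AddCommMonoid M]
    (F : α → ι₁ → ι₂ → ι₃ → ι₄ → ι₅ → ι₆ → M) :
    ∑ a, ∑ i, ∑ j, ∑ l, ∑ p, ∑ q, ∑ r, F a i j l p q r
      = ∑ i, ∑ j, ∑ l, ∑ p, ∑ q, ∑ r, ∑ a, F a i j l p q r := by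
  simp only [← Fintype.sum_prod_type']
  exact Fintype.sum_equiv ⟨fun (a, i, j, l, p, q, r) => (i, j, l, p, q, r, a),
    fun (i, j, l, p, q, r, a) => (a, i, j, l, p, q, r), fun _ => rfl, fun _ => rfl⟩ _ _ fun _ => rfl

section CycleIdentities

variable {k : Type u} [Field k] {X : Type v} [AddCommGroup X] [Module k X] [Coalgebra k X]

/-- The identity `(x o₁ y₍₁₎) o₂ (z o₃ y₍₂₎) = (x o₄ z₍₂₎) o₅ (y o₆ z₍₁₎)` among six operations. -/
def IsCycleIdentity (o₁ o₂ o₃ o₄ o₅ o₆ : X →ₗ[k] X →ₗ[k] X) : Prop :=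
  ∀ ⦃n m : Type⦄ [Fintype n] [DecidableEq n] [Fintype m] [DecidableEq m] (w : n → n → X)
    (v : m → m → X), IsMult k 0 w → IsMult k 0 v → ∀ x a b c d,
      ∑ e, o₂ (o₁ x (w a e)) (o₃ (v c d) (w e b)) = ∑ f, o₅ (o₄ x (v f d)) (o₆ (w a b) (v c f))

/-- `x ⊗ z ↦ x₍₁₎ ⊗ (z o x₍₂₎)`. -/
noncomputable def splitFst (o : X →ₗ[k] X →ₗ[k] X) : X ⊗[k] X →ₗ[k] X ⊗[k] X :=
  (TensorProduct.lift o.flip).lTensor X ∘ₗ (TensorProduct.assoc k X X X).toLinearMap ∘ₗ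
    comul.rTensor X

/-- `x ⊗ z ↦ z₍₂₎ ⊗ (x o z₍₁₎)`. -/
noncomputable def splitSnd (o : X →ₗ[k] X →ₗ[k] X) : X ⊗[k] X →ₗ[k] X ⊗[k] X :=
  (TensorProduct.comm k X X).toLinearMap ∘ₗ (TensorProduct.lift o).rTensor X ∘ₗ
    (TensorProduct.assoc k X X X).symm.toLinearMap ∘ₗ comul.lTensor X

variable {n m : Type} [Fintype n] [DecidableEq n] [Fintype m] [DecidableEq m]

theorem splitFst_tmul (o : X →ₗ[k] X →ₗ[k] X) {w : n → n → X} (hw : IsMult k 0 w) (a b : n)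
    (z : X) : splitFst o (w a b ⊗ₜ z) = ∑ e, w a e ⊗ₜ[k] o z (w e b) := by
  simp [splitFst, hw.comul_zero, TensorProduct.sum_tmul]

theorem splitSnd_tmul (o : X →ₗ[k] X →ₗ[k] X) {w : n → n → X} (hw : IsMult k 0 w) (a b : n)
    (x : X) : splitSnd o (x ⊗ₜ w a b) = ∑ e, w e b ⊗ₜ[k] o x (w a e) := by
  simp [splitSnd, hw.comul_zero, TensorProduct.tmul_sum]

theorem splitFst_splitFst {o o' : X →ₗ[k] X →ₗ[k] X} (h : IsConvInv 0 o o') (z : X ⊗[k] X) :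
    splitFst o' (splitFst o z) = z := by
  suffices H : splitFst o' ∘ₗ splitFst o = LinearMap.id from LinearMap.congr_fun H z
  refine ext_isMult_tmul 0 fun r w hw a b z => ?_
  simp only [LinearMap.comp_apply, splitFst_tmul _ hw, map_sum, LinearMap.id_apply]
  rw [Finset.sum_comm]
  simp only [← TensorProduct.tmul_sum, h w hw]
  simp [TensorProduct.tmul_ite]

/-- Extension of an operator on `X ⊗ X` to `X ⊗ (X ⊗ B)`. -/
noncomputable def onTwo (B : Type*) [AddCommGroup B] [Module k B] (f : X ⊗[k] X →ₗ[k] X ⊗[k] X) :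
    X ⊗[k] (X ⊗[k] B) →ₗ[k] X ⊗[k] (X ⊗[k] B) :=
  (TensorProduct.assoc k X X B).toLinearMap ∘ₗ f.rTensor B ∘ₗ
    (TensorProduct.assoc k X X B).symm.toLinearMap

theorem onTwo_tmul {B : Type*} [AddCommGroup B] [Module k B] (f : X ⊗[k] X →ₗ[k] X ⊗[k] X)
    (x z : X) (t : B) : onTwo B f (x ⊗ₜ (z ⊗ₜ t))
      = TensorProduct.assoc k X X B (f (x ⊗ₜ z) ⊗ₜ t) := rfl

theorem onTwo_onTwo {B : Type*} [AddCommGroup B] [Module k B] (f g : X ⊗[k] X →ₗ[k] X ⊗[k] X)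
    (z : X ⊗[k] (X ⊗[k] B)) : onTwo B f (onTwo B g z) = onTwo B (f ∘ₗ g) z := by
  simp [onTwo, LinearMap.rTensor_comp]

open FreeHopf

variable {A A' B B' : FreeHopf k X →ₐ[k] Module.End k (X ⊗[k] FreeHopf k X)}
variable {a at' a' at2 b bt b' bt2 o o' : X →ₗ[k] X →ₗ[k] X}

/-- Both sides of `star_eq_of_cycleIdentities` are brought, for an acting element of `X`, to a form
in which only operations on `X` occur. -/
theorem star_splitFst (hA : IsRightLinear A)
    (eA : ∀ x, A (gen k 0 x) = rext k _ X X (twist 0 0 a at' x))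
    (eB : ∀ x, B (gen k 0 x) = rext k _ X X (twist 0 0 b bt x))
    (mA : IsMagma 0 0 a at') (mo : IsMultOp 0 0 o)
    (r1 : IsCycleIdentity a' o a o b at')
    {l : Type} [Fintype l] [DecidableEq l] {h : n → n → X} {x : m → m → X} {z : l → l → X}
    (hh : IsMult k 0 h) (hx : IsMult k 0 x) (hz : IsMult k 0 z) (c d : n) (p q : m) (r s : l)
    (t : FreeHopf k X) :
    star A hA B (gen k 0 (h c d)) (onTwo _ (splitFst o) (x p q ⊗ₜ (z r s ⊗ₜ t)))
      = onTwo _ (splitFst o) (∑ r', ∑ q', ∑ c', ∑ f, ∑ g, a (x f q') (h c' g) ⊗ₜ[k]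
          (a' (z r' s) (h c c') ⊗ₜ[k]
            (gen k 0 (bt (at' (h g d) (x p f)) (o (z r r') (x q' q))) * t))) := by
  have hN := mA.multColon h x hh hx
  have hM := mo z x hz hx
  have hN2 := mA.multDot x h hx hh
  have e1 := fun e g f => twist_apply b bt hN hM (c, e) (g, f) (r, q) (s, e)
  have e2 := fun f q' c' g => splitFst_tmul o hN2 (f, g) (q', c')
  simp only [Fintype.sum_prod_type] at e1 e2
  simp only [map_sum, onTwo_tmul, splitFst_tmul _ hx, e2, TensorProduct.sum_tmul,
    TensorProduct.assoc_tmul, star_tmul, eA, eB, mul_one, twist_apply' mA.exchange hh hx,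
    actTmul_tmul, rext_tmul, e1, rightMul_tmul, TensorProduct.tmul_sum]
  -- the first leg, the argument of `o`, and the last leg of a summand
  let Φ : m → n → l → m → n → m → X →ₗ[k] X ⊗[k] (X ⊗[k] FreeHopf k X) := fun f g r' q' g' f' =>
    TensorProduct.mk k X _ (a (x p f) (h g d)) ∘ₗ (TensorProduct.mk k X _).flip
      (gen k 0 (bt (at' (h g' g) (x f f')) (o (z r r') (x q' q))) * t)
  let Ψ : l → m → n → m → n → X ⊗[k] X →ₗ[k] X ⊗[k] (X ⊗[k] FreeHopf k X) :=
    fun r' q' g' f' c' => (TensorProduct.mk k X _ (o (a' (z r' s) (h c c')) (a (x f' q') (h c' g'))) ∘ₗ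
        LinearMap.mulRight k t ∘ₗ gen k 0 ∘ₗ bt.flip (o (z r r') (x q' q))).lTensor X ∘ₗ
      (TensorProduct.comm k X X).toLinearMap
  have hΨ : ∀ r' q' g' f' c' y y', Ψ r' q' g' f' c' (y ⊗ₜ y') = y' ⊗ₜ[k]
      (o (a' (z r' s) (h c c')) (a (x f' q') (h c' g')) ⊗ₜ[k]
        (gen k 0 (bt y (o (z r r') (x q' q))) * t)) := fun _ _ _ _ _ _ _ => rfl
  calc _ = ∑ f, ∑ g, ∑ r', ∑ q', ∑ g', ∑ f', Φ f g r' q' g' f'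
            (∑ e, b (o (z r' s) (x e q')) (at' (h c g') (x f' e))) := by
        simp only [map_sum]
        exact sum_move_last _
    _ = ∑ f, ∑ g, ∑ r', ∑ q', ∑ g', ∑ f', Φ f g r' q' g' f'
            (∑ c', o (a' (z r' s) (h c c')) (a (x f' q') (h c' g'))) := by
        simp only [fun r' q' g' f' => r1 h x hh hx (z r' s) c g' f' q']
    _ = ∑ r', ∑ q', ∑ g', ∑ f', ∑ c', Ψ r' q' g' f' c'
            (∑ f, ∑ g, at' (h g' g) (x f f') ⊗ₜ[k] a (x p f) (h g d)) := by
        simp only [map_sum, hΨ]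
        exact sum_rotate_two_five _
    _ = ∑ r', ∑ q', ∑ g', ∑ f', ∑ c', Ψ r' q' g' f' c'
            (∑ f, ∑ g, at' (h g d) (x p f) ⊗ₜ[k] a (x f f') (h g' g)) := by
        simp only [fun g' f' => mA.exchange x h hx hh p f' g' d]
    _ = _ := by
        simp only [map_sum, hΨ, ← Fintype.sum_prod_type']
        exact Fintype.sum_equiv ⟨fun (r', q', g', f', c', f, g) => (r', q', c', f, g, f', g'),
          fun (r', q', c', f, g, f', g') => (r', q', g', f', c', f, g), fun _ => rfl,
          fun _ => rfl⟩ _ _ fun ⟨_, _, _, _, _, _, _⟩ => rfl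

theorem star_splitSnd (hA : IsRightLinear A')
    (eA : ∀ x, A' (gen k 0 x) = rext k _ X X (twist 0 0 a' at2 x))
    (eB : ∀ x, B' (gen k 0 x) = rext k _ X X (twist 0 0 b' bt2 x))
    (mA : IsMagma 0 0 a' at2) (mB : IsMagma 0 0 b' bt2) (mo : IsMultOp 0 0 o')
    (r2 : IsCycleIdentity o' b' at2 a o' a')
    {l : Type} [Fintype l] [DecidableEq l] {h : n → n → X} {x : m → m → X} {z : l → l → X}
    (hh : IsMult k 0 h) (hx : IsMult k 0 x) (hz : IsMult k 0 z) (c d : n) (p q : m) (r s : l)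
    (t : FreeHopf k X) :
    star A' hA B' (gen k 0 (h c d)) (onTwo _ (splitSnd o') (x p q ⊗ₜ (z r s ⊗ₜ t)))
      = onTwo _ (splitSnd o') (∑ p', ∑ d', ∑ f, ∑ g, ∑ e', a (x p p') (h d' d) ⊗ₜ[k]
          (a' (z e' f) (h g d') ⊗ₜ[k]
            (gen k 0 (bt2 (at2 (h c g) (z f s)) (o' (x p' q) (z r e'))) * t))) := by
  have hN := mA.multColon h z hh hz
  have hM := mo x z hx hz
  have hN3 := mA.multDot z h hz hh
  have e1 := fun e g f => twist_apply' mB.exchange hN hM (g, f) (d, e) (p, e) (q, r)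
  have e2 := fun f g e' d' => splitSnd_tmul o' hN3 (e', d') (f, g)
  simp only [Fintype.sum_prod_type] at e1 e2
  simp only [map_sum, onTwo_tmul, splitSnd_tmul _ hz, e2, TensorProduct.sum_tmul,
    TensorProduct.assoc_tmul, star_tmul, eA, eB, mul_one, twist_apply _ _ hh hz,
    actTmul_tmul, rext_tmul, e1, rightMul_tmul, TensorProduct.tmul_sum]
  -- the first leg, the argument of `o'`, and the last leg of a summand
  let Φ : l → n → m → l → n → l → X →ₗ[k] X ⊗[k] (X ⊗[k] FreeHopf k X) := fun f g p' e' g' f' =>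
    TensorProduct.mk k X _ (a' (z f s) (h c g)) ∘ₗ (TensorProduct.mk k X _).flip
      (gen k 0 (bt2 (at2 (h g g') (z f' f)) (o' (x p' q) (z r e'))) * t)
  let Ψ : m → l → n → l → n → X ⊗[k] X →ₗ[k] X ⊗[k] (X ⊗[k] FreeHopf k X) :=
    fun p' e' g' f' d' => (TensorProduct.mk k X _
          (o' (a (x p p') (h d' d)) (a' (z e' f') (h g' d'))) ∘ₗ
        LinearMap.mulRight k t ∘ₗ gen k 0 ∘ₗ bt2.flip (o' (x p' q) (z r e'))).lTensor X ∘ₗ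
      (TensorProduct.comm k X X).toLinearMap
  have hΨ : ∀ p' e' g' f' d' y y', Ψ p' e' g' f' d' (y ⊗ₜ y') = y' ⊗ₜ[k]
      (o' (a (x p p') (h d' d)) (a' (z e' f') (h g' d')) ⊗ₜ[k]
        (gen k 0 (bt2 y (o' (x p' q) (z r e'))) * t)) := fun _ _ _ _ _ _ _ => rfl
  calc _ = ∑ f, ∑ g, ∑ p', ∑ e', ∑ g', ∑ f', Φ f g p' e' g' f'
            (∑ e, b' (o' (x p p') (z e' e)) (at2 (h g' d) (z e f'))) := by
        simp only [map_sum]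
        exact sum_move_last _
    _ = ∑ f, ∑ g, ∑ p', ∑ e', ∑ g', ∑ f', Φ f g p' e' g' f'
            (∑ d', o' (a (x p p') (h d' d)) (a' (z e' f') (h g' d'))) := by
        simp only [fun p' e' g' f' => r2 z h hz hh (x p p') e' f' g' d]
    _ = ∑ p', ∑ e', ∑ g', ∑ f', ∑ d', Ψ p' e' g' f' d'
            (∑ f, ∑ g, at2 (h g g') (z f' f) ⊗ₜ[k] a' (z f s) (h c g)) := by
        simp only [map_sum, hΨ]
        exact sum_rotate_two_five _
    _ = ∑ p', ∑ e', ∑ g', ∑ f', ∑ d', Ψ p' e' g' f' d'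
            (∑ f, ∑ g, at2 (h c g) (z f s) ⊗ₜ[k] a' (z f' f) (h g g')) := by
        simp only [fun g' f' => mA.exchange z h hz hh f' s c g']
    _ = _ := by
        simp only [map_sum, hΨ, ← Fintype.sum_prod_type']
        exact Fintype.sum_equiv ⟨fun (p', e', g', f', d', f, g) => (p', d', f, g, e', f', g'),
          fun (p', d', f, g, e', f', g') => (p', e', g', f', d', f, g), fun _ => rfl,
          fun _ => rfl⟩ _ _ fun ⟨_, _, _, _, _, _, _⟩ => rfl

theorem cycle_sum_eq (mA : IsMagma 0 0 a at') (mA' : IsMagma 0 0 a' at2)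
    (r3 : IsCycleIdentity at' bt o at2 bt2 o')
    {l : Type} [Fintype l] [DecidableEq l] {h : n → n → X} {x : m → m → X} {z : l → l → X}
    (hh : IsMult k 0 h) (hx : IsMult k 0 x) (hz : IsMult k 0 z) (c d : n) (p q : m) (r s : l)
    (t : FreeHopf k X) :
    ∑ r', ∑ q', ∑ c', ∑ f, ∑ g, a (x f q') (h c' g) ⊗ₜ[k] (a' (z r' s) (h c c') ⊗ₜ[k]
        (gen k 0 (bt (at' (h g d) (x p f)) (o (z r r') (x q' q))) * t))
      = ∑ p', ∑ d', ∑ f, ∑ g, ∑ e', a (x p p') (h d' d) ⊗ₜ[k] (a' (z e' f) (h g d') ⊗ₜ[k]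
          (gen k 0 (bt2 (at2 (h c g) (z f s)) (o' (x p' q) (z r e'))) * t)) := by
  let Ψ : l → m → n → X ⊗[k] X →ₗ[k] X ⊗[k] (X ⊗[k] FreeHopf k X) :=
    fun r' q' c' => (TensorProduct.mk k X _ (a' (z r' s) (h c c')) ∘ₗ
        LinearMap.mulRight k t ∘ₗ gen k 0 ∘ₗ bt.flip (o (z r r') (x q' q))).lTensor X ∘ₗ
      (TensorProduct.comm k X X).toLinearMap
  have hΨ : ∀ r' q' c' y y', Ψ r' q' c' (y ⊗ₜ y') = y' ⊗ₜ[k] (a' (z r' s) (h c c') ⊗ₜ[k]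
        (gen k 0 (bt y (o (z r r') (x q' q))) * t)) := fun _ _ _ _ _ => rfl
  let Φ : l → n → m → n → X →ₗ[k] X ⊗[k] (X ⊗[k] FreeHopf k X) := fun r' c' f g =>
    TensorProduct.mk k X _ (a (x p f) (h g d)) ∘ₗ TensorProduct.mk k X _ (a' (z r' s) (h c c')) ∘ₗ
      LinearMap.mulRight k t ∘ₗ gen k 0
  have hΦ : ∀ r' c' f g y, Φ r' c' f g y = a (x p f) (h g d) ⊗ₜ[k] (a' (z r' s) (h c c') ⊗ₜ[k]
        (gen k 0 y * t)) := fun _ _ _ _ _ => rfl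
  let Ω : m → n → l → X ⊗[k] X →ₗ[k] X ⊗[k] (X ⊗[k] FreeHopf k X) := fun f g y =>
    TensorProduct.mk k X _ (a (x p f) (h g d)) ∘ₗ
      (LinearMap.mulRight k t ∘ₗ gen k 0 ∘ₗ bt2.flip (o' (x f q) (z r y))).lTensor X ∘ₗ
      (TensorProduct.comm k X X).toLinearMap
  have hΩ : ∀ f g y v v', Ω f g y (v ⊗ₜ v') = a (x p f) (h g d) ⊗ₜ[k] (v' ⊗ₜ[k]
        (gen k 0 (bt2 v (o' (x f q) (z r y))) * t)) := fun _ _ _ _ _ => rfl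
  calc _ = ∑ r', ∑ q', ∑ c', Ψ r' q' c'
            (∑ f, ∑ g, at' (h g d) (x p f) ⊗ₜ[k] a (x f q') (h c' g)) := by
        simp only [map_sum, hΨ]
    _ = ∑ r', ∑ q', ∑ c', Ψ r' q' c'
            (∑ f, ∑ g, at' (h c' g) (x f q') ⊗ₜ[k] a (x p f) (h g d)) := by
        simp only [fun q' c' => mA.exchange x h hx hh p q' c' d]
    _ = ∑ r', ∑ c', ∑ f, ∑ g, Φ r' c' f g (∑ q', bt (at' (h c' g) (x f q')) (o (z r r') (x q' q))) := by
        simp only [map_sum]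
        simp only [hΨ, hΦ, ← Fintype.sum_prod_type']
        exact Fintype.sum_equiv ⟨fun (r', q', c', f, g) => (r', c', f, g, q'),
          fun (r', c', f, g, q') => (r', q', c', f, g), fun _ => rfl,
          fun _ => rfl⟩ _ _ fun ⟨_, _, _, _, _⟩ => rfl
    _ = ∑ r', ∑ c', ∑ f, ∑ g, Φ r' c' f g (∑ y, bt2 (at2 (h c' g) (z y r')) (o' (x f q) (z r y))) := by
        simp only [fun r' c' f g => r3 x z hx hz (h c' g) f q r r']
    _ = ∑ f, ∑ g, ∑ y, Ω f g y (∑ r', ∑ c', at2 (h c' g) (z y r') ⊗ₜ[k] a' (z r' s) (h c c')) := by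
        simp only [map_sum]
        simp only [hΦ, hΩ, ← Fintype.sum_prod_type']
        exact Fintype.sum_equiv ⟨fun (r', c', f, g, y) => (f, g, y, r', c'),
          fun (f, g, y, r', c') => (r', c', f, g, y), fun _ => rfl,
          fun _ => rfl⟩ _ _ fun ⟨_, _, _, _, _⟩ => rfl
    _ = ∑ f, ∑ g, ∑ y, Ω f g y (∑ r', ∑ c', at2 (h c c') (z r' s) ⊗ₜ[k] a' (z y r') (h c' g)) := by
        simp only [fun g y => mA'.exchange z h hz hh y s c g]
    _ = _ := by
        simp only [map_sum, hΩ, ← Fintype.sum_prod_type']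
        exact Fintype.sum_equiv ⟨fun (f, g, y, r', c') => (f, g, r', c', y),
          fun (f, g, r', c', y) => (f, g, y, r', c'), fun _ => rfl,
          fun _ => rfl⟩ _ _ fun ⟨_, _, _, _, _⟩ => rfl

/-- The identities among `a`, `o`, … on `X` extend to actions of the elements of `H`: both sides of
an identity, applied to an element of `H`, are read off from the two sides of this equation. -/
theorem star_eq_of_cycleIdentities {o₁ : X →ₗ[k] X →ₗ[k] X} (hA : IsRightLinear A)
    (hA' : IsRightLinear A')
    (eA : ∀ x, A (gen k 0 x) = rext k _ X X (twist 0 0 a at' x))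
    (eB : ∀ x, B (gen k 0 x) = rext k _ X X (twist 0 0 b bt x))
    (eA' : ∀ x, A' (gen k 0 x) = rext k _ X X (twist 0 0 a' at2 x))
    (eB' : ∀ x, B' (gen k 0 x) = rext k _ X X (twist 0 0 b' bt2 x))
    (mA : IsMagma 0 0 a at') (mA' : IsMagma 0 0 a' at2) (mB' : IsMagma 0 0 b' bt2)
    (mo : IsMultOp 0 0 o) (mo' : IsMultOp 0 0 o')
    (h1 : IsConvInv 0 o o₁) (h2 : IsConvInv 0 o₁ o)
    (r1 : IsCycleIdentity a' o a o b at') (r2 : IsCycleIdentity o' b' at2 a o' a')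
    (r3 : IsCycleIdentity at' bt o at2 bt2 o') (h : FreeHopf k X)
    (ζ : X ⊗[k] (X ⊗[k] FreeHopf k X)) :
    onTwo _ (splitSnd o' ∘ₗ splitFst o₁) (star A hA B h (onTwo _ (splitFst o) ζ))
      = star A' hA' B' h (onTwo _ (splitSnd o') ζ) := by
  have i1 : splitFst o₁ ∘ₗ splitFst o = LinearMap.id := LinearMap.ext (splitFst_splitFst h1)
  have i2 : splitFst o ∘ₗ splitFst o₁ = LinearMap.id := LinearMap.ext (splitFst_splitFst h2)
  have key : ∀ h (ζ : X ⊗[k] (X ⊗[k] FreeHopf k X)),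
      onTwo _ (splitSnd o' ∘ₗ splitFst o₁) (star A hA B h ζ)
        = star A' hA' B' h (onTwo _ (splitSnd o' ∘ₗ splitFst o₁) ζ) := by
    refine intertwines_isMult fun n u hu c d => ?_
    have H : onTwo _ (splitSnd o' ∘ₗ splitFst o₁) ∘ₗ star A hA B (gen k 0 (u c d)) ∘ₗ
        onTwo _ (splitFst o) = star A' hA' B' (gen k 0 (u c d)) ∘ₗ onTwo _ (splitSnd o') := by
      refine TensorProduct.ext (ext_isMult 0 fun r' x hx p q => ?_)
      refine ext_isMult_tmul 0 fun r'' z hz r s t => ?_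
      have e1 := star_splitFst hA eA eB mA mo r1 hu hx hz c d p q r s t
      have e2 := star_splitSnd hA' eA' eB' mA' mB' mo' r2 hu hx hz c d p q r s t
      have e3 := cycle_sum_eq mA mA' r3 hu hx hz c d p q r s t
      change onTwo _ _ (star A hA B _ (onTwo _ _ _)) = star A' hA' B' _ (onTwo _ _ _)
      rw [TensorProduct.mk_apply, e1, e2, e3, onTwo_onTwo, LinearMap.comp_assoc, i1, LinearMap.comp_id]
    refine LinearMap.ext fun y => ?_
    have e := LinearMap.congr_fun H (onTwo _ (splitFst o₁) y)
    simp only [LinearMap.comp_apply, onTwo_onTwo, i2] at e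
    have i3 : onTwo (FreeHopf k X) LinearMap.id y = y := by simp [onTwo]
    rw [i3] at e
    exact e
  rw [key, onTwo_onTwo, LinearMap.comp_assoc, i1, LinearMap.comp_id]

end CycleIdentities

end QBrace

namespace QBrace

/-! ### Cycle identities with two arguments in `X` -/

section BraceRepresentations

variable {k : Type u} [Field k] {B : Type*} [Ring B] [Bialgebra k B]
  {U : B →ₐ[k] Module.End k (B ⊗[k] B)}

/-- The representation `l ↦ (a ↦ a · l)`. -/
noncomputable def IsBraceRep.dotRep (h : IsBraceRep U) : B →ₐ[k] Module.End k B :=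
  AlgHom.ofLinearMap (repDot U).flip (LinearMap.ext fun a => h.dot_one a)
    fun a b => LinearMap.ext fun x => h.dot_mul x a b

theorem IsBraceRep.dotRep_apply (h : IsBraceRep U) (l a : B) : h.dotRep l a = repDot U a l := rfl

/-- The representation `l ↦ (a ↦ a : l)`. -/
noncomputable def IsBraceRep.colonRep (h : IsBraceRep U) : B →ₐ[k] Module.End k B :=
  AlgHom.ofLinearMap (repColon U).flip (LinearMap.ext fun a => IsBraceRep.colon_one (U := U) a)
    fun a b => LinearMap.ext fun x => by
      rw [Module.End.mul_apply, LinearMap.flip_apply, LinearMap.flip_apply, LinearMap.flip_apply]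
      exact h.colon_mul x a b

theorem IsBraceRep.colonRep_apply (h : IsBraceRep U) (l a : B) :
    h.colonRep l a = repColon U a l := rfl

theorem legR_actTmul {M N : Type*} [AddCommGroup M] [Module k M] [Coalgebra k M] [AddCommGroup N]
    [Module k N] (Ψ : B →ₐ[k] Module.End k N) (n : N) (z : M ⊗[k] B) :
    legR k M N (actTmul Ψ M n z) = Ψ (legR k M B z) n := by
  induction z using TensorProduct.induction_on with
  | zero => simp
  | add x y hx hy => simp only [map_add, LinearMap.add_apply, hx, hy]
  | tmul x y => simp

end BraceRepresentations

section Restriction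

variable {k : Type u} [Field k] {X : Type v} [AddCommGroup X] [Module k X] [Coalgebra k X]
variable {D K : ℤ → ℤ → X →ₗ[k] X →ₗ[k] X}

open FreeHopf

/-- On `X ⊗ H ⊆ H ⊗ H` the representation `freeRep` restricts to `twistRep`, with the two operations
exchanged. -/
theorem IsLevelSystem.freeRep_gen (h : IsLevelSystem D K) (a : FreeHopf k X)
    (z : X ⊗[k] FreeHopf k X) : h.freeRep a ((gen k 0).rTensor _ z)
      = (gen k 0).rTensor _ (h.symm.twistRep 0 a z) := by
  refine (intertwines_isMult (Θ := h.symm.twistRep 0) (Θ' := h.freeRep) (F := (gen k 0).rTensor _)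
    (fun n w hw a b => ext_isMult_tmul 0 fun r u hu p q c => ?_) a z).symm
  simp only [LinearMap.comp_apply, LinearMap.rTensor_tmul, h.freeRep_gen_tmul,
    h.twistRep_gen_tmul_one, h.symm.twistRep_gen, rext_tmul, twist_apply _ _ hu hw,
    twist_apply _ _ hw hu, map_sum, rightMul_tmul, swapGen_tmul]
  exact Finset.sum_comm

theorem IsLevelSystem.legL_twistRep (h : IsLevelSystem D K) (l : FreeHopf k X)
    (z : X ⊗[k] FreeHopf k X) : legL k _ _ (h.twistRep 0 l z) = h.dotRep 0 l (legL k _ _ z) := by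
  refine intertwines_isMult
    (fun n u hu p q => ext_isMult_tmul 0 fun r w hw a b c => ?_) l z
  simp only [LinearMap.comp_apply, h.twistRep_gen, h.dotRep_gen, rext_tmul, twist_apply _ _ hu hw,
    map_sum, rightMul_tmul, legL_tmul, Bialgebra.counit_mul, counit_gen, h.symm.counit_dot,
    hu.counit_apply, hw.counit_apply, map_smul, LinearMap.flip_apply]
  simp

theorem IsLevelSystem.dot_gen_right (h : IsLevelSystem D K) (a : FreeHopf k X) (y : X) :
    repDot h.freeRep a (gen k 0 y) = legR k _ _ (h.symm.twistRep 0 a (y ⊗ₜ 1)) := by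
  have e1 : ∀ z : X ⊗[k] FreeHopf k X, legR k _ _ ((gen k 0).rTensor (FreeHopf k X) z)
      = legR k _ _ z := by
    intro z
    induction z using TensorProduct.induction_on with
    | zero => simp
    | add x y hx hy => simp only [map_add, hx, hy]
    | tmul x y => simp [counit_gen]
  rw [repDot_apply, ← e1, ← h.freeRep_gen, LinearMap.rTensor_tmul]

theorem IsLevelSystem.colon_gen_right (h : IsLevelSystem D K) (l : FreeHopf k X) (y : X) :
    repColon h.freeRep l (gen k 0 y) = legR k _ _ (h.twistRep 0 l (y ⊗ₜ 1)) := by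
  have e1 : ∀ z : X ⊗[k] FreeHopf k X, legL k _ _ (swapGen k X 0 z) = legR k _ _ z := by
    intro z
    induction z using TensorProduct.induction_on with
    | zero => simp
    | add x y hx hy => simp only [map_add, hx, hy]
    | tmul x y => simp [counit_gen]
  rw [repColon_apply, h.freeRep_gen_tmul, rightMul_one, e1]

theorem IsLevelSystem.dot_gen_left (h : IsLevelSystem D K) (y : X) (l : FreeHopf k X) :
    repDot h.freeRep (gen k 0 y) l = gen k 0 (h.dotRep 0 l y) := by
  have e1 : ∀ z : X ⊗[k] FreeHopf k X, legR k _ _ (swapGen k X 0 z) = gen k 0 (legL k _ _ z) := by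
    intro z
    induction z using TensorProduct.induction_on with
    | zero => simp
    | add x y hx hy => simp only [map_add, hx, hy]
    | tmul x y => simp
  rw [repDot_apply, h.freeRep_gen_tmul, rightMul_one, e1, h.legL_twistRep]
  simp

theorem IsLevelSystem.dot_gen_gen (h : IsLevelSystem D K) (x y : X) :
    repDot h.freeRep (gen k 0 x) (gen k 0 y) = gen k 0 (D 0 0 x y) := by
  rw [h.dot_gen_left, h.dotRep_gen]; rfl

theorem IsLevelSystem.colon_gen_gen (h : IsLevelSystem D K) (x y : X) :
    repColon h.freeRep (gen k 0 x) (gen k 0 y) = gen k 0 (K 0 0 x y) := by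
  suffices H : (repColon h.freeRep).compl₁₂ (gen k 0) (gen k 0) = (K 0 0).compr₂ (gen k 0) from
    LinearMap.congr_fun₂ H x y
  refine ext_isMult₂ 0 0 fun r s u w hu hw p q a b => ?_
  simp only [LinearMap.compl₁₂_apply, LinearMap.compr₂_apply, h.colon_gen_right,
    h.twistRep_gen_tmul_one, twist_apply _ _ hu hw, map_sum, legR_tmul, h.counit_dot,
    hu.counit_apply, hw.counit_apply]
  simp

end Restriction

section CycleBase

variable {k : Type u} [Field k] {X : Type v} [AddCommGroup X] [Module k X] [Coalgebra k X]
variable {D K : ℤ → ℤ → X →ₗ[k] X →ₗ[k] X}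

open FreeHopf

theorem legR_star {A B : FreeHopf k X →ₐ[k] Module.End k (X ⊗[k] FreeHopf k X)}
    (hA : IsRightLinear A) (h : FreeHopf k X) (x z : X) :
    legR k _ _ (legR k _ _ (star A hA B h (x ⊗ₜ (z ⊗ₜ 1))))
      = legR k _ _ (B (legR k _ _ (A h (x ⊗ₜ 1))) (z ⊗ₜ 1)) := by
  rw [star_tmul, legR_actTmul]

theorem counit_splitFst {o : X →ₗ[k] X →ₗ[k] X}
    (ho : ∀ x y, counit (R := k) (o x y) = counit (R := k) x * counit (R := k) y) :
    counit (R := k) ∘ₗ splitFst o = counit (R := k) := by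
  refine ext_isMult_tmul 0 fun r w hw a b z => ?_
  simp [splitFst_tmul _ hw, ho, hw.counit_apply]

theorem counit_splitSnd {o : X →ₗ[k] X →ₗ[k] X}
    (ho : ∀ x y, counit (R := k) (o x y) = counit (R := k) x * counit (R := k) y) :
    counit (R := k) ∘ₗ splitSnd o = counit (R := k) := by
  refine TensorProduct.ext (ext_isMult₂ 0 0 fun r s u w hu hw p q a b => ?_)
  simp [splitSnd_tmul _ hw, ho, hw.counit_apply]

theorem legR_onTwo {o o' : X →ₗ[k] X →ₗ[k] X}
    (ho : ∀ x y, counit (R := k) (o x y) = counit (R := k) x * counit (R := k) y)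
    (ho' : ∀ x y, counit (R := k) (o' x y) = counit (R := k) x * counit (R := k) y)
    (z : X ⊗[k] (X ⊗[k] FreeHopf k X)) :
    legR k _ _ (legR k _ _ (onTwo _ (splitSnd o ∘ₗ splitFst o') z))
      = legR k X (FreeHopf k X) (legR k _ _ z) := by
  suffices H : legR k X (FreeHopf k X) ∘ₗ legR k X (X ⊗[k] FreeHopf k X) ∘ₗ
      onTwo _ (splitSnd o ∘ₗ splitFst o')
        = legR k X (FreeHopf k X) ∘ₗ legR k X (X ⊗[k] FreeHopf k X) from LinearMap.congr_fun H z
  have e1 : ∀ (f : X ⊗[k] X →ₗ[k] X ⊗[k] X), counit (R := k) ∘ₗ f = counit (R := k) →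
      legR k X (FreeHopf k X) ∘ₗ legR k X (X ⊗[k] FreeHopf k X) ∘ₗ onTwo _ f
        = legR k X (FreeHopf k X) ∘ₗ legR k X (X ⊗[k] FreeHopf k X) := by
    intro f hf
    refine TensorProduct.ext (LinearMap.ext fun x => TensorProduct.ext' fun z t => ?_)
    have e2 : ∀ y : X ⊗[k] X, legR k X (FreeHopf k X) (legR k X (X ⊗[k] FreeHopf k X)
        (TensorProduct.assoc k X X _ (y ⊗ₜ t))) = counit (R := k) y • t := by
      intro y
      induction y using TensorProduct.induction_on with
      | zero => simp
      | add x y hx hy => simp only [map_add, TensorProduct.add_tmul, add_smul, hx, hy]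
      | tmul x y => simp [smul_smul, mul_comm]
    have e3 := e2 (f (x ⊗ₜ z))
    rw [show counit (R := k) (f (x ⊗ₜ z)) = counit (R := k) (x ⊗ₜ[k] z) from
      LinearMap.congr_fun hf _, ← e2] at e3
    exact e3
  refine e1 _ ?_
  rw [← LinearMap.comp_assoc, counit_splitSnd ho, counit_splitFst ho']

/-- `star_eq_of_cycleIdentities` after the counits have been applied to both factors `X`. -/
theorem legR_star_eq {A A' B B' : FreeHopf k X →ₐ[k] Module.End k (X ⊗[k] FreeHopf k X)}
    {a at' a' at2 b bt b' bt2 o o' o₁ : X →ₗ[k] X →ₗ[k] X} (hA : IsRightLinear A)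
    (hA' : IsRightLinear A')
    (eA : ∀ x, A (gen k 0 x) = rext k _ X X (twist 0 0 a at' x))
    (eB : ∀ x, B (gen k 0 x) = rext k _ X X (twist 0 0 b bt x))
    (eA' : ∀ x, A' (gen k 0 x) = rext k _ X X (twist 0 0 a' at2 x))
    (eB' : ∀ x, B' (gen k 0 x) = rext k _ X X (twist 0 0 b' bt2 x))
    (mA : IsMagma 0 0 a at') (mA' : IsMagma 0 0 a' at2) (mB' : IsMagma 0 0 b' bt2)
    (mo : IsMultOp 0 0 o) (mo' : IsMultOp 0 0 o')
    (ho : ∀ x y, counit (R := k) (o₁ x y) = counit (R := k) x * counit (R := k) y)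
    (h1 : IsConvInv 0 o o₁) (h2 : IsConvInv 0 o₁ o)
    (r1 : IsCycleIdentity a' o a o b at') (r2 : IsCycleIdentity o' b' at2 a o' a')
    (r3 : IsCycleIdentity at' bt o at2 bt2 o') (h : FreeHopf k X)
    {n m : Type} [Fintype n] [DecidableEq n] [Fintype m] [DecidableEq m] {x : n → n → X}
    {z : m → m → X} (hx : IsMult k 0 x) (hz : IsMult k 0 z) (p q : n) (r s : m) :
    ∑ e, legR k _ _ (B (legR k _ _ (A h (x p e ⊗ₜ 1))) (o (z r s) (x e q) ⊗ₜ 1))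
      = ∑ e, legR k _ _ (B' (legR k _ _ (A' h (z e s ⊗ₜ 1))) (o' (x p q) (z r e) ⊗ₜ 1)) := by
  have e1 := congrArg (fun ζ => legR k X (FreeHopf k X) (legR k _ _ ζ))
    (star_eq_of_cycleIdentities hA hA' eA eB eA' eB' mA mA' mB' mo mo' h1 h2 r1 r2 r3 h
      (x p q ⊗ₜ (z r s ⊗ₜ 1)))
  simp only [legR_onTwo mo'.counit_apply ho, onTwo_tmul, splitFst_tmul _ hx, splitSnd_tmul _ hz,
    TensorProduct.sum_tmul, map_sum, TensorProduct.assoc_tmul, legR_star] at e1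
  exact e1

variable {n m : Type} [Fintype n] [DecidableEq n] [Fintype m] [DecidableEq m]

/-- The three identities of a `q`-cycle coalgebra, in terms of multiplicative matrices. -/
structure IsCycle {Y : Type*} [AddCommGroup Y] [Module k Y] [Coalgebra k Y]
    (dot colon : Y →ₗ[k] Y →ₗ[k] Y) : Prop where
  dot_dot : IsCycleIdentity dot dot colon dot dot dot
  dot_colon : IsCycleIdentity dot colon dot colon dot colon
  colon_colon : IsCycleIdentity colon colon colon colon colon dot

/-- The identity `(x · y₍₁₎) · (z : y₍₂₎) = (x · z₍₂₎) · (y · z₍₁₎)` for `x` in `H` and `y`, `z` in `X`. -/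
theorem IsLevelSystem.dot_dot_gen (h : IsLevelSystem D K) (c : IsCycle (D 0 0) (K 0 0))
    {y : n → n → X} {z : m → m → X} (hy : IsMult k 0 y) (hz : IsMult k 0 z) (x : FreeHopf k X)
    (p q : n) (r s : m) :
    ∑ e, repDot h.freeRep (repDot h.freeRep x (gen k 0 (y p e))) (gen k 0 (K 0 0 (z r s) (y e q)))
      = ∑ e, repDot h.freeRep (repDot h.freeRep x (gen k 0 (z e s)))
          (gen k 0 (D 0 0 (y p q) (z r e))) := by
  simp only [h.dot_gen_right]
  exact legR_star_eq (h.symm.isRightLinear_twistRep 0) (h.symm.isRightLinear_twistRep 0)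
    (h.symm.twistRep_gen 0 0) (h.symm.twistRep_gen 0 0) (h.symm.twistRep_gen 0 0)
    (h.symm.twistRep_gen 0 0) (h.symm.magma 0 0) (h.symm.magma 0 0) (h.symm.magma 0 0)
    (h.symm.magma 0 0).multDot (h.magma 0 0).multDot (h.symm.counit_dot 0 1)
    (h.inv_colon 0 0) (h.inv_colon' 0 0) c.colon_colon c.dot_colon c.dot_dot x hy hz p q r s

/-- The identity `(x : y₍₁₎) : (z : y₍₂₎) = (x : z₍₂₎) : (y · z₍₁₎)` for `x` in `H` and `y`, `z` in `X`. -/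
theorem IsLevelSystem.colon_colon_gen (h : IsLevelSystem D K) (c : IsCycle (D 0 0) (K 0 0))
    {y : n → n → X} {z : m → m → X} (hy : IsMult k 0 y) (hz : IsMult k 0 z) (x : FreeHopf k X)
    (p q : n) (r s : m) :
    ∑ e, repColon h.freeRep (repColon h.freeRep x (gen k 0 (y p e)))
        (gen k 0 (K 0 0 (z r s) (y e q)))
      = ∑ e, repColon h.freeRep (repColon h.freeRep x (gen k 0 (z e s)))
          (gen k 0 (D 0 0 (y p q) (z r e))) := by
  simp only [h.colon_gen_right]
  exact legR_star_eq (h.isRightLinear_twistRep 0) (h.isRightLinear_twistRep 0)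
    (h.twistRep_gen 0 0) (h.twistRep_gen 0 0) (h.twistRep_gen 0 0)
    (h.twistRep_gen 0 0) (h.magma 0 0) (h.magma 0 0) (h.magma 0 0)
    (h.symm.magma 0 0).multDot (h.magma 0 0).multDot (h.symm.counit_dot 0 1)
    (h.inv_colon 0 0) (h.inv_colon' 0 0) c.dot_colon c.dot_dot c.colon_colon x hy hz p q r s

/-- The identity `(x · y₍₁₎) : (z · y₍₂₎) = (x : z₍₂₎) · (y : z₍₁₎)` for `x` in `H` and `y`, `z` in `X`. -/
theorem IsLevelSystem.dot_colon_gen (h : IsLevelSystem D K) (c : IsCycle (D 0 0) (K 0 0))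
    {y : n → n → X} {z : m → m → X} (hy : IsMult k 0 y) (hz : IsMult k 0 z) (x : FreeHopf k X)
    (p q : n) (r s : m) :
    ∑ e, repColon h.freeRep (repDot h.freeRep x (gen k 0 (y p e)))
        (gen k 0 (D 0 0 (z r s) (y e q)))
      = ∑ e, repDot h.freeRep (repColon h.freeRep x (gen k 0 (z e s)))
          (gen k 0 (K 0 0 (y p q) (z r e))) := by
  simp only [h.colon_gen_right, h.dot_gen_right]
  exact legR_star_eq (h.symm.isRightLinear_twistRep 0) (h.isRightLinear_twistRep 0)
    (h.symm.twistRep_gen 0 0) (h.twistRep_gen 0 0) (h.twistRep_gen 0 0)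
    (h.symm.twistRep_gen 0 0) (h.symm.magma 0 0) (h.magma 0 0)
    (h.symm.magma 0 0) (h.magma 0 0).multDot (h.symm.magma 0 0).multDot (h.counit_dot 0 1)
    (h.inv_dot 0 0) (h.inv_dot' 0 0) c.dot_dot c.colon_colon c.dot_colon x hy hz p q r s

end CycleBase

end QBrace

namespace QBrace

/-! ### Cycle identities on the free Hopf algebra -/

theorem sum_tmul_congr {k M N ι ι' κ μ : Type*} [CommSemiring k] [AddCommMonoid M] [Module k M]
    [AddCommMonoid N] [Module k N] [Fintype ι] [Fintype ι'] [Fintype κ] [Fintype μ]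
    {A : κ → μ → M} {f : ι → κ → μ → N} {g : ι' → κ → μ → N}
    (h : ∀ b c, ∑ a, f a b c = ∑ a, g a b c) :
    ∑ a, ∑ b, ∑ c, A b c ⊗ₜ[k] f a b c = ∑ a, ∑ b, ∑ c, A b c ⊗ₜ[k] g a b c := by
  rw [← sum_rotate fun b c a => A b c ⊗ₜ[k] f a b c, ← sum_rotate fun b c a => A b c ⊗ₜ[k] g a b c]
  simp only [← TensorProduct.tmul_sum, h]

section Spread

variable {k : Type u} [Field k] {Y N : Type*} [AddCommGroup Y] [Module k Y] [Coalgebra k Y]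
  [AddCommGroup N] [Module k N]

/-- `y ⊗ n ↦ y₍₁₎ ⊗ f(y₍₂₎) n`. -/
noncomputable def spreadSnd (f : Y →ₗ[k] Module.End k N) : Y ⊗[k] N →ₗ[k] Y ⊗[k] N :=
  (TensorProduct.lift f).lTensor Y ∘ₗ (TensorProduct.assoc k Y Y N).toLinearMap ∘ₗ
    comul.rTensor N

/-- `y ⊗ n ↦ y₍₂₎ ⊗ f(y₍₁₎) n`. -/
noncomputable def spreadFst (f : Y →ₗ[k] Module.End k N) : Y ⊗[k] N →ₗ[k] Y ⊗[k] N :=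
  (TensorProduct.lift f).lTensor Y ∘ₗ (TensorProduct.assoc k Y Y N).toLinearMap ∘ₗ
    (comulFlip k Y).rTensor N

variable {n : Type} [Fintype n] [DecidableEq n] {w : n → n → Y}

theorem spreadSnd_tmul (f : Y →ₗ[k] Module.End k N) (hw : IsMult k 0 w) (a b : n) (x : N) :
    spreadSnd f (w a b ⊗ₜ x) = ∑ e, w a e ⊗ₜ[k] f (w e b) x := by
  simp [spreadSnd, hw.comul_zero, TensorProduct.sum_tmul]

theorem spreadFst_tmul (f : Y →ₗ[k] Module.End k N) (hw : IsMult k 0 w) (a b : n) (x : N) :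
    spreadFst f (w a b ⊗ₜ x) = ∑ e, w e b ⊗ₜ[k] f (w a e) x := by
  simp [spreadFst, comulFlip, hw.comul_zero, TensorProduct.sum_tmul]

theorem legR_spreadSnd (f : Y →ₗ[k] Module.End k N) (y : Y) (x : N) :
    legR k Y N (spreadSnd f (y ⊗ₜ x)) = f y x := by
  suffices H : legR k Y N ∘ₗ spreadSnd f = TensorProduct.lift f from
    LinearMap.congr_fun H (y ⊗ₜ x)
  refine ext_isMult_tmul 0 fun r w hw a b x => ?_
  simp [spreadSnd_tmul f hw, hw.counit_apply]

theorem legR_spreadFst (f : Y →ₗ[k] Module.End k N) (y : Y) (x : N) :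
    legR k Y N (spreadFst f (y ⊗ₜ x)) = f y x := by
  suffices H : legR k Y N ∘ₗ spreadFst f = TensorProduct.lift f from
    LinearMap.congr_fun H (y ⊗ₜ x)
  refine ext_isMult_tmul 0 fun r w hw a b x => ?_
  simp [spreadFst_tmul f hw, hw.counit_apply]

end Spread

section CycleExtension

variable {k : Type u} [Field k] {X : Type v} [AddCommGroup X] [Module k X] [Coalgebra k X]
variable {D K : ℤ → ℤ → X →ₗ[k] X →ₗ[k] X}
variable {N : Type*} [AddCommGroup N] [Module k N]
variable {n m : Type} [Fintype n] [DecidableEq n] [Fintype m] [DecidableEq m]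

open FreeHopf

/-- The identity `(z : y₍₂₎) y₍₁₎ = (y · z₍₁₎) z₍₂₎` in a representation `Ψ`, for all `y`, `z`
in the images of two coalgebra morphisms `i` and `j`. -/
def CommutesIn {B : Type*} [Ring B] [Bialgebra k B] (dot colon : B →ₗ[k] B →ₗ[k] B) {Y Z : Type*}
    [AddCommGroup Y] [Module k Y] [Coalgebra k Y] [AddCommGroup Z] [Module k Z] [Coalgebra k Z]
    (i : Y →ₗ[k] B) (j : Z →ₗ[k] B) (Ψ : B →ₐ[k] Module.End k N) : Prop :=
  ∀ ⦃n m : Type⦄ [Fintype n] [DecidableEq n] [Fintype m] [DecidableEq m] (w : n → n → Y)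
    (v : m → m → Z), IsMult k 0 w → IsMult k 0 v → ∀ a b c d x,
      ∑ e, Ψ (colon (j (v c d)) (i (w e b))) (Ψ (i (w a e)) x)
        = ∑ f, Ψ (dot (i (w a b)) (j (v c f))) (Ψ (j (v f d)) x)

/-- The first step from `X` to `H`: the right-hand argument `z` is arbitrary.  For fixed `Ψ` the
identity says that a map from `X ⊗ N` to itself intertwines two actions of `z`. -/
theorem IsLevelSystem.commutesIn_left (h : IsLevelSystem D K)
    {Ψ : FreeHopf k X →ₐ[k] Module.End k N}
    (hΨ : CommutesIn (repDot h.freeRep) (repColon h.freeRep) (gen k 0) (gen k 0) Ψ) :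
    CommutesIn (repDot h.freeRep) (repColon h.freeRep) (gen k 0) LinearMap.id Ψ := by
  have key : ∀ l z, spreadFst (Ψ.toLinearMap ∘ₗ gen k 0) (diagRep (h.dotRep 0) Ψ l z)
      = star (h.twistRep 0) (h.isRightLinear_twistRep 0) Ψ l
          (spreadFst (Ψ.toLinearMap ∘ₗ gen k 0) z) := by
    refine intertwines_isMult fun n v hv c d => ext_isMult_tmul 0 fun r w hw a b x => ?_
    have hN := (h.magma 0 0).multDot w v hw hv
    have e1 := fun f x => spreadFst_tmul (Ψ.toLinearMap ∘ₗ gen k 0) hN (a, f) (b, c) x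
    simp only [Fintype.sum_prod_type] at e1
    have e2 := fun e g => hΨ w v hw hv a e g d x
    simp only [h.dot_gen_gen, h.colon_gen_gen] at e2
    simp only [LinearMap.comp_apply, diagRep_apply _ _ (isMult_gen hv), h.dotRep_gen, map_sum,
      LinearMap.flip_apply, e1, spreadFst_tmul _ hw, star_tmul, h.twistRep_gen_tmul_one,
      twist_apply _ _ hv hw, actTmul_tmul, AlgHom.toLinearMap_apply]
    exact sum_tmul_congr fun e g => (e2 e g).symm
  intro n m _ _ _ _ w v hw hv a b c d x
  have e1 := congrArg (legR k X N) (key (v c d) (w a b ⊗ₜ x))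
  rw [diagRep_apply _ _ hv, spreadFst_tmul _ hw] at e1
  simp only [map_sum, legR_spreadFst, star_tmul, legR_actTmul, ← h.colon_gen_right] at e1
  simp only [LinearMap.id_apply, h.dot_gen_left]
  exact e1.symm

/-- The second step from `X` to `H`: both arguments are arbitrary. -/
theorem IsLevelSystem.commutesIn (h : IsLevelSystem D K)
    {Ψ : FreeHopf k X →ₐ[k] Module.End k N}
    (hΨ : CommutesIn (repDot h.freeRep) (repColon h.freeRep) (gen k 0) (gen k 0) Ψ) :
    CommutesIn (repDot h.freeRep) (repColon h.freeRep) LinearMap.id LinearMap.id Ψ := by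
  have hU := h.isBraceRep_freeRep
  have key : ∀ a z, spreadSnd Ψ.toLinearMap (diagRep' hU.colonRep Ψ a z)
      = star h.freeRep h.isRightLinear_freeRep Ψ a (spreadSnd Ψ.toLinearMap z) := by
    refine intertwines_isMult fun n w hw a b => ext_isMult_tmul 0 fun r l hl c d x => ?_
    have hw' := isMult_gen (k := k) hw
    have hN := hU.isMagma.multColon l _ hl hw'
    have e1 := fun e x => spreadSnd_tmul Ψ.toLinearMap hN (c, b) (d, e) x
    simp only [Fintype.sum_prod_type] at e1
    have e2 := fun f g => h.commutesIn_left hΨ w l hw hl a g f d x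
    simp only [LinearMap.id_apply] at e2
    simp only [LinearMap.comp_apply, diagRep'_apply _ _ hw', hU.colonRep_apply, map_sum,
      e1, spreadSnd_tmul _ hl, star_tmul, hU.apply_matrix' hw' hl, actTmul_tmul,
      AlgHom.toLinearMap_apply]
    exact sum_tmul_congr fun f g => e2 f g
  intro n m _ _ _ _ w v hw hv a b c d x
  have e1 := congrArg (legR k _ N) (key (w a b) (v c d ⊗ₜ x))
  rw [diagRep'_apply _ _ hw, spreadSnd_tmul _ hv] at e1
  simp only [map_sum, legR_spreadSnd, star_tmul, legR_actTmul, ← repDot_apply] at e1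
  exact e1

/-- The identity `(x · y₍₁₎) : (z · y₍₂₎) = (x : z₍₂₎) · (y : z₍₁₎)` for `x`, `y` in `H` and `z` in `X`. -/
theorem IsLevelSystem.dot_colon_left (h : IsLevelSystem D K) (c : IsCycle (D 0 0) (K 0 0))
    {u : n → n → FreeHopf k X} {v : m → m → X} (hu : IsMult k 0 u) (hv : IsMult k 0 v)
    (x : FreeHopf k X) (a b : n) (r s : m) :
    ∑ e, repColon h.freeRep (repDot h.freeRep x (u a e))
        (repDot h.freeRep (gen k 0 (v r s)) (u e b))
      = ∑ e, repDot h.freeRep (repColon h.freeRep x (gen k 0 (v e s)))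
          (repColon h.freeRep (u a b) (gen k 0 (v r e))) := by
  have hU := h.isBraceRep_freeRep
  have key : ∀ y z, spreadSnd (hU.colonRep.toLinearMap ∘ₗ gen k 0)
        (diagRep' (h.dotRep 0) hU.dotRep y z)
      = star (h.twistRep 0) (h.isRightLinear_twistRep 0) hU.dotRep y
          (spreadSnd (hU.colonRep.toLinearMap ∘ₗ gen k 0) z) := by
    refine intertwines_isMult fun n y hy a b => ext_isMult_tmul 0 fun r z hz p q x => ?_
    have hN := (h.magma 0 0).multDot z y hz hy
    have e1 := fun f x => spreadSnd_tmul (hU.colonRep.toLinearMap ∘ₗ gen k 0) hN (p, b) (q, f) x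
    simp only [Fintype.sum_prod_type] at e1
    have e2 := fun e g => h.dot_colon_gen c hy hz x a g e q
    simp only [LinearMap.comp_apply, diagRep'_apply _ _ (isMult_gen hy), h.dotRep_gen, map_sum,
      LinearMap.flip_apply, e1, spreadSnd_tmul _ hz, star_tmul, h.twistRep_gen_tmul_one,
      twist_apply' (h.magma 0 0).exchange hy hz, actTmul_tmul, AlgHom.toLinearMap_apply,
      hU.dotRep_apply, hU.colonRep_apply]
    exact sum_tmul_congr fun g e => e2 g e
  have e1 := congrArg (legR k X _) (key (u a b) (v r s ⊗ₜ x))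
  rw [diagRep'_apply _ _ hu, spreadSnd_tmul _ hv] at e1
  simp only [map_sum, legR_spreadSnd, star_tmul, legR_actTmul, ← h.colon_gen_right,
    LinearMap.comp_apply, AlgHom.toLinearMap_apply, hU.dotRep_apply, hU.colonRep_apply,
    ← h.dot_gen_left] at e1
  exact e1

theorem IsLevelSystem.dot_colon (h : IsLevelSystem D K) (c : IsCycle (D 0 0) (K 0 0)) :
    IsCycleIdentity (repDot h.freeRep) (repColon h.freeRep) (repDot h.freeRep)
      (repColon h.freeRep) (repDot h.freeRep) (repColon h.freeRep) := by
  have hU := h.isBraceRep_freeRep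
  have key : ∀ a z, spreadFst hU.dotRep.toLinearMap (diagRep hU.colonRep hU.colonRep a z)
      = star h.freeRep h.isRightLinear_freeRep hU.colonRep a
          (spreadFst hU.dotRep.toLinearMap z) := by
    refine intertwines_isMult fun n v hv r s => ext_isMult_tmul 0 fun r' l hl a b x => ?_
    have hv' := isMult_gen (k := k) hv
    have hN := hU.isMagma.multColon l _ hl hv'
    have e1 := fun f x => spreadFst_tmul hU.dotRep.toLinearMap hN (a, f) (b, r) x
    simp only [Fintype.sum_prod_type] at e1
    have e2 := fun g f => h.dot_colon_left c hl hv x a g f s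
    simp only [LinearMap.comp_apply, diagRep_apply _ _ hv', hU.colonRep_apply, map_sum,
      e1, spreadFst_tmul _ hl, star_tmul, hU.apply_matrix hv' hl, actTmul_tmul,
      AlgHom.toLinearMap_apply, hU.dotRep_apply]
    exact sum_tmul_congr fun f g => (e2 f g).symm
  intro n m _ _ _ _ w v hw hv x a b c d
  have e1 := congrArg (legR k _ _) (key (v c d) (w a b ⊗ₜ x))
  rw [diagRep_apply _ _ hv, spreadFst_tmul _ hw] at e1
  simp only [map_sum, legR_spreadFst, star_tmul, legR_actTmul, ← repDot_apply,
    AlgHom.toLinearMap_apply, hU.dotRep_apply, hU.colonRep_apply] at e1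
  exact e1.symm

/-- The first and the third identity of a `q`-cycle coalgebra are instances of `CommutesIn`, for the
representations `dotRep` and `colonRep`; the second one involves both of these. -/
theorem IsLevelSystem.isCycle (h : IsLevelSystem D K) (c : IsCycle (D 0 0) (K 0 0)) :
    IsCycle (repDot h.freeRep) (repColon h.freeRep) := by
  have hU := h.isBraceRep_freeRep
  refine ⟨?_, h.dot_colon c, ?_⟩
  · have e1 : CommutesIn (repDot h.freeRep) (repColon h.freeRep) (gen k 0) (gen k 0) hU.dotRep := by
      intro n m _ _ _ _ w v hw hv p q r s x
      simp only [hU.dotRep_apply, h.dot_gen_gen, h.colon_gen_gen]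
      exact h.dot_dot_gen c hw hv x p q r s
    intro n m _ _ _ _ w v hw hv x p q r s
    exact h.commutesIn e1 w v hw hv p q r s x
  · have e1 : CommutesIn (repDot h.freeRep) (repColon h.freeRep) (gen k 0) (gen k 0)
        hU.colonRep := by
      intro n m _ _ _ _ w v hw hv p q r s x
      simp only [hU.colonRep_apply, h.dot_gen_gen, h.colon_gen_gen]
      exact h.colon_colon_gen c hw hv x p q r s
    intro n m _ _ _ _ w v hw hv x p q r s
    exact h.commutesIn e1 w v hw hv p q r s x

end CycleExtension

end QBrace

namespace QBrace

/-! ### From brace representations to Hopf `q`-braces -/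

section Repr

variable {k : Type u} [Field k] {Y : Type*} [AddCommGroup Y] [Module k Y] [Coalgebra k Y]
  {M : Type*} [AddCommGroup M] [Module k M]

theorem sum_repr (F : Y →ₗ[k] Y →ₗ[k] M) (y : Y) :
    ∑ i ∈ (ℛ k y).index, F ((ℛ k y).left i) ((ℛ k y).right i) = TensorProduct.lift F (comul y) := by
  rw [← (ℛ k y).eq]
  simp

theorem IsMult.sum_repr {n : Type} [Fintype n] [DecidableEq n] {u : n → n → Y}
    (hu : IsMult k 0 u) (F : Y →ₗ[k] Y →ₗ[k] M) (a b : n) :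
    ∑ i ∈ (ℛ k (u a b)).index, F ((ℛ k (u a b)).left i) ((ℛ k (u a b)).right i)
      = ∑ e, F (u a e) (u e b) := by
  rw [QBrace.sum_repr, hu.comul_zero]
  simp

/-- A cycle identity, in the notation of Sweedler. -/
theorem isCycleIdentity_iff {o₁ o₂ o₃ o₄ o₅ o₆ : Y →ₗ[k] Y →ₗ[k] Y} :
    IsCycleIdentity o₁ o₂ o₃ o₄ o₅ o₆ ↔ ∀ x y z,
      ∑ i ∈ (ℛ k y).index, o₂ (o₁ x ((ℛ k y).left i)) (o₃ z ((ℛ k y).right i))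
        = ∑ j ∈ (ℛ k z).index, o₅ (o₄ x ((ℛ k z).right j)) (o₆ y ((ℛ k z).left j)) := by
  have e1 : ∀ {n : Type} [Fintype n] [DecidableEq n] {w : n → n → Y}, IsMult k 0 w →
      ∀ (x z : Y) (a b : n),
        ∑ i ∈ (ℛ k (w a b)).index, o₂ (o₁ x ((ℛ k (w a b)).left i)) (o₃ z ((ℛ k (w a b)).right i))
          = ∑ e, o₂ (o₁ x (w a e)) (o₃ z (w e b)) := fun hw x z a b =>
    hw.sum_repr (o₂.compl₁₂ (o₁ x) (o₃ z)) a b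
  have e2 : ∀ {n : Type} [Fintype n] [DecidableEq n] {v : n → n → Y}, IsMult k 0 v →
      ∀ (x y : Y) (a b : n),
        ∑ j ∈ (ℛ k (v a b)).index, o₅ (o₄ x ((ℛ k (v a b)).right j)) (o₆ y ((ℛ k (v a b)).left j))
          = ∑ e, o₅ (o₄ x (v e b)) (o₆ y (v a e)) := fun hv x y a b =>
    hv.sum_repr (o₅.compl₁₂ (o₄ x) (o₆ y)).flip a b
  constructor
  · intro h x y z
    have s1 : ∀ (s : ℕ) (v : Fin s → Fin s → Y), IsMult k 0 v → ∀ c d,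
        TensorProduct.lift (o₂.compl₁₂ (o₁ x) (o₃ (v c d))) ∘ₗ comul
          = ∑ f, o₅ (o₄ x (v f d)) ∘ₗ o₆.flip (v c f) := by
      intro s v hv c d
      refine ext_isMult 0 fun r w hw a b => ?_
      simpa [hw.comul_zero] using h w v hw hv x a b c d
    have s2 : ∑ i ∈ (ℛ k y).index, o₂ (o₁ x ((ℛ k y).left i)) ∘ₗ o₃.flip ((ℛ k y).right i)
        = TensorProduct.lift (o₅.compl₁₂ (o₄ x) (o₆ y)).flip ∘ₗ comul := by
      refine ext_isMult 0 fun s v hv c d => ?_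
      have := LinearMap.congr_fun (s1 s v hv c d) y
      rw [LinearMap.comp_apply, ← QBrace.sum_repr] at this
      simpa [hv.comul_zero] using this
    have := LinearMap.congr_fun s2 z
    rw [LinearMap.comp_apply, ← QBrace.sum_repr] at this
    simpa using this
  · intro h n m _ _ _ _ w v hw hv x a b c d
    rw [← e1 hw, ← e2 hv]
    exact h x _ _

end Repr

section ProductRules

variable {k : Type u} [Field k] {B : Type*} [Ring B] [Bialgebra k B]

/-- The compatibility of an operation `o` with products, in the notation of Sweedler and for the
entries of multiplicative matrices. -/
theorem mul_rule_iff {o o' : B →ₗ[k] B →ₗ[k] B} :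
    (∀ ⦃n m : Type⦄ [Fintype n] [DecidableEq n] [Fintype m] [DecidableEq m] {u : n → n → B}
        {w : m → m → B}, IsMult k 0 u → IsMult k 0 w → ∀ (x : B) (a b : n) (c d : m),
        o (x * u a b) (w c d) = ∑ e, ∑ f, o x (o' (w c e) (u f b)) * o (u a f) (w e d)) ↔
      ∀ x a l : B, o (x * a) l = ∑ i ∈ (ℛ k a).index, ∑ j ∈ (ℛ k l).index,
        o x (o' ((ℛ k l).left j) ((ℛ k a).right i)) * o ((ℛ k a).left i) ((ℛ k l).right j) := by
  let P : B → B → B → B →ₗ[k] B →ₗ[k] B := fun x r s =>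
    (LinearMap.mul k B).compl₁₂ (o x ∘ₗ o'.flip r) (o s)
  let Q : B → B → B → B →ₗ[k] B →ₗ[k] B := fun x r s =>
    ((LinearMap.mul k B).compl₁₂ (o x ∘ₗ o' r) (o.flip s)).flip
  have hP : ∀ x r s y z, P x r s y z = o x (o' y r) * o s z := fun _ _ _ _ _ => rfl
  have hQ : ∀ x r s y z, Q x r s y z = o x (o' r z) * o y s := fun _ _ _ _ _ => rfl
  constructor
  · intro h x a l
    have s1 : ∀ (s : ℕ) (w : Fin s → Fin s → B), IsMult k 0 w → ∀ c d,
        o.flip (w c d) ∘ₗ LinearMap.mulLeft k x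
          = ∑ e, TensorProduct.lift (Q x (w c e) (w e d)) ∘ₗ comul := by
      intro s w hw c d
      refine ext_isMult 0 fun r u hu a b => ?_
      simpa [hu.comul_zero, hQ] using h hu hw x a b c d
    have s2 : o (x * a) = ∑ i ∈ (ℛ k a).index,
        TensorProduct.lift (P x ((ℛ k a).right i) ((ℛ k a).left i)) ∘ₗ comul := by
      refine ext_isMult 0 fun s w hw c d => ?_
      have := LinearMap.congr_fun (s1 s w hw c d) a
      simp only [LinearMap.sum_apply, LinearMap.comp_apply, ← QBrace.sum_repr, hQ] at this
      rw [Finset.sum_comm] at this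
      simpa [hw.comul_zero, hP] using this
    rw [s2]
    simp only [LinearMap.sum_apply, LinearMap.comp_apply, ← QBrace.sum_repr, hP]
  · intro h n m _ _ _ _ u w hu hw x a b c d
    rw [h]
    have e1 := fun i => hw.sum_repr (P x ((ℛ k (u a b)).right i) ((ℛ k (u a b)).left i)) c d
    have e2 := fun e => hu.sum_repr (Q x (w c e) (w e d)) a b
    simp only [hP] at e1
    simp only [hQ] at e2
    simp only [e1]
    rw [Finset.sum_comm]
    simp only [e2]

end ProductRules

section Regularity

variable {k : Type u} [Field k] {Y : Type*} [AddCommGroup Y] [Module k Y] [Coalgebra k Y]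
  {p q : Y ⊗[k] Y →ₗ[k] Y}

theorem G_leftInverse (h : ∀ ⦃n : Type⦄ [Fintype n] [DecidableEq n] (u : n → n → Y),
    IsMult k 0 u → ∀ x a b, ∑ c, q (p (x ⊗ₜ u a c) ⊗ₜ u c b) = if a = b then x else 0) :
    Function.LeftInverse (G q) (G p) := by
  intro z
  suffices H : G q ∘ₗ G p = LinearMap.id from LinearMap.congr_fun H z
  refine TensorProduct.ext (LinearMap.ext fun x => ext_isMult 0 fun r u hu a b => ?_)
  change G q (G p (x ⊗ₜ u a b)) = x ⊗ₜ u a b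
  simp only [G_tmul _ hu, map_sum]
  rw [Finset.sum_comm]
  simp [← TensorProduct.sum_tmul, h u hu, TensorProduct.ite_tmul]

theorem Gcop_leftInverse (h : ∀ ⦃n : Type⦄ [Fintype n] [DecidableEq n] (u : n → n → Y),
    IsMult k 1 u → ∀ x a b, ∑ c, q (p (x ⊗ₜ u a c) ⊗ₜ u c b) = if a = b then x else 0) :
    Function.LeftInverse (Gcop q) (Gcop p) := by
  intro z
  suffices H : Gcop q ∘ₗ Gcop p = LinearMap.id from LinearMap.congr_fun H z
  refine TensorProduct.ext (LinearMap.ext fun x => ext_isMult 1 fun r u hu a b => ?_)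
  change Gcop q (Gcop p (x ⊗ₜ u a b)) = x ⊗ₜ u a b
  simp only [Gcop_tmul _ hu, map_sum]
  rw [Finset.sum_comm]
  simp [← TensorProduct.sum_tmul, h u hu, TensorProduct.ite_tmul]

end Regularity

section Antipode

variable {k : Type u} [Field k] {L : Type*} [Ring L] [HopfAlgebra k L]

/-- The integral powers of a bijective antipode form an antipodal family. -/
theorem isAntipodalFamily_antipode_zpow
    (hb : Function.Bijective (HopfAlgebra.antipode k (A := L))) :
    IsAntipodalFamily (fun i : ℤ =>
      ((LinearEquiv.ofBijective (HopfAlgebra.antipode k (A := L)) hb ^ i : L ≃ₗ[k] L) :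
        L →ₗ[k] L)) := by
  set T := LinearEquiv.ofBijective (HopfAlgebra.antipode k (A := L)) hb with hT
  have hTa : ∀ x, T x = HopfAlgebra.antipode k x := fun _ => rfl
  have hmul : ∀ x y, T (x * y) = T y * T x := HopfAlgebra.antipode_mul_antidistrib
  have hone : T 1 = 1 := HopfAlgebra.antipode_one
  have hsucc : ∀ (i : ℤ) x, (T ^ (i + 1)) x = T ((T ^ i) x) := fun i x => by
    rw [add_comm, zpow_add, zpow_one]; rfl
  have hδ : ∀ {n : Type} [DecidableEq n] (a b : n), T (if a = b then 1 else 0)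
      = if a = b then 1 else 0 := fun a b => by split_ifs <;> simp [hone]
  have key : ∀ i : ℤ, ∀ ⦃n : Type⦄ [Fintype n] [DecidableEq n] (u : n → n → L), IsMult k i u →
      ∀ a b, ∑ c, (T ^ (i + 1)) (u a c) * (T ^ i) (u c b) = (if a = b then 1 else 0) ∧
        ∑ c, (T ^ i) (u a c) * (T ^ (i + 1)) (u c b) = if a = b then 1 else 0 := by
    intro i
    induction i using Int.induction_on with
    | zero =>
      intro n _ _ u hu a b
      have e1 := HopfAlgebra.mul_antipode_rTensor_comul_apply (R := k) (u a b)
      have e2 := HopfAlgebra.mul_antipode_lTensor_comul_apply (R := k) (u a b)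
      simp only [hu.comul_zero, map_sum, LinearMap.rTensor_tmul, LinearMap.lTensor_tmul,
        LinearMap.mul'_apply, hu.counit_apply] at e1 e2
      simp only [zero_add, zpow_one, zpow_zero, hTa]
      refine ⟨Eq.trans e1 ?_, Eq.trans e2 ?_⟩ <;> split_ifs <;> simp
    | succ i ih =>
      intro n _ _ u hu a b
      obtain ⟨h1, h2⟩ := ih _ hu.transpose' b a
      replace h1 := congrArg T h1
      replace h2 := congrArg T h2
      simp only [map_sum, hmul, ← hsucc, hδ] at h1 h2
      simp only [@eq_comm n b a] at h1 h2
      exact ⟨h2, h1⟩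
    | pred i ih =>
      intro n _ _ u hu a b
      obtain ⟨h1, h2⟩ := ih (fun a b => u b a)
        (hu.transpose.congr (by rw [sub_add_cancel])) b a
      have hs : ∀ x, T ((T ^ (-(i : ℤ) - 1)) x) = (T ^ (-(i : ℤ))) x := fun x => by
        rw [← hsucc, sub_add_cancel]
      simp only [@eq_comm n b a] at h1 h2
      rw [sub_add_cancel]
      refine ⟨T.injective ?_, T.injective ?_⟩
      · simpa only [map_sum, hmul, hs, hδ, ← hsucc] using h2
      · simpa only [map_sum, hmul, hs, hδ, ← hsucc] using h1
  exact ⟨fun i n _ _ u hu a b => (key i u hu a b).1, fun i n _ _ u hu a b => (key i u hu a b).2⟩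

variable {p : L ⊗[k] L →ₗ[k] L}

/-- The operation of a right `L^op`-module is left and right regular when `L` has bijective
antipode. -/
theorem bijective_G_of_module (hb : Function.Bijective (HopfAlgebra.antipode k (A := L)))
    (h1 : ∀ x, p (x ⊗ₜ 1) = x) (hmul : ∀ x a b, p (x ⊗ₜ (a * b)) = p (p (x ⊗ₜ b) ⊗ₜ a)) :
    Function.Bijective (G p) ∧ Function.Bijective (Gcop p) := by
  have hT := isAntipodalFamily_antipode_zpow hb
  set T := LinearEquiv.ofBijective (HopfAlgebra.antipode k (A := L)) hb
  have hδ : ∀ {n : Type} [DecidableEq n] (a b : n) (x : L), p (x ⊗ₜ (if a = b then 1 else 0))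
      = if b = a then x else 0 := fun a b x => by
    rcases eq_or_ne a b with rfl | hab
    · simp [h1]
    · simp [hab, hab.symm]
  constructor
  · -- the inverse is `x ⊗ y ↦ x · S⁻¹(y₍₁₎) ⊗ y₍₂₎`
    refine Function.bijective_iff_has_inverse.2
      ⟨G (p ∘ₗ ((T ^ (-1 : ℤ) : L ≃ₗ[k] L) : L →ₗ[k] L).lTensor L),
        G_leftInverse fun n _ _ u hu x a b => ?_, G_leftInverse fun n _ _ u hu x a b => ?_⟩
    · have e := hT.mul_succ (-1) _ (hu.transpose.congr (j := -1) (by decide)) b a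
      simp only [neg_add_cancel, zpow_zero, LinearEquiv.coe_coe] at e
      simp only [LinearMap.comp_apply, LinearMap.lTensor_tmul, LinearEquiv.coe_coe, ← hmul,
        ← map_sum, ← TensorProduct.tmul_sum]
      exact (congrArg (fun y => p (x ⊗ₜ y)) e).trans (hδ b a x)
    · have e := hT.succ_mul (-1) _ (hu.transpose.congr (j := -1) (by decide)) b a
      simp only [neg_add_cancel, zpow_zero, LinearEquiv.coe_coe] at e
      simp only [LinearMap.comp_apply, LinearMap.lTensor_tmul, LinearEquiv.coe_coe, ← hmul,
        ← map_sum, ← TensorProduct.tmul_sum]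
      exact (congrArg (fun y => p (x ⊗ₜ y)) e).trans (hδ b a x)
  · -- the inverse is `x ⊗ y ↦ x · S(y₍₂₎) ⊗ y₍₁₎`
    refine Function.bijective_iff_has_inverse.2 ⟨Gcop (p ∘ₗ (T : L →ₗ[k] L).lTensor L),
        Gcop_leftInverse fun n _ _ u hu x a b => ?_, Gcop_leftInverse fun n _ _ u hu x a b => ?_⟩
    · have e := hT.succ_mul 0 _ (IsMult.transpose' (by simpa using hu)) b a
      simp only [zero_add, zpow_one, zpow_zero, LinearEquiv.coe_coe] at e
      simp only [LinearMap.comp_apply, LinearMap.lTensor_tmul, LinearEquiv.coe_coe, ← hmul,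
        ← map_sum, ← TensorProduct.tmul_sum]
      exact (congrArg (fun y => p (x ⊗ₜ y)) e).trans (hδ b a x)
    · have e := hT.mul_succ 0 _ (IsMult.transpose' (by simpa using hu)) b a
      simp only [zero_add, zpow_one, zpow_zero, LinearEquiv.coe_coe] at e
      simp only [LinearMap.comp_apply, LinearMap.lTensor_tmul, LinearEquiv.coe_coe, ← hmul,
        ← map_sum, ← TensorProduct.tmul_sum]
      exact (congrArg (fun y => p (x ⊗ₜ y)) e).trans (hδ b a x)

end Antipode

/-- The Hopf `q`-brace defined by a representation of `B` on `B ⊗ B`. -/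
noncomputable def IsBraceRep.hopfQBrace {k : Type u} [Field k] {B : Type v} [Ring B]
    [HopfAlgebra k B] {U : B →ₐ[k] Module.End k (B ⊗[k] B)} (h : IsBraceRep U)
    (c : IsCycle (repDot U) (repColon U))
    (hb : Function.Bijective (HopfAlgebra.antipode k (A := B))) : HopfQBrace k B where
  p := TensorProduct.lift (repDot U)
  d := TensorProduct.lift (repColon U)
  counit_p := IsMagma.counit_comp (p := TensorProduct.lift (repDot U))
    (d := TensorProduct.lift (repColon U)) h.isMagma |>.1
  counit_d := IsMagma.counit_comp (p := TensorProduct.lift (repDot U))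
    (d := TensorProduct.lift (repColon U)) h.isMagma |>.2
  isCoalgMap_hMap := IsMagma.isCoalgMap_hMap h.isMagma
  leftRegular := (bijective_G_of_module hb h.dot_one h.dot_mul).1
  rightRegular := (bijective_G_of_module hb colon_one h.colon_mul).2
  cycle_dot_dot := isCycleIdentity_iff.1 c.dot_dot
  cycle_dot_colon := isCycleIdentity_iff.1 c.dot_colon
  cycle_colon_colon := isCycleIdentity_iff.1 c.colon_colon
  dot_one := h.dot_one
  dot_mul := h.dot_mul
  colon_one := colon_one
  colon_mul := h.colon_mul
  mul_dot := mul_rule_iff.1 fun _ _ _ _ _ _ _ _ hu hw => h.mul_dot hu hw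
  mul_colon := mul_rule_iff.1 fun _ _ _ _ _ _ _ _ hu hw => h.mul_colon hu hw

theorem QCycleCoalgebra.isMagma {k : Type u} [Field k] {X : Type v} [AddCommGroup X] [Module k X]
    [Coalgebra k X] (𝒳 : QCycleCoalgebra k X) :
    IsMagma 0 0 (TensorProduct.curry 𝒳.p) (TensorProduct.curry 𝒳.d) :=
  isMagma_of_isCoalgMap 𝒳.counit_p 𝒳.counit_d 𝒳.isCoalgMap_hMap

theorem QCycleCoalgebra.isCycle {k : Type u} [Field k] {X : Type v} [AddCommGroup X] [Module k X]
    [Coalgebra k X] (𝒳 : QCycleCoalgebra k X) :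
    IsCycle (TensorProduct.curry 𝒳.p) (TensorProduct.curry 𝒳.d) :=
  ⟨isCycleIdentity_iff.2 𝒳.cycle_dot_dot, isCycleIdentity_iff.2 𝒳.cycle_dot_colon,
    isCycleIdentity_iff.2 𝒳.cycle_colon_colon⟩

end QBrace

namespace QBrace

/-! ### Universality -/

section CrossRepresentation

variable {k : Type u} [Field k] {L : Type*} [Ring L] [HopfAlgebra k L]
variable {n m : Type} [Fintype n] [DecidableEq n] [Fintype m] [DecidableEq m]

/-- The map `a ↦ (l ↦ l₍₁₎ ∘ a₍₂₎ ⊗ a₍₁₎ ∘' l₍₂₎)`, for two operations `∘` and `∘'`. -/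
noncomputable def cross (o o' : L →ₗ[k] L →ₗ[k] L) : L →ₗ[k] L →ₗ[k] L ⊗[k] L :=
  TensorProduct.curry (TensorProduct.map (TensorProduct.lift o.flip) (TensorProduct.lift o') ∘ₗ
    (TensorProduct.tensorTensorTensorComm k L L L L).toLinearMap ∘ₗ
    TensorProduct.map (comulFlip k L) comul)

theorem cross_apply (o o' : L →ₗ[k] L →ₗ[k] L) {u : n → n → L} {w : m → m → L}
    (hu : IsMult k 0 u) (hw : IsMult k 0 w) (a b : n) (c d : m) : cross o o' (u a b) (w c d)
      = ∑ e, ∑ f, o (w c e) (u f b) ⊗ₜ[k] o' (u a f) (w e d) := by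
  simp only [cross, TensorProduct.curry_apply, LinearMap.comp_apply, comulFlip,
    TensorProduct.map_tmul, hu.comul_zero, hw.comul_zero, TensorProduct.sum_tmul,
    TensorProduct.tmul_sum, map_sum, LinearEquiv.coe_coe, TensorProduct.comm_tmul,
    TensorProduct.tensorTensorTensorComm_tmul, TensorProduct.lift.tmul, LinearMap.flip_apply]

/-- Two operations on a Hopf algebra with the properties which make
`a ↦ (l ⊗ c ↦ l₍₁₎ ∘ a₍₂₎ ⊗ (a₍₁₎ ∘' l₍₂₎) c)` a representation. -/
structure IsCrossPair (o o' : L →ₗ[k] L →ₗ[k] L) : Prop where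
  mult : IsMultOp 0 0 o
  mult' : IsMultOp 0 0 o'
  op_one : ∀ x, o x 1 = x
  op_mul : ∀ x a b, o x (a * b) = o (o x b) a
  mul_op : ∀ ⦃n m : Type⦄ [Fintype n] [DecidableEq n] [Fintype m] [DecidableEq m] {u : n → n → L}
    {w : m → m → L}, IsMult k 0 u → IsMult k 0 w → ∀ (x : L) (a b : n) (c d : m),
    o' (x * u a b) (w c d) = ∑ e, ∑ f, o' x (o (w c e) (u f b)) * o' (u a f) (w e d)

variable {o o' : L →ₗ[k] L →ₗ[k] L}

/-- The matrix `1 ∘' w` is idempotent, and it is invertible since the antipode is bijective. -/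
theorem IsCrossPair.one_op (h : IsCrossPair o o')
    (hb : Function.Bijective (HopfAlgebra.antipode k (A := L))) {w : m → m → L}
    (hw : IsMult k 0 w) (a b : m) : o' 1 (w a b) = if a = b then 1 else 0 := by
  have e1 : ∀ a b, ∑ c, o' 1 (w a c) * o' 1 (w c b) = o' 1 (w a b) := fun a b => by
    have := h.mul_op isMult_one hw 1 () () a b
    simpa [h.op_one] using this.symm
  have hM : IsMult k (-1) (fun a b => o' 1 (w a b)) := by
    have h1 := h.mult' _ w isMult_one hw
    have h2 : IsMult k 0 (fun a b : m => o' 1 (w b a)) :=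
      ⟨fun a b => by simpa [Fintype.sum_prod_type] using h1.comul_apply ((), a) ((), b),
        fun a b => by simpa using h1.counit_apply ((), a) ((), b)⟩
    exact h2.transpose.congr (by decide)
  have e2 := (isAntipodalFamily_antipode_zpow hb).succ_mul (-1) _ hM
  set T := LinearEquiv.ofBijective (HopfAlgebra.antipode k (A := L)) hb
  simp only [neg_add_cancel, zpow_zero, LinearEquiv.coe_coe] at e2
  replace e2 : ∀ a b, ∑ c, o' 1 (w a c) * (T ^ (-1 : ℤ)) (o' 1 (w c b))
    = if a = b then 1 else 0 := e2
  calc o' 1 (w a b) = ∑ c, o' 1 (w a c) * (if c = b then 1 else 0) := by simp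
    _ = ∑ c, ∑ e, o' 1 (w a c) * o' 1 (w c e) * (T ^ (-1 : ℤ)) (o' 1 (w e b)) := by
      simp only [← e2, Finset.mul_sum, mul_assoc]
    _ = ∑ e, o' 1 (w a e) * (T ^ (-1 : ℤ)) (o' 1 (w e b)) := by
      rw [Finset.sum_comm]
      simp only [← Finset.sum_mul, e1]
    _ = _ := e2 a b

/-- The representation `a ↦ (l ⊗ c ↦ l₍₁₎ ∘ a₍₂₎ ⊗ (a₍₁₎ ∘' l₍₂₎) c)` of `L` on `L ⊗ L`. -/
noncomputable def crossRep (h : IsCrossPair o o')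
    (hb : Function.Bijective (HopfAlgebra.antipode k (A := L))) :
    L →ₐ[k] Module.End k (L ⊗[k] L) :=
  AlgHom.ofLinearMap (rext k L L L ∘ₗ cross o o')
    (by
      refine ext_isMult_tmul 0 fun r w hw c d x => ?_
      have := cross_apply o o' isMult_one hw () () c d
      rw [LinearMap.comp_apply, rext_tmul, this]
      simp [h.op_one, h.one_op hb hw, TensorProduct.tmul_ite])
    (by
      intro a b
      suffices H : (LinearMap.mul k L).compr₂ (rext k L L L ∘ₗ cross o o')
          = (LinearMap.mul k (Module.End k (L ⊗[k] L))).compl₁₂ (rext k L L L ∘ₗ cross o o')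
            (rext k L L L ∘ₗ cross o o') from LinearMap.congr_fun₂ H a b
      refine ext_isMult₂ 0 0 fun r s u v hu hv a b a' b' => ext_isMult_tmul 0 fun t w hw c d x => ?_
      have hN := h.mult w v hw hv
      have e1 := cross_apply o o' (hu.mul hv) hw (a, a') (b, b') c d
      have e2 := cross_apply o o' hv hw a' b' c d
      have e3 := fun e g => cross_apply o o' hu hN a b (c, b') (e, g)
      simp only [Fintype.sum_prod_type] at e1 e3
      simp only [LinearMap.compr₂_apply, LinearMap.compl₁₂_apply, LinearMap.mul_apply',
        LinearMap.comp_apply, Module.End.mul_apply, rext_tmul, e1, e2, map_sum, rightMul_tmul, e3,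
        h.op_mul, h.mul_op hv hw]
      simp only [Finset.sum_mul, TensorProduct.tmul_sum, mul_assoc, ← Fintype.sum_prod_type']
      exact Fintype.sum_equiv ⟨fun (e, f, p, q, g) => (q, g, e, p, f),
        fun (q, g, e, p, f) => (e, f, p, q, g), fun _ => rfl, fun _ => rfl⟩ _ _
        fun ⟨_, _, _, _, _⟩ => rfl)

theorem crossRep_tmul (h : IsCrossPair o o')
    (hb : Function.Bijective (HopfAlgebra.antipode k (A := L))) (a l c : L) :
    crossRep h hb a (l ⊗ₜ c) = rightMul k L c (cross o o' a l) := rext_tmul _ _ _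

theorem comm_cross (o o' : L →ₗ[k] L →ₗ[k] L) (a l : L) :
    TensorProduct.comm k L L (cross o o' l a) = cross o' o a l := by
  suffices H : (cross o o').flip.compr₂ (TensorProduct.comm k L L).toLinearMap = cross o' o from
    LinearMap.congr_fun₂ H a l
  refine ext_isMult₂ 0 0 fun r s u w hu hw p q c d => ?_
  simp only [LinearMap.compr₂_apply, LinearMap.flip_apply, cross_apply o o' hw hu,
    cross_apply o' o hu hw, map_sum, LinearEquiv.coe_coe, TensorProduct.comm_tmul]
  exact Finset.sum_comm

theorem legR_cross (ho : ∀ x y, counit (R := k) (o x y) = counit (R := k) x * counit (R := k) y)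
    (a l : L) : legR k L L (cross o o' a l) = o' a l := by
  suffices H : (cross o o').compr₂ (legR k L L) = o' from LinearMap.congr_fun₂ H a l
  refine ext_isMult₂ 0 0 fun r s u w hu hw p q c d => ?_
  simp [cross_apply o o' hu hw, ho, hu.counit_apply, hw.counit_apply]

theorem legL_cross (ho : ∀ x y, counit (R := k) (o' x y) = counit (R := k) x * counit (R := k) y)
    (a l : L) : legL k L L (cross o o' a l) = o l a := by
  suffices H : (cross o o').compr₂ (legL k L L) = o.flip from LinearMap.congr_fun₂ H a l
  refine ext_isMult₂ 0 0 fun r s u w hu hw p q c d => ?_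
  simp [cross_apply o o' hu hw, ho, hu.counit_apply, hw.counit_apply]

end CrossRepresentation

section Universality

variable {k : Type u} [Field k] {X : Type v} [AddCommGroup X] [Module k X] [Coalgebra k X]

theorem IsMult.map {Y : Type*} [AddCommGroup Y] [Module k Y] [Coalgebra k Y] (f : X →ₗc[k] Y)
    {i : ℤ} {n : Type} [Fintype n] [DecidableEq n] {u : n → n → X} (hu : IsMult k i u) :
    IsMult k i (fun a b => f (u a b)) := by
  have key : ∀ x, levelComul k Y i (f x)
      = TensorProduct.map (f : X →ₗ[k] Y) (f : X →ₗ[k] Y) (levelComul k X i x) := by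
    intro x
    have e := LinearMap.congr_fun (CoalgHomClass.map_comp_comul f) x
    simp only [LinearMap.comp_apply] at e
    by_cases hi : Even i
    · rw [levelComul_of_even hi, levelComul_of_even hi, e]
      rfl
    · rw [levelComul_of_odd hi, levelComul_of_odd hi]
      have := congrArg (TensorProduct.comm k Y Y) e
      rw [← TensorProduct.map_comm] at this
      exact this.symm
  refine ⟨fun a b => ?_, fun a b => ?_⟩
  · rw [key, hu.comul_apply, map_sum]
    rfl
  · rw [CoalgHomClass.counit_comp_apply, hu.counit_apply]

theorem IsAntipodalFamily.comp {Y A : Type*} [AddCommGroup Y] [Module k Y] [Coalgebra k Y] [Ring A]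
    [Algebra k A] {F : ℤ → Y →ₗ[k] A} (hF : IsAntipodalFamily F) (f : X →ₗc[k] Y) :
    IsAntipodalFamily (fun i => F i ∘ₗ (f : X →ₗ[k] Y)) :=
  ⟨fun i _ _ _ _ hu => hF.succ_mul i _ (hu.map f), fun i _ _ _ _ hu => hF.mul_succ i _ (hu.map f)⟩

open FreeHopf

variable {L : Type*} [Ring L] [HopfAlgebra k L]

/-- The morphism from the free Hopf algebra on `X` to a Hopf algebra with bijective antipode which
extends a coalgebra morphism. -/
noncomputable def liftHopf (hb : Function.Bijective (HopfAlgebra.antipode k (A := L)))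
    (f : X →ₗc[k] L) : FreeHopf k X →ₐ[k] L :=
  lift _ ((isAntipodalFamily_antipode_zpow hb).comp f)

theorem liftHopf_gen (hb : Function.Bijective (HopfAlgebra.antipode k (A := L)))
    (f : X →ₗc[k] L) (x : X) : liftHopf hb f (gen k 0 x) = f x := by
  rw [liftHopf, lift_gen]
  simp only [zpow_zero]
  rfl

/-- `liftHopf`, as a morphism of bialgebras. -/
noncomputable def liftBialgHom (hb : Function.Bijective (HopfAlgebra.antipode k (A := L)))
    (f : X →ₗc[k] L) : FreeHopf k X →ₐc[k] L :=
  .ofAlgHom (liftHopf hb f)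
    (algHom_ext_zero fun x => by
      simp only [AlgHom.comp_apply, liftHopf_gen, Bialgebra.counitAlgHom_apply,
        CoalgHomClass.counit_comp_apply, counit_gen])
    (algHom_ext_zero fun x => by
      suffices H : ((Algebra.TensorProduct.map (liftHopf hb f) (liftHopf hb f)).comp
          (Bialgebra.comulAlgHom k (FreeHopf k X))).toLinearMap ∘ₗ gen k 0
          = ((Bialgebra.comulAlgHom k L).comp (liftHopf hb f)).toLinearMap ∘ₗ gen k 0 from
        LinearMap.congr_fun H x
      refine ext_isMult 0 fun r u hu a b => ?_
      simp only [LinearMap.comp_apply, AlgHom.toLinearMap_apply, AlgHom.comp_apply,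
        Bialgebra.comulAlgHom_apply, comul_gen hu, liftHopf_gen, (hu.map f).comul_zero, map_sum,
        Algebra.TensorProduct.map_tmul])

variable {D K : ℤ → ℤ → X →ₗ[k] X →ₗ[k] X} {dot colon : L →ₗ[k] L →ₗ[k] L}

/-- A morphism `X → L` of `q`-cycle coalgebras intertwines the actions on `X ⊗ H` and `L ⊗ L`. -/
theorem IsLevelSystem.map_twistRep (h : IsLevelSystem D K)
    (hb : Function.Bijective (HopfAlgebra.antipode k (A := L))) (hc : IsCrossPair dot colon)
    (f : X →ₗc[k] L) (hD : ∀ x y, f (D 0 0 x y) = dot (f x) (f y))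
    (hK : ∀ x y, f (K 0 0 x y) = colon (f x) (f y)) (l : FreeHopf k X)
    (z : X ⊗[k] FreeHopf k X) :
    TensorProduct.map (f : X →ₗ[k] L) (liftHopf hb f).toLinearMap (h.twistRep 0 l z)
      = crossRep hc hb (liftHopf hb f l)
          (TensorProduct.map (f : X →ₗ[k] L) (liftHopf hb f).toLinearMap z) := by
  refine intertwines_isMult (Θ' := (crossRep hc hb).comp (liftHopf hb f))
    (fun r u hu a b => ext_isMult_tmul 0 fun s w hw c d x => ?_) l z
  simp only [LinearMap.comp_apply, AlgHom.comp_apply, liftHopf_gen, TensorProduct.map_tmul,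
    crossRep_tmul, LinearMap.coe_coe, AlgHom.toLinearMap_apply,
    cross_apply dot colon (hu.map f) (hw.map f), h.twistRep_gen, rext_tmul,
    twist_apply' (h.magma 0 0).exchange hu hw, map_sum, rightMul_tmul, map_mul, hD, hK]

/-- The extension `H → L` of a morphism `X → L` of `q`-cycle coalgebras intertwines the actions on
`H ⊗ H` and `L ⊗ L`. -/
theorem IsLevelSystem.map_freeRep (h : IsLevelSystem D K)
    (hb : Function.Bijective (HopfAlgebra.antipode k (A := L))) (hc : IsCrossPair dot colon)
    (hc' : IsCrossPair colon dot)
    (f : X →ₗc[k] L) (hD : ∀ x y, f (D 0 0 x y) = dot (f x) (f y))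
    (hK : ∀ x y, f (K 0 0 x y) = colon (f x) (f y)) (a : FreeHopf k X)
    (z : FreeHopf k X ⊗[k] FreeHopf k X) :
    TensorProduct.map (liftHopf hb f).toLinearMap (liftHopf hb f).toLinearMap (h.freeRep a z)
      = crossRep hc' hb (liftHopf hb f a)
          (TensorProduct.map (liftHopf hb f).toLinearMap (liftHopf hb f).toLinearMap z) := by
  refine intertwines (Θ' := (crossRep hc' hb).comp (liftHopf hb f)) (fun y z => ?_) a z
  induction z using TensorProduct.induction_on with
  | zero => simp
  | add z z' hz hz' => simp only [map_add, hz, hz']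
  | tmul l c =>
    have e1 := h.map_twistRep hb hc f hD hK l (y ⊗ₜ 1)
    have e2 : ∀ z, TensorProduct.map (liftHopf hb f).toLinearMap (liftHopf hb f).toLinearMap
        (rightMul k _ c (swapGen k X 0 z)) = rightMul k _ (liftHopf hb f c)
          (TensorProduct.comm k L L (TensorProduct.map (f : X →ₗ[k] L)
            (liftHopf hb f).toLinearMap z)) := by
      intro z
      induction z using TensorProduct.induction_on with
      | zero => simp
      | add z z' hz hz' => simp only [map_add, hz, hz']
      | tmul m b => simp [liftHopf_gen]
    rw [h.freeRep_gen_tmul, e2, e1, TensorProduct.map_tmul, TensorProduct.map_tmul,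
      AlgHom.comp_apply, crossRep_tmul, crossRep_tmul, AlgHom.toLinearMap_apply,
      AlgHom.toLinearMap_apply, AlgHom.toLinearMap_apply, map_one, rightMul_one, comm_cross,
      liftHopf_gen]
    rfl

/-- The two operations are the components of the actions on `H ⊗ H` and `L ⊗ L`, hence they are
preserved. -/
theorem IsLevelSystem.liftHopf_dot_colon (h : IsLevelSystem D K)
    (hb : Function.Bijective (HopfAlgebra.antipode k (A := L))) (hc : IsCrossPair dot colon)
    (hc' : IsCrossPair colon dot)
    (f : X →ₗc[k] L) (hD : ∀ x y, f (D 0 0 x y) = dot (f x) (f y))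
    (hK : ∀ x y, f (K 0 0 x y) = colon (f x) (f y)) (a l : FreeHopf k X) :
    liftHopf hb f (repDot h.freeRep a l) = dot (liftHopf hb f a) (liftHopf hb f l) ∧
      liftHopf hb f (repColon h.freeRep l a) = colon (liftHopf hb f l) (liftHopf hb f a) := by
  have hε : ∀ x, counit (R := k) (liftHopf hb f x) = counit (R := k) x :=
    fun x => CoalgHomClass.counit_comp_apply (liftBialgHom hb f) x
  have e := h.map_freeRep hb hc hc' f hD hK a (l ⊗ₜ 1)
  rw [TensorProduct.map_tmul, crossRep_tmul, AlgHom.toLinearMap_apply, AlgHom.toLinearMap_apply,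
    map_one, rightMul_one] at e
  constructor
  · have e1 : ∀ z, liftHopf hb f (legR k _ _ z) = legR k _ _
        (TensorProduct.map (liftHopf hb f).toLinearMap (liftHopf hb f).toLinearMap z) := by
      intro z
      induction z using TensorProduct.induction_on with
      | zero => simp
      | add z z' hz hz' => simp only [map_add, hz, hz']
      | tmul m b => simp [hε]
    rw [repDot_apply, e1, e, legR_cross hc'.mult.counit_apply]
  · have e1 : ∀ z, liftHopf hb f (legL k _ _ z) = legL k _ _
        (TensorProduct.map (liftHopf hb f).toLinearMap (liftHopf hb f).toLinearMap z) := by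
      intro z
      induction z using TensorProduct.induction_on with
      | zero => simp
      | add z z' hz hz' => simp only [map_add, hz, hz']
      | tmul m b => simp [hε]
    rw [repColon_apply, e1, e, legL_cross hc.mult.counit_apply]

end Universality

section Statement

variable {k : Type u} [Field k]

/-- The two operations of a Hopf `q`-brace act on `L ⊗ L`, in either order. -/
theorem HopfQBrace.isCrossPair {L : Type*} [Ring L] [HopfAlgebra k L] (ℒ : HopfQBrace k L) :
    IsCrossPair (TensorProduct.curry ℒ.p) (TensorProduct.curry ℒ.d) ∧
      IsCrossPair (TensorProduct.curry ℒ.d) (TensorProduct.curry ℒ.p) := by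
  have hm := ℒ.toQCycleCoalgebra.isMagma
  exact ⟨⟨hm.multDot, hm.multColon, ℒ.dot_one, ℒ.dot_mul,
    fun _ _ _ _ _ _ _ _ hu hw => mul_rule_iff.2 ℒ.mul_colon hu hw⟩,
    ⟨hm.multColon, hm.multDot, ℒ.colon_one, ℒ.colon_mul,
    fun _ _ _ _ _ _ _ _ hu hw => mul_rule_iff.2 ℒ.mul_dot hu hw⟩⟩

/-- The inclusion of `X` into the free Hopf algebra on `X`. -/
noncomputable def FreeHopf.genCoalgHom (k : Type u) [Field k] (X : Type v) [AddCommGroup X]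
    [Module k X] [Coalgebra k X] : X →ₗc[k] FreeHopf k X :=
  { FreeHopf.gen k 0 with
    counit_comp := LinearMap.ext fun x => FreeHopf.counit_gen 0 x
    map_comp_comul := ext_isMult 0 fun r u hu a b => by
      simp only [LinearMap.comp_apply, hu.comul_zero, map_sum, TensorProduct.map_tmul]
      exact (FreeHopf.comul_gen hu a b).symm }

end Statement

end QBrace

theorem theorem8p5 {k : Type u} [Field k] {X : Type v} [AddCommGroup X] [Module k X]
    [Coalgebra k X] (𝒳 : QBrace.QCycleCoalgebra k X)
    (h𝒳 : QBrace.IsVeryStronglyRegular 𝒳.p 𝒳.d) :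
    ∃ (H : Type (max u v)) (_ : Ring H) (_ : HopfAlgebra k H) (ℋ : QBrace.HopfQBrace k H)
      (ι : X →ₗc[k] H),
      Function.Bijective (HopfAlgebra.antipode k (A := H)) ∧
      QBrace.PreservesOps 𝒳.toQMagmaCoalgebra ℋ.toQMagmaCoalgebra ι ∧
      ∀ (L : Type (max u v w)) [Ring L] [HopfAlgebra k L] (ℒ : QBrace.HopfQBrace k L),
        Function.Bijective (HopfAlgebra.antipode k (A := L)) →
        ∀ f : X →ₗc[k] L,
          QBrace.PreservesOps 𝒳.toQMagmaCoalgebra ℒ.toQMagmaCoalgebra f →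
          ∃! g : H →ₐc[k] L,
            QBrace.PreservesOps ℋ.toQMagmaCoalgebra ℒ.toQMagmaCoalgebra g ∧
            ∀ x : X, f x = g (ι x) := by
  obtain ⟨D, K, h, hD, hK⟩ := QBrace.exists_isLevelSystem 𝒳.isMagma h𝒳
  have hc : QBrace.IsCycle (D 0 0) (K 0 0) := by
    rw [hD, hK]
    exact 𝒳.isCycle
  have hD' : ∀ x y, 𝒳.dot x y = D 0 0 x y := fun x y => by rw [hD]; rfl
  have hK' : ∀ x y, 𝒳.colon x y = K 0 0 x y := fun x y => by rw [hK]; rfl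
  refine ⟨QBrace.FreeHopf k X, inferInstance, inferInstance,
    h.isBraceRep_freeRep.hopfQBrace (h.isCycle hc) QBrace.FreeHopf.antipode_bijective,
    QBrace.FreeHopf.genCoalgHom k X, QBrace.FreeHopf.antipode_bijective, fun x y => ⟨?_, ?_⟩, ?_⟩
  · rw [hD']
    exact (h.dot_gen_gen x y).symm
  · rw [hK']
    exact (h.colon_gen_gen x y).symm
  intro L _ _ ℒ hb f hf
  obtain ⟨c₁, c₂⟩ := ℒ.isCrossPair
  have key := h.liftHopf_dot_colon hb c₁ c₂ f (fun x y => by rw [← hD']; exact (hf x y).1)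
    (fun x y => by rw [← hK']; exact (hf x y).2)
  refine ⟨QBrace.liftBialgHom hb f, ⟨fun a l => ⟨(key a l).1, (key l a).2⟩,
    fun x => (QBrace.liftHopf_gen hb f x).symm⟩, ?_⟩
  rintro g ⟨-, hg⟩
  have : (g : QBrace.FreeHopf k X →ₐ[k] L) = QBrace.liftHopf hb f :=
    QBrace.FreeHopf.algHom_ext_zero fun x => (hg x).symm.trans (QBrace.liftHopf_gen hb f x).symm
  exact DFunLike.ext _ _ fun a => DFunLike.congr_fun this a
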